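/- Let $T$ be an oriented tangle diagram in a disk with exactly two endpoints on the boundary of the disk: one strand joins the two endpoints, and there may be further closed components. Let $\hat T$ be the oriented link obtained by connecting the two endpoints of $T$ outside the disk. **State sum.** At a crossing, turn the picture so that both strands run upwards, and call the corners $SW, SE$ (incoming) and $NW, NE$ (outgoing). Replace the crossing by the formal linear combination $$q^{\varepsilon}\,[SW\!-\!NW,\ SE\!-\!NE] + q\,\big([SE\!-\!NW]-[SE\!-\!NE]-[\,]\big) + q^{-1}\big([SW\!-\!NE]-[SW\!-\!NW]-[\,]\big),$$ where $\varepsilon=1$ for a positive (right-handed) crossing and $\varepsilon=-1$ for a negative (left-handed) one; a bracket denotes the crossingless picture in which the listed pairs of corners are joined by a strand, and every remaining corner is attached to a short strand that ends in the interior. Expanding all $n$ crossings multilinearly gives $T=\sum_{i=1}^{7^n}\lambda_i D_i$ with $\lambda_i=\pm q^{k_i}$ and crossingless diagrams $D_i$. Let $\Delta(T)\in\mathbb Z[q,q^{-1}]$ be the sum of the $\lambda_i$ over those $i$ for which $D_i$ has no closed loop and has a strand joining the two boundary endpoints (strands with both endpoints in the interior are allowed). **Turning number.** Smooth every crossing of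 $T$ according to the orientation ($SW\!-\!NW$, $SE\!-\!NE$ in the notation above). Let $\tau(T)$ be the number of counterclockwise minus the number of clockwise closed loops of the resulting diagram. **Alexander polynomial.** There is exactly one isotopy invariant $A$ of (nonempty) oriented links, with values in $\mathbb Z[q,q^{-1}]$, that equals $1$ on the unknot and satisfies the Alexander–Conway skein relation $A(L_+)-A(L_-)=(q-q^{-1})A(L_0)$ for all links $L_+,L_-,L_0$ whose diagrams agree except at one place, where they have a positive crossing, a negative crossing and its oriented smoothing, respectively. It is the one-variable Alexander(–Conway) polynomial. **Theorem.** For every such $T$, $$(-q)^{-\tau(T)}\,\Delta(T)=A(\hat T).$$ -/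

import Mathlib

/-!
Oriented tangle diagrams are drawn in generic (Morse) position in a box and read from bottom to top:
a diagram is a finite list of horizontal slices, each containing exactly one elementary piece
(a minimum, a maximum or a crossing) between vertical strands.  A boundary line is the list of the
orientations of the strands that meet it, `true` for a strand running upwards, `false` for downwards.
-/

namespace TangleDiagram

/-- Elementary pieces.
* `cup o`: a local minimum `∪`; its left leg has orientation `o`, its right leg `!o`.
* `cap o`: a local maximum `∩`; its left leg has orientation `o`, its right leg `!o`.
* `cross a b f`: a crossing of the strand `/` (bottom left to top right), which has orientation `a`,
  with the strand `\` (bottom right to top left), which has orientation `b`;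
  `/` is the overstrand iff `f = true`. -/
inductive Piece where
  | cup (o : Bool)
  | cap (o : Bool)
  | cross (a b f : Bool)

/-- Orientations at the bottom of a piece. -/
def Piece.src : Piece → List Bool
  | .cup _ => []
  | .cap o => [o, !o]
  | .cross a b _ => [a, b]

/-- Orientations at the top of a piece. -/
def Piece.tgt : Piece → List Bool
  | .cup o => [o, !o]
  | .cap _ => []
  | .cross a b _ => [b, a]

/-- An elementary piece with vertical strands to its left and to its right. -/
structure Slice where
  left : List Bool
  piece : Piece
  right : List Bool

def Slice.src (x : Slice) : List Bool := x.left ++ x.piece.src ++ x.right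

def Slice.tgt (x : Slice) : List Bool := x.left ++ x.piece.tgt ++ x.right

/-- `IsPath s w t`: the slices of `w`, stacked from bottom to top, fit together to an oriented
diagram with bottom boundary `s` and top boundary `t`. -/
def IsPath : List Bool → List Slice → List Bool → Prop
  | s, [], t => s = t
  | s, x :: w, t => x.src = s ∧ IsPath x.tgt w t

/-- Add vertical strands on both sides of a diagram. -/
def whisker (l : List Bool) (w : List Slice) (r : List Bool) : List Slice :=
  w.map fun x => ⟨l ++ x.left, x.piece, x.right ++ r⟩

theorem IsPath.append {s t u : List Bool} {w w' : List Slice} (h : IsPath s w t)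
    (h' : IsPath t w' u) : IsPath s (w ++ w') u := by
  induction w generalizing s with
  | nil => cases h; exact h'
  | cons x w ih => exact ⟨h.1, ih h.2⟩

theorem IsPath.whisker {s t : List Bool} {w : List Slice} (h : IsPath s w t)
    (l r : List Bool) : IsPath (l ++ s ++ r) (whisker l w r) (l ++ t ++ r) := by
  induction w generalizing s with
  | nil => cases h; rfl
  | cons x w ih =>
    obtain ⟨rfl, h⟩ := h
    refine ⟨by simp [Slice.src], ?_⟩
    have := ih h
    simpa [TangleDiagram.whisker, Slice.tgt] using this

/-- Oriented tangle diagrams with bottom boundary `s` and top boundary `t`. -/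
structure Tangle (s t : List Bool) where
  word : List Slice
  isPath : IsPath s word t

/-- Diagrams of oriented links with at least one component. -/
structure LinkDiagram where
  word : List Slice
  isPath : IsPath [] word []
  nonempty : word ≠ []

/-- The closure of a tangle diagram with one endpoint at the bottom and one at the top: the two
endpoints are joined by an arc that runs around the right side of the box. -/
def Tangle.closure {a : Bool} (T : Tangle [a] [a]) : LinkDiagram where
  word := ⟨[], .cup a, []⟩ :: (whisker [] T.word [!a] ++ [⟨[], .cap a, []⟩])
  isPath := by
    have h : IsPath ([] ++ [a] ++ [!a]) [⟨[], .cap a, []⟩] [] := ⟨rfl, rfl⟩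
    exact ⟨rfl, (T.isPath.whisker [] [!a]).append h⟩
  nonempty := by simp

/-! ### Isotopy of oriented links -/

/-- The local moves: planar isotopies and Reidemeister moves, for all orientations and all choices
of over- and undercrossings. -/
inductive LocalMove : List Slice → List Slice → Prop
  /-- Two pieces side by side may be drawn at either relative height. -/
  | interchange (p p' : Piece) (m : List Bool) :
      LocalMove [⟨[], p, m ++ p'.src⟩, ⟨p.tgt ++ m, p', []⟩]
        [⟨p.src ++ m, p', []⟩, ⟨[], p, m ++ p'.tgt⟩]
  /-- Straightening a zigzag. -/
  | zigzagLeft (o : Bool) :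
      LocalMove [⟨[o], .cup (!o), []⟩, ⟨[], .cap o, [o]⟩] []
  | zigzagRight (o : Bool) :
      LocalMove [⟨[], .cup o, [o]⟩, ⟨[o], .cap (!o), []⟩] []
  /-- A maximum or a minimum moves across (over or under) a strand of orientation `a`. -/
  | slideCap (o a f : Bool) :
      LocalMove [⟨[], .cross o a f, [!o]⟩, ⟨[a], .cap o, []⟩]
        [⟨[o], .cross a (!o) (!f), []⟩, ⟨[], .cap o, [a]⟩]
  | slideCup (o a f : Bool) :
      LocalMove [⟨[a], .cup o, []⟩, ⟨[], .cross a o f, [!o]⟩]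
        [⟨[], .cup o, [a]⟩, ⟨[o], .cross (!o) a (!f), []⟩]
  /-- Reidemeister I, with the curl on either side. -/
  | reidemeisterOneRight (o f : Bool) :
      LocalMove [⟨[o], .cup o, []⟩, ⟨[], .cross o o f, [!o]⟩, ⟨[o], .cap o, []⟩] []
  | reidemeisterOneLeft (o f : Bool) :
      LocalMove [⟨[], .cup (!o), [o]⟩, ⟨[!o], .cross o o f, []⟩, ⟨[], .cap (!o), [o]⟩] []
  /-- Reidemeister II. -/
  | reidemeisterTwo (a b f : Bool) :
      LocalMove [⟨[], .cross a b f, []⟩, ⟨[], .cross b a (!f), []⟩] []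
  /-- Reidemeister III for strands `a`, `b`, `c`; `f`, `g`, `h` tell whether `a` is over `b`,
  `b` over `c`, `a` over `c`.  The hypothesis says that these relations are not cyclic. -/
  | reidemeisterThree (a b c f g h : Bool) (hfgh : f = g → h = f) :
      LocalMove
        [⟨[], .cross a b f, [c]⟩, ⟨[b], .cross a c h, []⟩, ⟨[], .cross b c g, [a]⟩]
        [⟨[a], .cross b c g, []⟩, ⟨[], .cross a c h, [b]⟩, ⟨[c], .cross a b f, []⟩]

/-- A local move inside a larger diagram. -/
def Move (w w' : List Slice) : Prop :=
  ∃ (u v x y : List Slice) (l r : List Bool), LocalMove x y ∧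
    w = u ++ whisker l x r ++ v ∧ w' = u ++ whisker l y r ++ v

/-- Two link diagrams present isotopic oriented links. -/
def Isotopic : LinkDiagram → LinkDiagram → Prop :=
  Relation.EqvGen fun L L' => Move L.word L'.word

/-! ### The Alexander polynomial through the skein relation -/

open LaurentPolynomial

/-- The sign of a crossing: `true` for a positive (right-handed) one. -/
def isPositive (a b f : Bool) : Bool := f == (a == b)

/-- The oriented smoothing of a crossing with orientations `a`, `b` between strands `l`, `r`. -/
def smoothCrossing (l : List Bool) (a b : Bool) (r : List Bool) : List Slice :=
  if a = b then [] else [⟨l, .cap a, r⟩, ⟨l, .cup b, r⟩]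

/-- Three diagrams that agree except at one place, where they have a positive crossing, a negative
crossing and the oriented smoothing. -/
def SkeinTriple (Lp Lm L0 : LinkDiagram) : Prop :=
  ∃ (u v : List Slice) (l r : List Bool) (a b fp fm : Bool),
    isPositive a b fp = true ∧ isPositive a b fm = false ∧
    Lp.word = u ++ [⟨l, .cross a b fp, r⟩] ++ v ∧
    Lm.word = u ++ [⟨l, .cross a b fm, r⟩] ++ v ∧
    L0.word = u ++ smoothCrossing l a b r ++ v

/-- The diagram of the unknot without crossings. -/
def unknot : LinkDiagram where
  word := [⟨[], .cup true, []⟩, ⟨[], .cap true, []⟩]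
  isPath := ⟨rfl, rfl, rfl⟩
  nonempty := by simp

/-- The defining properties of the one-variable Alexander(-Conway) polynomial, as a function of
link diagrams with values in `ℤ[q, q⁻¹]`, where `q = T 1`. -/
structure IsAlexanderPolynomial (A : LinkDiagram → ℤ[T;T⁻¹]) : Prop where
  invariant : ∀ L L', Isotopic L L' → A L = A L'
  unknot : A unknot = 1
  skein : ∀ Lp Lm L0, SkeinTriple Lp Lm L0 → A Lp - A Lm = (T 1 - T (-1)) * A L0

/-! ### Diagrams without crossings, whose strands may end in the interior -/

/-- Unoriented elementary pieces: `birth` is a strand that starts at an interior endpoint and leaves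
through the top, `death` a strand that comes from the bottom and ends at an interior endpoint. -/
inductive FlatPiece where
  | cup
  | cap
  | birth
  | death

/-- Turning a piece upside down. -/
def FlatPiece.flip : FlatPiece → FlatPiece
  | .cup => .cap
  | .cap => .cup
  | .birth => .death
  | .death => .birth

/-- A piece with `left` vertical strands to its left and `right` ones to its right. -/
structure FlatSlice where
  left : ℕ
  piece : FlatPiece
  right : ℕ

/-- Enter the piece `p`, with `l` strands to its left, from below at position `i` (counted from the
left, from `0`), and follow the strand: `some (true, j)` if it leaves through the top at position
`j`, `some (false, j)` if it turns back and leaves through the bottom at position `j`, `none` if it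
ends in the interior. -/
def pass (l : ℕ) (p : FlatPiece) (i : ℕ) : Option (Bool × ℕ) :=
  if i < l then some (true, i) else
  match p with
  | .cup => some (true, i + 2)
  | .birth => some (true, i + 1)
  | .death => if i = l then none else some (true, i - 1)
  | .cap => if i = l then some (false, l + 1) else
      if i = l + 1 then some (false, l) else some (true, i - 2)

/-- A point where a strand meets the line below slice number `level` (or the top line, if `level` is
the number of slices), with a direction of travel along the strand. -/
structure Node where
  level : ℕ
  pos : ℕ
  up : Bool

/-- The next node met when travelling along the strand through a node, if there is one. -/
def next (D : List FlatSlice) (x : Node) : Option Node :=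
  if x.up then
    (D[x.level]?).bind fun s => (pass s.left s.piece x.pos).map fun y =>
      if y.1 then ⟨x.level + 1, y.2, true⟩ else ⟨x.level, y.2, false⟩
  else
    match x.level with
    | 0 => none
    | k + 1 => (D[k]?).bind fun s => (pass s.left s.piece.flip x.pos).map fun y =>
        if y.1 then ⟨k, y.2, false⟩ else ⟨k + 1, y.2, true⟩

def Step (D : List FlatSlice) (x y : Node) : Prop := next D x = some y

/-- The diagram contains a closed loop. -/
def HasLoop (D : List FlatSlice) : Prop := ∃ x, Relation.TransGen (Step D) x x

/-- In a diagram with one boundary point at the bottom and one at the top, these two points are the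
endpoints of one strand. -/
def HasThroughStrand (D : List FlatSlice) : Prop :=
  Relation.ReflTransGen (Step D) ⟨0, 0, true⟩ ⟨D.length, 0, true⟩

/-! ### The state sum -/

/-- The pictures that replace a crossing. The corners that are not joined in a picture end in short
strands with an interior endpoint. -/
inductive Picture where
  /-- bottom left to top left, and bottom right to top right -/
  | vertical
  /-- bottom left to bottom right, and top left to top right -/
  | horizontal
  /-- bottom left to top right -/
  | slash
  /-- bottom right to top left -/
  | backslash
  /-- bottom left to top left -/
  | leftEdge
  /-- bottom right to top right -/
  | rightEdge
  /-- bottom left to bottom right -/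
  | bottomEdge
  /-- top left to top right -/
  | topEdge
  /-- no corners are joined -/
  | ticks

/-- A picture as a diagram, with `l` strands to its left and `r` to its right. -/
def Picture.word (l r : ℕ) : Picture → List FlatSlice
  | .vertical => []
  | .horizontal => [⟨l, .cap, r⟩, ⟨l, .cup, r⟩]
  | .slash => [⟨l + 1, .death, r⟩, ⟨l, .birth, r + 1⟩]
  | .backslash => [⟨l, .death, r + 1⟩, ⟨l + 1, .birth, r⟩]
  | .leftEdge => [⟨l + 1, .death, r⟩, ⟨l + 1, .birth, r⟩]
  | .rightEdge => [⟨l, .death, r + 1⟩, ⟨l, .birth, r + 1⟩]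
  | .bottomEdge => [⟨l, .cap, r⟩, ⟨l, .birth, r⟩, ⟨l, .birth, r + 1⟩]
  | .topEdge => [⟨l, .death, r + 1⟩, ⟨l, .death, r⟩, ⟨l, .cup, r⟩]
  | .ticks => [⟨l, .death, r + 1⟩, ⟨l, .death, r⟩, ⟨l, .birth, r⟩, ⟨l, .birth, r + 1⟩]

/-- The oriented smoothing of a crossing, with orientations forgotten. -/
def smoothing : Bool → Bool → Picture
  | true, true => .vertical
  | false, false => .vertical
  | true, false => .horizontal
  | false, true => .horizontal

/-- The edge of the smoothing on the left-hand side, for someone travelling along with the two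
strands of the crossing. -/
def leftSide : Bool → Bool → Picture
  | true, true => .leftEdge
  | false, false => .rightEdge
  | true, false => .topEdge
  | false, true => .bottomEdge

/-- The edge of the smoothing on the right-hand side. -/
def rightSide : Bool → Bool → Picture
  | true, true => .rightEdge
  | false, false => .leftEdge
  | true, false => .bottomEdge
  | false, true => .topEdge

/-- The strand of the crossing that comes in on the right-hand side and goes out on the left. -/
def rightToLeft : Bool → Bool → Picture
  | true, true => .backslash
  | false, false => .backslash
  | true, false => .slash
  | false, true => .slash

/-- The strand of the crossing that comes in on the left-hand side and goes out on the right. -/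
def leftToRight : Bool → Bool → Picture
  | true, true => .slash
  | false, false => .slash
  | true, false => .backslash
  | false, true => .backslash

/-- A crossing as a linear combination of seven pictures, given by its list of terms. -/
noncomputable def crossingTerms (a b f : Bool) : List (ℤ[T;T⁻¹] × Picture) :=
  [(if isPositive a b f then T 1 else T (-1), smoothing a b),
   (T 1, rightToLeft a b), (-T 1, rightSide a b), (-T 1, .ticks),
   (T (-1), leftToRight a b), (-T (-1), leftSide a b), (-T (-1), .ticks)]

/-- The terms that replace a slice. -/
noncomputable def Slice.terms (x : Slice) : List (ℤ[T;T⁻¹] × List FlatSlice) :=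
  match x.piece with
  | .cup _ => [(1, [⟨x.left.length, .cup, x.right.length⟩])]
  | .cap _ => [(1, [⟨x.left.length, .cap, x.right.length⟩])]
  | .cross a b f =>
      (crossingTerms a b f).map fun t => (t.1, t.2.word x.left.length x.right.length)

/-- The multilinear expansion of a diagram with `n` crossings into `7 ^ n` terms `(λ, D)`. -/
noncomputable def expand : List Slice → List (ℤ[T;T⁻¹] × List FlatSlice)
  | [] => [(1, [])]
  | x :: w => x.terms.flatMap fun t => (expand w).map fun t' => (t.1 * t'.1, t.2 ++ t'.2)

open Classical in
/-- The state sum `Δ(T)`: the sum of the coefficients `λ` of those terms `(λ, D)` for which `D` has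
no closed loop and one strand that joins the two boundary points. -/
noncomputable def Tangle.Delta {a : Bool} (T : Tangle [a] [a]) : ℤ[T;T⁻¹] :=
  ((expand T.word).map fun t => if ¬ HasLoop t.2 ∧ HasThroughStrand t.2 then t.1 else 0).sum

/-! ### The turning number -/

/-- Smooth the crossing of a slice, if it has one. -/
def Slice.smooth (x : Slice) : List Slice :=
  match x.piece with
  | .cup _ => [x]
  | .cap _ => [x]
  | .cross a b _ => smoothCrossing x.left a b x.right

/-- Smooth every crossing according to the orientations. -/
def smooth (w : List Slice) : List Slice := w.flatMap Slice.smooth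

/-- Forget the orientations; meant for slices without a crossing. -/
def Slice.flat (x : Slice) : List FlatSlice :=
  match x.piece with
  | .cup _ => [⟨x.left.length, .cup, x.right.length⟩]
  | .cap _ => [⟨x.left.length, .cap, x.right.length⟩]
  | .cross _ _ _ => []

/-- In the diagram `D`, the maximum in slice number `k`, with `l` strands to its left, lies on a
closed loop and is the highest maximum of this loop. -/
def IsTopOfLoop (D : List FlatSlice) (k l : ℕ) : Prop :=
  Relation.TransGen (Step D) ⟨k, l, true⟩ ⟨k, l, true⟩ ∧
    ∀ y, Relation.TransGen (Step D) ⟨k, l, true⟩ y → y.level ≤ k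

open Classical in
/-- The contribution of slice number `k` of a crossingless diagram to the turning number: if the
slice contains the highest maximum of a closed loop, then `1` or `-1` according as the loop runs
counterclockwise (from right to left at its highest point) or clockwise (from left to right). -/
noncomputable def loopSign (w : List Slice) (k : Fin w.length) : ℤ :=
  match w[k].piece with
  | .cap o =>
      if IsTopOfLoop (w.flatMap Slice.flat) k w[k].left.length then (if o then -1 else 1) else 0
  | _ => 0

/-- The turning number: the number of counterclockwise minus the number of clockwise loops of the
smoothed diagram. -/
noncomputable def Tangle.turningNumber {a : Bool} (T : Tangle [a] [a]) : ℤ :=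
  ∑ k, loopSign (smooth T.word) k

/-- The unit `-q` of `ℤ[q, q⁻¹]`. -/
noncomputable def negQ : (ℤ[T;T⁻¹])ˣ where
  val := -T 1
  inv := -T (-1)
  val_inv := by rw [neg_mul_neg, ← T_add]; simp
  inv_val := by rw [neg_mul_neg, ← T_add]; simp

end TangleDiagram

/-! The state sum is a matrix entry of an operator invariant of gl(1|1) type. Every strand carries
one of two colours. A crossing acts by the sum of its seven pictures, in which joined corners have
equal colours and an open corner has colour `false`. A maximum or minimum that runs from right to
left gives the sign -1 to the colour `true`; in addition it carries the factor -q at a minimum and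
(-q)⁻¹ at a maximum. Apart from these powers, a closed loop has value 1 - 1 = 0, a strand with two
interior ends has value 1, and a strand from a boundary point of colour `true` into the interior has
value 0. Evaluation at the boundary colour `true` therefore keeps exactly the terms counted by Δ(T).
The power of -q depends only on the oriented diagram, not on the chosen pictures, and its exponent
is -τ(T).

Existence of the Alexander polynomial. Invariance under local moves and the skein relation are
finite checks with the table `crossing_apply`; the third Reidemeister move is checked for one
ordering of the heights and carried over to the others (`braidRelation`). Since a circle has value
0, a link has to be cut open before it is evaluated, and `stateInvariant` cuts it at its last
maximum. The one point that is not local is independence of the cut. It holds because diagrams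
intertwine two odd operators, the odd generators of the quantum group (`oddOp_wordOp`): a vector on
two pairs of strands that is killed by both has equal partial traces over either pair, up to
normalisation (`cut_aux`).

Uniqueness. The difference of two solutions vanishes on the unknot, and then on every diagram with a
split circle, because the two curls of Reidemeister I differ by such a diagram in the skein
relation. Modulo isotopy and skein relation, every diagram without lower boundary is a combination
of layered diagrams, in which each arc passes over all earlier ones; this is shown by adding one
slice at a time (`acts_of_isPath`). With empty upper boundary only the empty diagram is layered, and
the difference, extended by zero, vanishes there.

Evaluation of states. Read from the bottom, a crossingless diagram produces a noncrossing partial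
matching of the points of each horizontal line. Its vector is a product of arc weights times one
scalar for each component already completed (`orientedOp_matchingValue`). Two specialisations are
used: colours with weights 1 and -1 give Δ(T), and a single colour with weight q gives the exponent
-τ(T) (`Tangle.turningNumber_eq`). The matchings are compared with actual travel along strands in
`joins_and_ends`. -/

namespace TangleDiagram

/-! ### Operators on functions of colourings

A colouring of the strands that meet a horizontal line is an infinite sequence, of which only an
initial segment matters. -/

section Operators

variable {γ : Type*}

/-- Prepend a colour to a colouring. -/
def scons (x : γ) (c : ℕ → γ) : ℕ → γ
  | 0 => x
  | n + 1 => c n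

/-- Forget the first colour. -/
def stail (c : ℕ → γ) : ℕ → γ := fun n => c (n + 1)

@[simp] theorem scons_zero (x : γ) (c : ℕ → γ) : scons x c 0 = x := rfl

@[simp] theorem scons_succ (x : γ) (c : ℕ → γ) (n : ℕ) : scons x c (n + 1) = c n := rfl

@[simp] theorem scons_one (x : γ) (c : ℕ → γ) : scons x c 1 = c 0 := rfl

@[simp] theorem stail_scons (x : γ) (c : ℕ → γ) : stail (scons x c) = c := rfl

@[simp] theorem stail_apply (c : ℕ → γ) (n : ℕ) : stail c n = c (n + 1) := rfl

theorem scons_eta (c : ℕ → γ) : scons (c 0) (stail c) = c := by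
  funext n; cases n <;> rfl

theorem exists_scons (c : ℕ → γ) : ∃ x d, c = scons x d := ⟨_, _, (scons_eta c).symm⟩

variable {K : Type*} [CommRing K]

/-- Let an operator act on all strands but the leftmost one. -/
def lift (F : Module.End K ((ℕ → γ) → K)) : Module.End K ((ℕ → γ) → K) where
  toFun v c := F (fun d => v (scons (c 0) d)) (stail c)
  map_add' v w := by
    funext c
    exact congrFun (map_add F (fun d => v (scons (c 0) d)) (fun d => w (scons (c 0) d))) (stail c)
  map_smul' k v := by
    funext c
    exact congrFun (map_smul F k (fun d => v (scons (c 0) d))) (stail c)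

@[simp] theorem lift_apply (F : Module.End K ((ℕ → γ) → K)) (v : (ℕ → γ) → K) (x : γ) (c : ℕ → γ) :
    lift F v (scons x c) = F (fun d => v (scons x d)) c := rfl

theorem lift_mul (F G : Module.End K ((ℕ → γ) → K)) : lift (F * G) = lift F * lift G := rfl

theorem lift_one : lift (1 : Module.End K ((ℕ → γ) → K)) = 1 := by
  ext v c
  simp [lift, scons_eta]

theorem lift_add (F G : Module.End K ((ℕ → γ) → K)) : lift (F + G) = lift F + lift G := rfl

theorem lift_sub (F G : Module.End K ((ℕ → γ) → K)) : lift (F - G) = lift F - lift G := rfl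

theorem lift_smul (k : K) (F : Module.End K ((ℕ → γ) → K)) : lift (k • F) = k • lift F := rfl

/-- Let an operator act on all strands but the `n` leftmost ones. -/
def liftN (n : ℕ) (F : Module.End K ((ℕ → γ) → K)) : Module.End K ((ℕ → γ) → K) := lift^[n] F

@[simp] theorem liftN_zero (F : Module.End K ((ℕ → γ) → K)) : liftN 0 F = F := rfl

theorem liftN_succ (n : ℕ) (F : Module.End K ((ℕ → γ) → K)) : liftN (n + 1) F = lift (liftN n F) :=
  Function.iterate_succ_apply' lift n F

theorem liftN_add (m n : ℕ) (F : Module.End K ((ℕ → γ) → K)) :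
    liftN (m + n) F = liftN m (liftN n F) :=
  Function.iterate_add_apply lift m n F

theorem liftN_mul (n : ℕ) (F G : Module.End K ((ℕ → γ) → K)) :
    liftN n (F * G) = liftN n F * liftN n G := by
  induction n with
  | zero => rfl
  | succ n ih => simp only [liftN_succ, ih, lift_mul]

theorem liftN_one (n : ℕ) : liftN n (1 : Module.End K ((ℕ → γ) → K)) = 1 := by
  induction n with
  | zero => rfl
  | succ n ih => simp only [liftN_succ, ih, lift_one]

theorem liftN_sub (n : ℕ) (F G : Module.End K ((ℕ → γ) → K)) :
    liftN n (F - G) = liftN n F - liftN n G := by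
  induction n with
  | zero => rfl
  | succ n ih => simp only [liftN_succ, ih, lift_sub]

theorem liftN_smul (n : ℕ) (k : K) (F : Module.End K ((ℕ → γ) → K)) :
    liftN n (k • F) = k • liftN n F := by
  induction n with
  | zero => rfl
  | succ n ih => simp only [liftN_succ, ih, lift_smul]

theorem liftN_listSum (n : ℕ) (l : List (Module.End K ((ℕ → γ) → K))) :
    liftN n l.sum = (l.map (liftN n)).sum := by
  induction n with
  | zero => exact congrArg List.sum (List.map_id l).symm
  | succ n ih =>
    have h : ∀ l : List (Module.End K ((ℕ → γ) → K)), lift l.sum = (l.map lift).sum := by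
      intro l
      induction l with
      | nil => rfl
      | cons F l ih => simp [lift_add, ih]
    rw [liftN_succ, ih, h, List.map_map]
    congr 1
    exact List.map_congr_left fun F _ => (liftN_succ n F).symm

/-- Two strands of the same colour `x` end in a maximum, with weight `w x`. -/
def capOp [Fintype γ] (w : γ → K) : Module.End K ((ℕ → γ) → K) where
  toFun v c := ∑ x, w x * v (scons x (scons x c))
  map_add' v w' := by funext c; simp [mul_add, Finset.sum_add_distrib]
  map_smul' k v := by funext c; simp [Finset.mul_sum, mul_left_comm]

/-- Two strands of the same colour `x` start in a minimum, with weight `w x`. -/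
def cupOp [DecidableEq γ] (w : γ → K) : Module.End K ((ℕ → γ) → K) where
  toFun v c := if c 0 = c 1 then w (c 0) * v (stail (stail c)) else 0
  map_add' v w' := by funext c; simp only [Pi.add_apply]; split_ifs <;> ring
  map_smul' k v := by
    funext c; simp only [Pi.smul_apply, smul_eq_mul, RingHom.id_apply]; split_ifs <;> ring

/-- A strand of colour `x` starts, with weight `w x`. -/
def birthOp (w : γ → K) : Module.End K ((ℕ → γ) → K) where
  toFun v c := w (c 0) * v (stail c)
  map_add' v w' := by funext c; simp only [Pi.add_apply]; ring
  map_smul' k v := by funext c; simp only [Pi.smul_apply, smul_eq_mul, RingHom.id_apply]; ring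

/-- A strand of colour `x` ends, with weight `w x`. -/
def deathOp [Fintype γ] (w : γ → K) : Module.End K ((ℕ → γ) → K) where
  toFun v c := ∑ x, w x * v (scons x c)
  map_add' v w' := by funext c; simp [mul_add, Finset.sum_add_distrib]
  map_smul' k v := by funext c; simp [Finset.mul_sum, mul_left_comm]

/-- Two strands of colours `x`, `y` turn into two strands of colours `x'`, `y'`, with weight
`M x y x' y'`. -/
def crossOp [Fintype γ] (M : γ → γ → γ → γ → K) : Module.End K ((ℕ → γ) → K) where
  toFun v c := ∑ x, ∑ y, M x y (c 0) (c 1) * v (scons x (scons y (stail (stail c))))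
  map_add' v w' := by funext c; simp [mul_add, Finset.sum_add_distrib]
  map_smul' k v := by funext c; simp [Finset.mul_sum, mul_left_comm]

theorem capOp_apply [Fintype γ] (w : γ → K) (v : (ℕ → γ) → K) (c : ℕ → γ) :
    capOp w v c = ∑ x, w x * v (scons x (scons x c)) := rfl

theorem cupOp_apply [DecidableEq γ] (w : γ → K) (v : (ℕ → γ) → K) (x y : γ) (c : ℕ → γ) :
    cupOp w v (scons x (scons y c)) = if x = y then w x * v c else 0 := rfl

theorem birthOp_apply (w : γ → K) (v : (ℕ → γ) → K) (x : γ) (c : ℕ → γ) :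
    birthOp w v (scons x c) = w x * v c := rfl

theorem deathOp_apply [Fintype γ] (w : γ → K) (v : (ℕ → γ) → K) (c : ℕ → γ) :
    deathOp w v c = ∑ x, w x * v (scons x c) := rfl

theorem crossOp_apply [Fintype γ] (M : γ → γ → γ → γ → K) (v : (ℕ → γ) → K) (x' y' : γ)
    (c : ℕ → γ) : crossOp M v (scons x' (scons y' c)) =
      ∑ x, ∑ y, M x y x' y' * v (scons x (scons y c)) := rfl

theorem sum_apply_apply {ι : Type*} (s : Finset ι) (F : Module.End K ((ℕ → γ) → K)) (a : ι → K)
    (v : ι → (ℕ → γ) → K) (c : ℕ → γ) :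
    F (fun d => ∑ i ∈ s, a i * v i d) c = ∑ i ∈ s, a i * F (v i) c := by
  have h : (fun d => ∑ i ∈ s, a i * v i d) = ∑ i ∈ s, a i • v i := by
    funext d; simp
  rw [h, map_sum]
  simp

/-- Far commutativity: the piece reads only the first two colours and forms a linear combination of
its arguments, through which a linear operator on the other strands passes. The two statements after
it have the same reason. -/
theorem capOp_mul_lift [Fintype γ] (w : γ → K) (F : Module.End K ((ℕ → γ) → K)) :
    capOp w * liftN 2 F = F * capOp w := by
  ext v c
  exact (sum_apply_apply Finset.univ F w (fun x d => v (scons x (scons x d))) c).symm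

theorem cupOp_mul [DecidableEq γ] (w : γ → K) (F : Module.End K ((ℕ → γ) → K)) :
    cupOp w * F = liftN 2 F * cupOp w := by
  ext v c
  obtain ⟨x, c, rfl⟩ := exists_scons c
  obtain ⟨y, c, rfl⟩ := exists_scons c
  change (if x = y then w x * F v c else 0) = F (fun d => if x = y then w x * v d else 0) c
  split_ifs
  · exact (congrFun (map_smul F (w x) v) c).symm
  · exact (congrFun (map_zero F) c).symm

theorem crossOp_mul_lift [Fintype γ] (M : γ → γ → γ → γ → K) (F : Module.End K ((ℕ → γ) → K)) :
    crossOp M * liftN 2 F = liftN 2 F * crossOp M := by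
  ext v c
  obtain ⟨x', c, rfl⟩ := exists_scons c
  obtain ⟨y', c, rfl⟩ := exists_scons c
  change ∑ x, ∑ y, M x y x' y' * F (fun d => v (scons x (scons y d))) c =
    F (fun d => ∑ x, ∑ y, M x y x' y' * v (scons x (scons y d))) c
  simp only [← Finset.sum_product']
  exact (sum_apply_apply _ F (fun z : γ × γ => M z.1 z.2 x' y')
    (fun z d => v (scons z.1 (scons z.2 d))) c).symm

end Operators

/-! ### The operator invariant -/

section Functor

variable {K : Type*} [CommRing K]

/-- The sign of a strand of colour `x` at a maximum whose left leg has orientation `o`. -/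
def colourSign (o x : Bool) : K := if !o && x then -1 else 1

/-- The weight of a picture in a crossing with orientations `a`, `b`, for the colours `x`, `y` of the
bottom corners and `x'`, `y'` of the top corners. -/
def Picture.weight (a b : Bool) (x y x' y' : Bool) : Picture → K
  | .vertical => if x = x' ∧ y = y' then 1 else 0
  | .horizontal => if x = y ∧ x' = y' then colourSign a x * colourSign (!b) x' else 0
  | .slash => if x = y' ∧ y = false ∧ x' = false then 1 else 0
  | .backslash => if y = x' ∧ x = false ∧ y' = false then 1 else 0
  | .leftEdge => if x = x' ∧ y = false ∧ y' = false then 1 else 0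
  | .rightEdge => if y = y' ∧ x = false ∧ x' = false then 1 else 0
  | .bottomEdge => if x = y ∧ x' = false ∧ y' = false then colourSign a x else 0
  | .topEdge => if x' = y' ∧ x = false ∧ y = false then colourSign (!b) x' else 0
  | .ticks => if x = false ∧ y = false ∧ x' = false ∧ y' = false then 1 else 0

variable (q p : K)

/-- The weights of a crossing. -/
def crossWeight (a b f : Bool) (x y x' y' : Bool) : K :=
  (if isPositive a b f then q else p) * (smoothing a b).weight a b x y x' y' +
    (q * (rightToLeft a b).weight a b x y x' y' - q * (rightSide a b).weight a b x y x' y' -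
      q * Picture.ticks.weight a b x y x' y') +
    (p * (leftToRight a b).weight a b x y x' y' - p * (leftSide a b).weight a b x y x' y' -
      p * Picture.ticks.weight a b x y x' y')

/-- The weights of a maximum. -/
def capWeight (o x : Bool) : K := if o then 1 else -p * colourSign o x

/-- The weights of a minimum. -/
def cupWeight (o x : Bool) : K := if o then -q * colourSign (!o) x else 1

/-- The operator of a piece. -/
def pieceOp : Piece → Module.End K ((ℕ → Bool) → K)
  | .cup o => cupOp (cupWeight q o)
  | .cap o => capOp (capWeight p o)
  | .cross a b f => crossOp (crossWeight q p a b f)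

/-- The operator of a slice. -/
def sliceOp (x : Slice) : Module.End K ((ℕ → Bool) → K) := liftN x.left.length (pieceOp q p x.piece)

/-- The operator of a diagram, from functions of the colours at the bottom to functions of the
colours at the top. -/
def wordOp : List Slice → Module.End K ((ℕ → Bool) → K)
  | [] => 1
  | x :: w => wordOp w * sliceOp q p x

theorem wordOp_append (w w' : List Slice) : wordOp q p (w ++ w') = wordOp q p w' * wordOp q p w := by
  induction w with
  | nil => simp [wordOp]
  | cons x w ih => simp [wordOp, ih, mul_assoc]

theorem wordOp_whisker (l r : List Bool) (w : List Slice) :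
    wordOp q p (whisker l w r) = liftN l.length (wordOp q p w) := by
  induction w with
  | nil => simp [whisker, wordOp, liftN_one]
  | cons x w ih =>
    change wordOp q p (whisker l w r) * liftN (l ++ x.left).length _ = _
    rw [ih, wordOp, liftN_mul, List.length_append, liftN_add]
    rfl

theorem pieceOp_mul_liftN (P : Piece) (F : Module.End K ((ℕ → Bool) → K)) :
    pieceOp q p P * liftN P.src.length F = liftN P.tgt.length F * pieceOp q p P := by
  cases P with
  | cup o => exact cupOp_mul _ F
  | cap o => exact capOp_mul_lift _ F
  | cross a b f => exact crossOp_mul_lift _ F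

end Functor

/-! ### Invariance under planar isotopy and Reidemeister moves I and II -/

section Moves

variable {K : Type*} [CommRing K] {q p : K}

theorem crossOp_ext {F G : Module.End K ((ℕ → Bool) → K)}
    (h : ∀ v x y z c, F v (scons x (scons y (scons z c))) = G v (scons x (scons y (scons z c)))) :
    F = G := by
  ext v c
  obtain ⟨x, c, rfl⟩ := exists_scons c
  obtain ⟨y, c, rfl⟩ := exists_scons c
  obtain ⟨z, c, rfl⟩ := exists_scons c
  exact h v x y z c

-- Most entries cancel once the seven pictures are added; every row keeps at most two. With this
-- table a move becomes a case distinction on colours followed by an identity in q and p.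
variable (q p) in
theorem crossing_apply (a b f : Bool) (v : (ℕ → Bool) → K) (x' y' : Bool) (c : ℕ → Bool) :
    pieceOp q p (.cross a b f) v (scons x' (scons y' c)) =
      match a, b, x', y' with
      | true, true, false, false | false, false, false, false => -(if f then p else q) * v (scons false (scons false c))
      | true, true, true, true | false, false, true, true => (if f then q else p) * v (scons true (scons true c))
      | true, true, false, true => p * v (scons true (scons false c)) + (if f then 0 else p - q) * v (scons false (scons true c))
      | true, true, true, false => q * v (scons false (scons true c)) + (if f then q - p else 0) * v (scons true (scons false c))
      | false, false, false, true => p * v (scons true (scons false c)) + (if f then q - p else 0) * v (scons false (scons true c))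
      | false, false, true, false => q * v (scons false (scons true c)) + (if f then 0 else p - q) * v (scons true (scons false c))
      | true, false, false, true => q * v (scons true (scons false c)) 
      | true, false, true, false => p * v (scons false (scons true c)) 
      | false, true, false, true => q * v (scons true (scons false c)) 
      | false, true, true, false => p * v (scons false (scons true c)) 
      | true, false, false, false => -(if f then q else p) * v (scons false (scons false c)) + (if f then p - q else 0) * v (scons true (scons true c))
      | true, false, true, true => (if f then p else q) * v (scons true (scons true c)) + (if f then 0 else q - p) * v (scons false (scons false c))
      | false, true, false, false => -(if f then q else p) * v (scons false (scons false c)) + (if f then 0 else p - q) * v (scons true (scons true c))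
      | false, true, true, true => (if f then p else q) * v (scons true (scons true c)) + (if f then q - p else 0) * v (scons false (scons false c)) := by
  cases a <;> cases b <;> cases f <;> cases x' <;> cases y' <;>
    simp [pieceOp, crossOp_apply, crossWeight, Picture.weight,
      smoothing, leftSide, rightSide, leftToRight, rightToLeft, isPositive, colourSign]
  all_goals ring

theorem wordOp_zigzagLeft (hqp : q * p = 1) (o : Bool) :
    wordOp q p [⟨[o], .cup (!o), []⟩, ⟨[], .cap o, [o]⟩] = wordOp q p [] := by
  refine crossOp_ext fun v x y z c => ?_
  cases o <;> cases x <;>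
    simp [wordOp, sliceOp, pieceOp, liftN_succ, capOp_apply, cupOp_apply, capWeight, cupWeight,
      colourSign] <;> linear_combination v _ * hqp

theorem wordOp_zigzagRight (hqp : q * p = 1) (o : Bool) :
    wordOp q p [⟨[], .cup o, [o]⟩, ⟨[o], .cap (!o), []⟩] = wordOp q p [] := by
  refine crossOp_ext fun v x y z c => ?_
  cases o <;> cases x <;>
    simp [wordOp, sliceOp, pieceOp, liftN_succ, capOp_apply, cupOp_apply, capWeight, cupWeight,
      colourSign] <;> linear_combination v _ * hqp

theorem wordOp_reidemeisterTwo (hqp : q * p = 1) (a b f : Bool) :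
    wordOp q p [⟨[], .cross a b f, []⟩, ⟨[], .cross b a (!f), []⟩] = wordOp q p [] := by
  refine crossOp_ext fun v x y z c => ?_
  cases a <;> cases b <;> cases f <;> cases x <;> cases y <;>
    simp [wordOp, sliceOp, crossing_apply] <;> grind

theorem capOp_capWeight_apply (o : Bool) (v : (ℕ → Bool) → K) (c : ℕ → Bool) :
    pieceOp q p (.cap o) v c = if o then v (scons true (scons true c)) + v (scons false (scons false c))
      else p * v (scons true (scons true c)) - p * v (scons false (scons false c)) := by
  cases o <;> simp [pieceOp, capOp_apply, capWeight, colourSign, sub_eq_add_neg]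

theorem cupOp_cupWeight_apply (o : Bool) (v : (ℕ → Bool) → K) (x y : Bool) (c : ℕ → Bool) :
    pieceOp q p (.cup o) v (scons x (scons y c)) =
      if x = y then (if o then (if x then q else -q) * v c else v c) else 0 := by
  cases o <;> cases x <;> cases y <;> simp [pieceOp, cupOp_apply, cupWeight, colourSign]

theorem wordOp_slideCap (o a f : Bool) :
    wordOp q p [⟨[], .cross o a f, [!o]⟩, ⟨[a], .cap o, []⟩] =
      wordOp q p [⟨[o], .cross a (!o) (!f), []⟩, ⟨[], .cap o, [a]⟩] := by
  refine crossOp_ext fun v x y z c => ?_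
  cases o <;> cases a <;> cases f <;> cases x <;>
    simp [wordOp, sliceOp, crossing_apply, capOp_capWeight_apply, liftN_succ] <;> grind

theorem wordOp_slideCup (o a f : Bool) :
    wordOp q p [⟨[a], .cup o, []⟩, ⟨[], .cross a o f, [!o]⟩] =
      wordOp q p [⟨[], .cup o, [a]⟩, ⟨[o], .cross (!o) a (!f), []⟩] := by
  refine crossOp_ext fun v x y z c => ?_
  cases o <;> cases a <;> cases f <;> cases x <;> cases y <;> cases z <;>
    simp [wordOp, sliceOp, crossing_apply, cupOp_cupWeight_apply, liftN_succ] <;> grind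

theorem wordOp_reidemeisterOneRight (hqp : q * p = 1) (o f : Bool) :
    wordOp q p [⟨[o], .cup o, []⟩, ⟨[], .cross o o f, [!o]⟩, ⟨[o], .cap o, []⟩] =
      wordOp q p [] := by
  refine crossOp_ext fun v x y z c => ?_
  cases o <;> cases f <;> cases x <;>
    simp [wordOp, sliceOp, crossing_apply, capOp_capWeight_apply, cupOp_cupWeight_apply,
      liftN_succ] <;> grind

theorem wordOp_reidemeisterOneLeft (hqp : q * p = 1) (o f : Bool) :
    wordOp q p [⟨[], .cup (!o), [o]⟩, ⟨[!o], .cross o o f, []⟩, ⟨[], .cap (!o), [o]⟩] =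
      wordOp q p [] := by
  refine crossOp_ext fun v x y z c => ?_
  cases o <;> cases f <;> cases x <;>
    simp [wordOp, sliceOp, crossing_apply, capOp_capWeight_apply, cupOp_cupWeight_apply,
      liftN_succ] <;> grind

end Moves

/-! ### The third Reidemeister move and the skein relation -/

section Moves

variable {K : Type*} [CommRing K] {q p : K}

theorem pieceOp_cross_mul (hqp : q * p = 1) (a b f : Bool) :
    pieceOp q p (.cross b a (!f)) * pieceOp q p (.cross a b f) = 1 := by
  simpa [wordOp, sliceOp] using wordOp_reidemeisterTwo hqp a b f

/-- The operator identity that belongs to a third Reidemeister move. -/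
def BraidRelation (q p : K) (a b c f g h : Bool) : Prop :=
  pieceOp q p (.cross b c g) * lift (pieceOp q p (.cross a c h)) * pieceOp q p (.cross a b f) =
    lift (pieceOp q p (.cross a b f)) * pieceOp q p (.cross a c h) * lift (pieceOp q p (.cross b c g))

/-- The only ordering of the heights that is checked on colours: the first strand above the second,
the second above the third. -/
theorem braidRelation_over (a b c : Bool) :
    BraidRelation q p a b c true true true := by
  refine crossOp_ext fun v x y z d => ?_
  cases a <;> cases b <;> cases c <;> cases x <;> cases y <;> cases z <;>
    simp only [crossing_apply, lift_apply, Module.End.mul_apply, if_true, zero_mul, add_zero] <;>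
    grind

/-- Multiplication by the inverse crossing of the first two strands, on either side of the relation,
exchanges the positions of these strands and leaves the heights alone. `BraidRelation.flip_right`
does this for the last two strands. -/
theorem BraidRelation.flip_left (hqp : q * p = 1) {a b c f g h : Bool}
    (H : BraidRelation q p a b c f g h) : BraidRelation q p b a c (!f) h g := by
  have h1 : pieceOp q p (.cross a b f) * pieceOp q p (.cross b a (!f)) = 1 := by
    simpa using pieceOp_cross_mul hqp b a (!f)
  have h2 : lift (pieceOp q p (.cross b a (!f))) * lift (pieceOp q p (.cross a b f)) = 1 := by
    rw [← lift_mul, pieceOp_cross_mul hqp, lift_one]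
  calc _ = lift (pieceOp q p (.cross b a (!f))) * lift (pieceOp q p (.cross a b f)) *
        (pieceOp q p (.cross a c h) * lift (pieceOp q p (.cross b c g)) *
          pieceOp q p (.cross b a (!f))) := by rw [h2, one_mul]
    _ = lift (pieceOp q p (.cross b a (!f))) * (lift (pieceOp q p (.cross a b f)) *
        pieceOp q p (.cross a c h) * lift (pieceOp q p (.cross b c g))) *
          pieceOp q p (.cross b a (!f)) := by simp only [mul_assoc]
    _ = lift (pieceOp q p (.cross b a (!f))) * pieceOp q p (.cross b c g) *
        lift (pieceOp q p (.cross a c h)) *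
          (pieceOp q p (.cross a b f) * pieceOp q p (.cross b a (!f))) := by
      rw [← H]; simp only [mul_assoc]
    _ = _ := by rw [h1, mul_one]

theorem BraidRelation.flip_right (hqp : q * p = 1) {a b c f g h : Bool}
    (H : BraidRelation q p a b c f g h) : BraidRelation q p a c b h (!g) f := by
  have h1 : pieceOp q p (.cross c b (!g)) * pieceOp q p (.cross b c g) = 1 :=
    pieceOp_cross_mul hqp b c g
  have h2 : lift (pieceOp q p (.cross b c g)) * lift (pieceOp q p (.cross c b (!g))) = 1 := by
    rw [← lift_mul]
    simpa using congrArg lift (pieceOp_cross_mul hqp c b (!g)) |>.trans lift_one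
  calc _ = pieceOp q p (.cross c b (!g)) * lift (pieceOp q p (.cross a b f)) *
        pieceOp q p (.cross a c h) *
          (lift (pieceOp q p (.cross b c g)) * lift (pieceOp q p (.cross c b (!g)))) := by
        rw [h2, mul_one]
    _ = pieceOp q p (.cross c b (!g)) * (lift (pieceOp q p (.cross a b f)) *
        pieceOp q p (.cross a c h) * lift (pieceOp q p (.cross b c g))) *
          lift (pieceOp q p (.cross c b (!g))) := by simp only [mul_assoc]
    _ = pieceOp q p (.cross c b (!g)) * pieceOp q p (.cross b c g) *
        (lift (pieceOp q p (.cross a c h)) * pieceOp q p (.cross a b f) *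
          lift (pieceOp q p (.cross c b (!g)))) := by
      rw [← H]; simp only [mul_assoc]
    _ = _ := by rw [h1, one_mul]

/-- The noncyclic choices of `f`, `g`, `h` are the six orderings of the heights of three strands.
Adjacent transpositions connect all of them with the case `braidRelation_over`. -/
theorem braidRelation (hqp : q * p = 1) (a b c f g h : Bool) (hfgh : f = g → h = f) :
    BraidRelation q p a b c f g h := by
  have H := braidRelation_over (K := K) (q := q) (p := p)
  cases f <;> cases g <;> cases h <;> simp at hfgh
  · exact (((H _ _ _).flip_left hqp).flip_right hqp).flip_left hqp
  · exact ((H _ _ _).flip_right hqp).flip_left hqp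
  · exact (H _ _ _).flip_left hqp
  · exact ((H _ _ _).flip_left hqp).flip_right hqp
  · exact (H _ _ _).flip_right hqp
  · exact H _ _ _

theorem wordOp_localMove (hqp : q * p = 1) {x y : List Slice} (h : LocalMove x y) :
    wordOp q p x = wordOp q p y := by
  cases h with
  | interchange P P' m =>
    simp only [wordOp, sliceOp, List.length_append, liftN_add, List.length_nil, liftN_zero, one_mul]
    exact (pieceOp_mul_liftN q p P _).symm
  | zigzagLeft o => exact wordOp_zigzagLeft hqp o
  | zigzagRight o => exact wordOp_zigzagRight hqp o
  | slideCap o a f => exact wordOp_slideCap o a f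
  | slideCup o a f => exact wordOp_slideCup o a f
  | reidemeisterOneRight o f => exact wordOp_reidemeisterOneRight hqp o f
  | reidemeisterOneLeft o f => exact wordOp_reidemeisterOneLeft hqp o f
  | reidemeisterTwo a b f => exact wordOp_reidemeisterTwo hqp a b f
  | reidemeisterThree a b c f g h hfgh =>
    simpa [wordOp, sliceOp, liftN_succ, mul_assoc, BraidRelation] using
      braidRelation hqp a b c f g h hfgh

theorem wordOp_move (hqp : q * p = 1) (u v : List Slice) {x y : List Slice} (l r : List Bool)
    (h : LocalMove x y) :
    wordOp q p (u ++ whisker l x r ++ v) = wordOp q p (u ++ whisker l y r ++ v) := by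
  simp only [wordOp_append, wordOp_whisker, wordOp_localMove hqp h]

/-- The skein relation. -/
theorem pieceOp_skein (hqp : q * p = 1) (a b : Bool) {fp fm : Bool} (hp : isPositive a b fp = true)
    (hm : isPositive a b fm = false) :
    pieceOp q p (.cross a b fp) - pieceOp q p (.cross a b fm) =
      (q - p) • wordOp q p (smoothCrossing [] a b []) := by
  refine crossOp_ext fun v x y z c => ?_
  cases a <;> cases b <;> cases fp <;> simp [isPositive] at hp <;>
  cases fm <;> simp [isPositive] at hm <;> cases x <;> cases y <;>
    simp [smoothCrossing, wordOp, sliceOp, crossing_apply, capOp_capWeight_apply,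
      cupOp_cupWeight_apply] <;> grind

theorem smoothCrossing_eq_whisker (l r : List Bool) (a b : Bool) :
    smoothCrossing l a b r = whisker l (smoothCrossing [] a b []) r := by
  unfold smoothCrossing whisker
  split_ifs <;> simp

theorem wordOp_skein (hqp : q * p = 1) (l r : List Bool) (a b : Bool) {fp fm : Bool}
    (hp : isPositive a b fp = true) (hm : isPositive a b fm = false) :
    wordOp q p [⟨l, .cross a b fp, r⟩] - wordOp q p [⟨l, .cross a b fm, r⟩] =
      (q - p) • wordOp q p (smoothCrossing l a b r) := by
  rw [smoothCrossing_eq_whisker, wordOp_whisker, ← liftN_smul, ← pieceOp_skein hqp a b hp hm,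
    liftN_sub]
  simp [wordOp, sliceOp]

end Moves

/-! ### Odd operators that commute with all diagrams -/

section Odd

variable {K : Type*} [CommRing K]

/-- Change the first colour with weight `w`, or give it the weight `k` and apply `F` to the other
strands. -/
def oddCons (w k : Bool → K) (F : Module.End K ((ℕ → Bool) → K)) :
    Module.End K ((ℕ → Bool) → K) where
  toFun v c := w (c 0) * v (scons (!c 0) (stail c)) + k (c 0) * lift F v c
  map_add' v v' := by funext c; simp only [Pi.add_apply, map_add]; ring
  map_smul' a v := by
    funext c; simp only [Pi.smul_apply, smul_eq_mul, RingHom.id_apply, map_smul]; ring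

theorem oddCons_apply (w k : Bool → K) (F : Module.End K ((ℕ → Bool) → K)) (v : (ℕ → Bool) → K)
    (x : Bool) (c : ℕ → Bool) : oddCons w k F v (scons x c) =
      w x * v (scons (!x) c) + k x * F (fun d => v (scons x d)) c := rfl

/-- The sum over all strands of the operators that change the colour of one strand. -/
def oddOp (w k : Bool → Bool → K) : List Bool → Module.End K ((ℕ → Bool) → K)
  | [] => 0
  | o :: t => oddCons (w o) (k o) (oddOp w k t)

theorem fun_add_apply (F : Module.End K ((ℕ → Bool) → K)) (v v' : (ℕ → Bool) → K) (c : ℕ → Bool) :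
    F (fun d => v d + v' d) c = F v c + F v' c := congrFun (map_add F v v') c

theorem fun_sub_apply (F : Module.End K ((ℕ → Bool) → K)) (v v' : (ℕ → Bool) → K) (c : ℕ → Bool) :
    F (fun d => v d - v' d) c = F v c - F v' c := congrFun (map_sub F v v') c

theorem fun_mul_apply (F : Module.End K ((ℕ → Bool) → K)) (a : K) (v : (ℕ → Bool) → K)
    (c : ℕ → Bool) : F (fun d => a * v d) c = a * F v c := congrFun (map_smul F a v) c

theorem fun_neg_apply (F : Module.End K ((ℕ → Bool) → K)) (v : (ℕ → Bool) → K)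
    (c : ℕ → Bool) : F (fun d => - v d) c = - F v c := congrFun (map_neg F v) c

theorem fun_zero_apply (F : Module.End K ((ℕ → Bool) → K)) (c : ℕ → Bool) :
    F (fun _ => 0) c = 0 := congrFun (map_zero F) c

variable (q p : K)

/-- The weights of the two odd operators. -/
def oddWeight (s o x : Bool) : K :=
  if s then (if x = o then 1 else 0) else if x = o then 0 else if o then 1 else -p * p

def oddSign (s o x : Bool) : K :=
  (if x then 1 else -1) * if s then 1 else if o then q * q else p * p

variable {q p}

/-- `F` stands for the odd operator on the strands to the right. The legs of a minimum have equal
colours and opposite orientations, so their factors `oddSign` multiply to 1 and `F` passes through,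
while the changes of colour on the two legs cancel each other. -/
theorem oddCons_cup (hqp : q * p = 1) (s o : Bool) (F : Module.End K ((ℕ → Bool) → K)) :
    oddCons (oddWeight p s o) (oddSign q p s o)
      (oddCons (oddWeight p s !o) (oddSign q p s !o) F) * pieceOp q p (.cup o) =
        pieceOp q p (.cup o) * F := by
  refine crossOp_ext fun v x y z c => ?_
  cases s <;> cases o <;> cases x <;> cases y <;>
    simp [oddCons_apply, cupOp_cupWeight_apply, fun_mul_apply, oddWeight, oddSign, fun_zero_apply,
      fun_neg_apply] <;> grind

theorem oddCons_cap (hqp : q * p = 1) (s o : Bool) (F : Module.End K ((ℕ → Bool) → K)) :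
    F * pieceOp q p (.cap o) = pieceOp q p (.cap o) *
      oddCons (oddWeight p s o) (oddSign q p s o)
        (oddCons (oddWeight p s !o) (oddSign q p s !o) F) := by
  ext v c
  cases s <;> cases o <;>
    simp [oddCons_apply, capOp_capWeight_apply, oddWeight, oddSign,
      show pieceOp q p (.cap true) v = _ from funext (capOp_capWeight_apply true v),
      show pieceOp q p (.cap false) v = _ from funext (capOp_capWeight_apply false v),
      fun_mul_apply, fun_add_apply, fun_sub_apply] <;> grind

theorem oddCons_cross (hqp : q * p = 1) (s a b f : Bool) (F : Module.End K ((ℕ → Bool) → K)) :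
    oddCons (oddWeight p s b) (oddSign q p s b)
      (oddCons (oddWeight p s a) (oddSign q p s a) F) * pieceOp q p (.cross a b f) =
    pieceOp q p (.cross a b f) * oddCons (oddWeight p s a) (oddSign q p s a)
      (oddCons (oddWeight p s b) (oddSign q p s b) F) := by
  refine crossOp_ext fun v x y z c => ?_
  cases s <;> cases a <;> cases b <;> cases f <;> cases x <;> cases y <;>
    simp [oddCons_apply, crossing_apply, fun_mul_apply, fun_add_apply, oddWeight, oddSign,
      fun_neg_apply] <;> grind

/-- Strands to the right of the piece are absorbed into the arbitrary `F` of the local identities;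
strands to the left are added one by one, since the piece does not touch their colours. -/
theorem oddOp_sliceOp (hqp : q * p = 1) (s : Bool) (x : Slice) :
    oddOp (oddWeight p s) (oddSign q p s) x.tgt * sliceOp q p x =
      sliceOp q p x * oddOp (oddWeight p s) (oddSign q p s) x.src := by
  obtain ⟨l, P, r⟩ := x
  induction l with
  | nil =>
    cases P with
    | cup o => exact oddCons_cup hqp s o _
    | cap o => exact oddCons_cap hqp s o _
    | cross a b f => exact oddCons_cross hqp s a b f _
  | cons o l ih =>
    ext v c
    obtain ⟨y, c, rfl⟩ := exists_scons c
    have h := congrFun (LinearMap.congr_fun ih (fun d => v (scons y d))) c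
    simp only [sliceOp, Slice.src, Slice.tgt, List.cons_append, oddOp, List.length_cons, liftN_succ,
      Module.End.mul_apply, oddCons_apply, lift_apply, fun_add_apply, fun_mul_apply] at h ⊢
    rw [h]

theorem oddOp_wordOp (hqp : q * p = 1) (s : Bool) {t t' : List Bool} {w : List Slice}
    (h : IsPath t w t') :
    oddOp (oddWeight p s) (oddSign q p s) t' * wordOp q p w =
      wordOp q p w * oddOp (oddWeight p s) (oddSign q p s) t := by
  induction w generalizing t with
  | nil => cases h; simp [wordOp]
  | cons x w ih =>
    obtain ⟨rfl, h⟩ := h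
    rw [wordOp, ← mul_assoc, ih h, mul_assoc, oddOp_sliceOp hqp, mul_assoc]

/-- The odd operators are zero on an empty line, so intertwining makes the vector of a diagram
without lower boundary an invariant vector. -/
theorem oddOp_wordOp_eq_zero (hqp : q * p = 1) (s : Bool) {t : List Bool} {w : List Slice}
    (h : IsPath [] w t) (v : (ℕ → Bool) → K) :
    oddOp (oddWeight p s) (oddSign q p s) t (wordOp q p w v) = 0 := by
  have := LinearMap.congr_fun (oddOp_wordOp hqp s h) v
  simpa [oddOp] using this

end Odd

/-! ### Independence of the place where a link is cut -/

section Cut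

variable {K : Type*} [CommRing K] {q p : K}

/-- Invariance under both odd operators leaves so little freedom on two pairs of strands that
capping either pair gives proportional results. The factors `p` normalise the orientation of the
maximum at which the link is cut. -/
theorem cut_aux (hqp : q * p = 1) (o o' : Bool) (v : (ℕ → Bool) → K) (c : ℕ → Bool)
    (h : ∀ s, oddOp (oddWeight p s) (oddSign q p s) [o, !o, o', !o'] v = 0) :
    (if o then p else 1) * liftN 2 (pieceOp q p (.cap o')) v (scons true (scons true c)) =
      (if o' then p else 1) * pieceOp q p (.cap o) v (scons true (scons true c)) := by
  have h' : ∀ s x y z t, oddOp (oddWeight p s) (oddSign q p s) [o, !o, o', !o'] v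
    (scons x (scons y (scons z (scons t c)))) = 0 := fun s x y z t => by rw [h s]; rfl
  -- An odd operator changes a single colour, so its values at colourings with an odd number of
  -- `true` are linear equations between the values of `v` at even ones. All eight such colourings
  -- are used, for both operators.
  have e1 := h' false false true false false
  have e2 := h' true false false true false
  have e3 := h' true false true false false
  have e4 := h' false false false true false
  have e5 := h' false true false false false
  have e6 := h' true true false false false
  have e7 := h' false false false false true
  have e8 := h' true false false false true
  have f1 := h' false true false true true
  have f2 := h' true true true false true
  have f3 := h' true true false true true
  have f4 := h' false true true false true
  have f5 := h' false false true true true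
  have f6 := h' true false true true true
  have f7 := h' false true true true false
  have f8 := h' true true true true false
  clear h h'
  cases o <;> cases o' <;>
    simp [oddOp, oddCons_apply, oddWeight, oddSign, capOp_capWeight_apply, liftN_succ] at * <;>
    grind

end Cut

/-! ### The invariant of links -/

theorem isPath_append {s t : List Bool} {u v : List Slice} :
    IsPath s (u ++ v) t ↔ ∃ m, IsPath s u m ∧ IsPath m v t := by
  constructor
  · intro h
    induction u generalizing s with
    | nil => exact ⟨s, rfl, h⟩
    | cons x u ih =>
      obtain ⟨m, hu, hv⟩ := ih h.2
      exact ⟨m, ⟨h.1, hu⟩, hv⟩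
  · rintro ⟨m, hu, hv⟩
    exact hu.append hv

theorem isPath_singleton {s t : List Bool} {x : Slice} :
    IsPath s [x] t ↔ x.src = s ∧ x.tgt = t := Iff.rfl

theorem Slice.tgt_eq_nil {x : Slice} (h : x.tgt = []) : ∃ o, x = ⟨[], .cap o, []⟩ := by
  obtain ⟨l, P, r⟩ := x
  cases P <;> simp_all [Slice.tgt, Piece.tgt]

theorem Slice.src_eq_nil {x : Slice} (h : x.src = []) : ∃ o, x = ⟨[], .cup o, []⟩ := by
  obtain ⟨l, P, r⟩ := x
  cases P <;> simp_all [Slice.src, Piece.src]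

theorem exists_last_cap {s : List Bool} {w : List Slice} (h : IsPath s w []) (hw : w ≠ []) :
    ∃ w' o, w = w' ++ [⟨[], .cap o, []⟩] ∧ IsPath s w' [o, !o] := by
  obtain ⟨w', x, rfl⟩ := List.eq_nil_or_concat' w |>.resolve_left hw
  obtain ⟨m, h1, h2⟩ := isPath_append.1 h
  obtain ⟨h2, h3⟩ := isPath_singleton.1 h2
  obtain ⟨o, rfl⟩ := Slice.tgt_eq_nil h3
  obtain rfl : [o, !o] = m := h2
  exact ⟨w', o, rfl, h1⟩

section Invariant

variable {K : Type*} [CommRing K] (q p : K)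

/-- The value of the operator of a diagram without bottom boundary at a colouring in which the first
two strands have colour `true`. -/
def wordValue (w : List Slice) : K :=
  wordOp q p w 1 (scons true (scons true fun _ => false))

/-- Cut a diagram at its last maximum and evaluate. -/
def stateInvariant (w : List Slice) : K :=
  match w.getLast? with
  | some ⟨_, .cap o, _⟩ => (if o then p else 1) * wordValue q p w.dropLast
  | _ => 0

theorem stateInvariant_concat (w : List Slice) (l r : List Bool) (o : Bool) :
    stateInvariant q p (w ++ [⟨l, .cap o, r⟩]) = (if o then p else 1) * wordValue q p w := by
  simp [stateInvariant]

variable {q p}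

/-- The last clause says that a move which removes all its slices happens on an existing strand.
Hence no move turns a link into the empty diagram. -/
theorem LocalMove.src_eq {x y : List Slice} (h : LocalMove x y) :
    ∃ s t, IsPath s x t ∧ IsPath s y t ∧ ((x = [] ∨ y = []) → s ≠ [] ∧ t ≠ []) := by
  cases h with
  | interchange P P' m =>
    refine ⟨P.src ++ m ++ P'.src, P.tgt ++ m ++ P'.tgt, ?_, ?_, by simp⟩ <;>
      simp [IsPath, Slice.src, Slice.tgt]
  | zigzagLeft o => exact ⟨[o], [o], by simp [IsPath, Slice.src, Slice.tgt, Piece.src, Piece.tgt]⟩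
  | zigzagRight o => exact ⟨[o], [o], by simp [IsPath, Slice.src, Slice.tgt, Piece.src, Piece.tgt]⟩
  | slideCap o a f =>
    exact ⟨[o, a, !o], [a], by simp [IsPath, Slice.src, Slice.tgt, Piece.src, Piece.tgt]⟩
  | slideCup o a f =>
    exact ⟨[a], [o, a, !o], by simp [IsPath, Slice.src, Slice.tgt, Piece.src, Piece.tgt]⟩
  | reidemeisterOneRight o f =>
    exact ⟨[o], [o], by simp [IsPath, Slice.src, Slice.tgt, Piece.src, Piece.tgt]⟩
  | reidemeisterOneLeft o f =>
    exact ⟨[o], [o], by simp [IsPath, Slice.src, Slice.tgt, Piece.src, Piece.tgt]⟩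
  | reidemeisterTwo a b f =>
    exact ⟨[a, b], [a, b], by simp [IsPath, Slice.src, Slice.tgt, Piece.src, Piece.tgt]⟩
  | reidemeisterThree a b c f g h hfgh =>
    exact ⟨[a, b, c], [c, b, a], by simp [IsPath, Slice.src, Slice.tgt, Piece.src, Piece.tgt]⟩

theorem IsPath.tgt_unique {s t t' : List Bool} {w : List Slice} (h : IsPath s w t)
    (h' : IsPath s w t') : t = t' := by
  induction w generalizing s with
  | nil => exact h.symm.trans h'
  | cons x w ih => exact ih h.2 h'.2

theorem IsPath.src_unique {s s' t t' : List Bool} {w : List Slice} (h : IsPath s w t)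
    (h' : IsPath s' w t') (hw : w ≠ []) : s = s' := by
  cases w with
  | nil => exact absurd rfl hw
  | cons x w => exact h.1.symm.trans h'.1

theorem whisker_eq_nil {l r : List Bool} {w : List Slice} : whisker l w r = [] ↔ w = [] := by
  simp [whisker]

/-- At most one side of a move is empty, and the nonempty side determines the lines between which
the move takes place. -/
theorem LocalMove.exists_boundary {u v x y : List Slice} {l r : List Bool} (h : LocalMove x y)
    {s t : List Bool} (hx : IsPath s (u ++ whisker l x r ++ v) t)
    (hy : IsPath s (u ++ whisker l y r ++ v) t) :
    ∃ s' t', IsPath s' x t' ∧ IsPath s' y t' ∧ IsPath s u (l ++ s' ++ r) ∧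
      IsPath (l ++ t' ++ r) v t ∧ ((x = [] ∨ y = []) → s' ≠ [] ∧ t' ≠ []) := by
  obtain ⟨s', t', h1, h2, h3⟩ := h.src_eq
  have key : ∀ z, IsPath s' z t' → z ≠ [] → IsPath s (u ++ whisker l z r ++ v) t →
      IsPath s u (l ++ s' ++ r) ∧ IsPath (l ++ t' ++ r) v t := by
    intro z hz hne hp
    obtain ⟨m, hp, hv⟩ := isPath_append.1 hp
    obtain ⟨m', hu, hp⟩ := isPath_append.1 hp
    obtain rfl := hp.src_unique (hz.whisker l r) (mt whisker_eq_nil.1 hne)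
    obtain rfl := hp.tgt_unique (hz.whisker l r)
    exact ⟨hu, hv⟩
  have hxy : x ≠ [] ∨ y ≠ [] := by
    by_contra! hc
    obtain ⟨rfl, rfl⟩ := hc
    cases h
  rcases hxy with hne | hne
  · exact ⟨s', t', h1, h2, (key x h1 hne hx).1, (key x h1 hne hx).2, h3⟩
  · exact ⟨s', t', h1, h2, (key y h2 hne hy).1, (key y h2 hne hy).2, h3⟩

/-- Exchanging the two highest maxima is the only move that changes the maximum at which the link is
cut. The vector below both maxima is invariant, so `cut_aux` applies. -/
theorem stateInvariant_cut (hqp : q * p = 1) {u : List Slice} {o o' : Bool}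
    (hu : IsPath [] u [o, !o, o', !o']) :
    stateInvariant q p (u ++ [⟨[o, !o], .cap o', []⟩, ⟨[], .cap o, []⟩]) =
      stateInvariant q p (u ++ [⟨[], .cap o, [o', !o']⟩, ⟨[], .cap o', []⟩]) := by
  have h := cut_aux hqp o o' (wordOp q p u 1) (fun _ => false)
    fun s => oddOp_wordOp_eq_zero hqp s hu 1
  have e : ∀ (w : List Slice) (x y : Slice), w ++ [x, y] = (w ++ [x]) ++ [y] := by simp
  rw [e, e, stateInvariant_concat, stateInvariant_concat]
  simpa [wordValue, wordOp_append, wordOp, sliceOp] using h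

theorem stateInvariant_move (hqp : q * p = 1) {L L' : LinkDiagram} (h : Move L.word L'.word) :
    stateInvariant q p L.word = stateInvariant q p L'.word := by
  obtain ⟨u, v, x, y, l, r, h, hx, hy⟩ := h
  obtain ⟨s, t, h1, h2, hu, hv, hst⟩ := h.exists_boundary (hx ▸ L.isPath) (hy ▸ L'.isPath)
  rw [hx, hy]
  -- If slices remain above the move, the last maximum stays the same and the operator identity
  -- suffices. Otherwise the upper boundary of the move is empty, which leaves only the interchange
  -- of two maxima.
  rcases eq_or_ne v [] with rfl | hne
  · have ht : l ++ t ++ r = [] := hv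
    obtain ⟨⟨rfl, rfl⟩, rfl⟩ : (l = [] ∧ t = []) ∧ r = [] := by
      simpa [and_assoc] using ht
    cases h with
    | interchange P P' m =>
      simp only [IsPath, Slice.src, Slice.tgt, List.append_eq_nil_iff, List.nil_append] at h1 h2
      obtain ⟨rfl, -, hP, rfl, hP'⟩ := h2
      cases P <;> simp [Piece.tgt] at hP
      cases P' <;> simp [Piece.tgt] at hP'
      rename_i o o'
      have := stateInvariant_cut hqp (u := u) (o := o) (o' := o') (by simpa [Piece.src] using hu)
      simpa [whisker, Piece.src, Piece.tgt] using this.symm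
    | zigzagLeft | zigzagRight | reidemeisterOneLeft | reidemeisterOneRight =>
      simp at hst
    | slideCap | slideCup | reidemeisterTwo | reidemeisterThree =>
      simp [IsPath, Slice.src, Slice.tgt, Piece.src, Piece.tgt] at h1
  · obtain ⟨v, o, rfl, -⟩ := exists_last_cap hv hne
    simp only [← List.append_assoc _ v, stateInvariant_concat, wordValue]
    rw [wordOp_move hqp u v l r h]

theorem stateInvariant_isotopic (hqp : q * p = 1) {L L' : LinkDiagram} (h : Isotopic L L') :
    stateInvariant q p L.word = stateInvariant q p L'.word := by
  induction h with
  | rel L L' h => exact stateInvariant_move hqp h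
  | refl => rfl
  | symm L L' _ ih => exact ih.symm
  | trans L L' L'' _ _ ih ih' => exact ih.trans ih'

theorem stateInvariant_skein (hqp : q * p = 1) {Lp Lm L0 : LinkDiagram} (h : SkeinTriple Lp Lm L0) :
    stateInvariant q p Lp.word - stateInvariant q p Lm.word =
      (q - p) * stateInvariant q p L0.word := by
  obtain ⟨u, v, l, r, a, b, fp, fm, hp, hm, hLp, hLm, hL0⟩ := h
  -- A crossing has strands above it, so it cannot be the last slice, and all three diagrams are cut
  -- at the same maximum.
  have hne : v ≠ [] := by
    rintro rfl
    have h1 := Lp.isPath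
    rw [hLp, List.append_nil] at h1
    obtain ⟨m, -, -, h2⟩ := isPath_append.1 h1
    obtain ⟨o, ho⟩ := Slice.tgt_eq_nil h2
    simp at ho
  have h1 := Lp.isPath
  rw [hLp] at h1
  obtain ⟨m, -, hv⟩ := isPath_append.1 h1
  obtain ⟨v, o, rfl, -⟩ := exists_last_cap hv hne
  rw [hLp, hLm, hL0]
  simp only [← List.append_assoc _ v, stateInvariant_concat, wordValue]
  have h2 := wordOp_skein hqp l r a b hp hm
  have h3 := congrArg (fun F => wordOp q p v * F * wordOp q p u) h2
  have h4 := congrFun (LinearMap.congr_fun h3 1) (scons true (scons true fun _ => false))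
  simp only [mul_sub, sub_mul, LinearMap.sub_apply, Pi.sub_apply, mul_smul_comm, smul_mul_assoc,
    LinearMap.smul_apply, Pi.smul_apply, smul_eq_mul] at h4
  simp only [wordOp_append, ← mul_assoc]
  linear_combination (if o then p else 1) * h4

theorem stateInvariant_unknot (hqp : q * p = 1) : stateInvariant q p unknot.word = 1 := by
  have : unknot.word = [⟨[], .cup true, []⟩] ++ [⟨[], .cap true, []⟩] := rfl
  rw [this, stateInvariant_concat]
  simp [wordValue, wordOp, sliceOp, cupOp_cupWeight_apply, mul_comm p q, hqp]

end Invariant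

open LaurentPolynomial in
theorem T_one_mul_T_neg_one : (T 1 : ℤ[T;T⁻¹]) * T (-1) = 1 := by
  rw [← T_add]; simp

open LaurentPolynomial in
theorem isAlexanderPolynomial_stateInvariant :
    IsAlexanderPolynomial fun L => stateInvariant (T 1 : ℤ[T;T⁻¹]) (T (-1)) L.word where
  invariant _ _ h := stateInvariant_isotopic T_one_mul_T_neg_one h
  unknot := stateInvariant_unknot T_one_mul_T_neg_one
  skein _ _ _ h := stateInvariant_skein T_one_mul_T_neg_one h

/-! ### Isotopy of tangle diagrams -/

/-- Isotopy of tangle diagrams with bottom boundary `s` and top boundary `t`. -/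
inductive TIso : List Bool → List Bool → List Slice → List Slice → Prop
  | refl {s t w} (h : IsPath s w t) : TIso s t w w
  | symm {s t x y} (h : TIso s t x y) : TIso s t y x
  | trans {s t x y z} (h : TIso s t x y) (h' : TIso s t y z) : TIso s t x z
  | move {s t x y} (l r : List Bool) (h : LocalMove x y) (hx : IsPath s x t) (hy : IsPath s y t) :
      TIso (l ++ s ++ r) (l ++ t ++ r) (whisker l x r) (whisker l y r)
  | comp {s t u x y x' y'} (h : TIso s t x y) (h' : TIso t u x' y') : TIso s u (x ++ x') (y ++ y')

theorem whisker_whisker (l l' r r' : List Bool) (w : List Slice) :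
    whisker l (whisker l' w r') r = whisker (l ++ l') w (r' ++ r) := by
  simp [whisker, Function.comp_def]

@[simp] theorem whisker_append (l r : List Bool) (w w' : List Slice) :
    whisker l (w ++ w') r = whisker l w r ++ whisker l w' r := by
  simp [whisker]

@[simp] theorem whisker_cons (l r : List Bool) (x : Slice) (w : List Slice) :
    whisker l (x :: w) r = ⟨l ++ x.left, x.piece, x.right ++ r⟩ :: whisker l w r := rfl

@[simp] theorem whisker_nil (l r : List Bool) : whisker l [] r = [] := rfl

@[simp] theorem whisker_nil_nil (w : List Slice) : whisker [] w [] = w := by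
  simp [whisker]

theorem TIso.isPath {s t : List Bool} {x y : List Slice} (h : TIso s t x y) :
    IsPath s x t ∧ IsPath s y t := by
  induction h with
  | refl h => exact ⟨h, h⟩
  | symm _ ih => exact ih.symm
  | trans _ _ ih ih' => exact ⟨ih.1, ih'.2⟩
  | move l r h hx hy => exact ⟨hx.whisker l r, hy.whisker l r⟩
  | comp _ _ ih ih' => exact ⟨ih.1.append ih'.1, ih.2.append ih'.2⟩

theorem TIso.whisker {s t : List Bool} {x y : List Slice} (h : TIso s t x y) (l r : List Bool) :
    TIso (l ++ s ++ r) (l ++ t ++ r) (whisker l x r) (whisker l y r) := by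
  induction h with
  | refl h => exact .refl (h.whisker l r)
  | symm _ ih => exact ih.symm
  | trans _ _ ih ih' => exact ih.trans ih'
  | move l' r' h hx hy => simpa [whisker_whisker] using TIso.move (l ++ l') (r' ++ r) h hx hy
  | comp _ _ ih ih' => simpa using ih.comp ih'

theorem TIso.of_localMove {s t : List Bool} {x y : List Slice} (h : LocalMove x y)
    (hx : IsPath s x t) : TIso s t x y := by
  obtain ⟨s', t', h1, h2, h3⟩ := h.src_eq
  by_cases hne : x = []
  · subst hne; cases h
  obtain rfl := hx.src_unique h1 hne
  obtain rfl := hx.tgt_unique h1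
  simpa using TIso.move [] [] h h1 h2

theorem TIso.comp_left {s t u : List Bool} {x y z : List Slice} (h : TIso s t x y)
    (hz : IsPath u z s) : TIso u t (z ++ x) (z ++ y) := (TIso.refl hz).comp h

theorem TIso.comp_right {s t u : List Bool} {x y z : List Slice} (h : TIso s t x y)
    (hz : IsPath t z u) : TIso s u (x ++ z) (y ++ z) := h.comp (TIso.refl hz)

theorem TIso.interchange_slices (x y : Slice) :
    TIso (x.src ++ y.src) (x.tgt ++ y.tgt)
      [⟨x.left, x.piece, x.right ++ y.src⟩, ⟨x.tgt ++ y.left, y.piece, y.right⟩]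
      [⟨x.src ++ y.left, y.piece, y.right⟩, ⟨x.left, x.piece, x.right ++ y.tgt⟩] := by
  have h := (TIso.of_localMove (.interchange x.piece y.piece (x.right ++ y.left))
    (s := x.piece.src ++ x.right ++ y.left ++ y.piece.src)
    (t := x.piece.tgt ++ x.right ++ y.left ++ y.piece.tgt)
    (by simp [IsPath, Slice.src, Slice.tgt])).whisker x.left y.right
  simpa [Slice.src, Slice.tgt] using h

theorem TIso.interchange {s s' t t' : List Bool} {Y Z : List Slice} (hY : IsPath s Y s')
    (hZ : IsPath t Z t') :
    TIso (s ++ t) (s' ++ t') (TangleDiagram.whisker [] Y t ++ TangleDiagram.whisker s' Z [])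
      (TangleDiagram.whisker s Z [] ++ TangleDiagram.whisker [] Y t') := by
  induction Y generalizing s with
  | nil =>
    cases hY
    simpa using TIso.refl (hZ.whisker _ [])
  | cons x Y ih =>
    obtain ⟨rfl, hY⟩ := hY
    have h1 : ∀ {t}, IsPath t Z t' → TIso (x.src ++ t) (x.tgt ++ t')
        ([⟨x.left, x.piece, x.right ++ t⟩] ++ TangleDiagram.whisker x.tgt Z [])
        (TangleDiagram.whisker x.src Z [] ++ [⟨x.left, x.piece, x.right ++ t'⟩]) := by
      clear hZ ih
      induction Z with
      | nil =>
        intro t hZ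
        cases hZ
        exact .refl ⟨by simp [Slice.src], by simp [Slice.tgt, IsPath]⟩
      | cons y Z ih =>
        intro t hZ
        obtain ⟨rfl, hZ⟩ := hZ
        have h2 := (TIso.interchange_slices x y).comp_right
          (z := TangleDiagram.whisker x.tgt Z []) (by simpa using hZ.whisker x.tgt [])
        have h3 := (ih hZ).comp_left (z := [⟨x.src ++ y.left, y.piece, y.right⟩])
          (u := x.src ++ y.src) ⟨by simp [Slice.src], by simp [Slice.tgt, IsPath]⟩
        simpa using h2.trans h3
    have h2 := (h1 hZ).comp_right (z := TangleDiagram.whisker [] Y t')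
      (by simpa using hY.whisker [] t')
    have h3 := (ih hY).comp_left (z := [⟨x.left, x.piece, x.right ++ t⟩])
      (u := x.src ++ t) ⟨by simp [Slice.src], by simp [Slice.tgt, IsPath]⟩
    simp only [List.append_assoc] at h2 h3
    simpa using h3.trans h2

/-! ### Strands that pass over other strands -/

/-- A strand of orientation `a` passes from left to right over strands with orientations `t`. -/
def dragRight (a : Bool) : List Bool → List Slice
  | [] => []
  | b :: t => ⟨[], .cross a b true, t⟩ :: whisker [b] (dragRight a t) []

/-- A strand of orientation `a` passes from right to left over strands with orientations `t`. -/
def dragLeft (a : Bool) : List Bool → List Slice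
  | [] => []
  | b :: t => whisker [b] (dragLeft a t) [] ++ [⟨[], .cross b a false, t⟩]

theorem isPath_dragRight (a : Bool) (t : List Bool) : IsPath (a :: t) (dragRight a t) (t ++ [a]) := by
  induction t with
  | nil => rfl
  | cons b t ih =>
    refine ⟨rfl, ?_⟩
    simpa [Slice.tgt, Piece.tgt] using ih.whisker [b] []

theorem isPath_dragLeft (a : Bool) (t : List Bool) : IsPath (t ++ [a]) (dragLeft a t) (a :: t) := by
  induction t with
  | nil => rfl
  | cons b t ih =>
    have := ih.whisker [b] []
    simp only [List.append_nil, List.singleton_append] at this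
    exact this.append ⟨rfl, rfl⟩

theorem dragRight_append (a : Bool) (l m : List Bool) :
    dragRight a (l ++ m) = whisker [] (dragRight a l) m ++ whisker l (dragRight a m) [] := by
  induction l with
  | nil => simp [dragRight]
  | cons b l ih => simp [dragRight, ih, whisker_whisker]

theorem TIso.reidemeisterTwo (l r : List Bool) (a b f : Bool) :
    TIso (l ++ [a, b] ++ r) (l ++ [a, b] ++ r) [⟨l, .cross a b f, r⟩, ⟨l, .cross b a (!f), r⟩] [] := by
  simpa using (TIso.of_localMove (.reidemeisterTwo a b f)
    (s := [a, b]) (t := [a, b]) ⟨rfl, rfl, rfl⟩).whisker l r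

/-- A piece passes under a strand. -/
theorem TIso.dragRight_piece (a : Bool) (P : Piece) :
    TIso (a :: P.src) (P.tgt ++ [a]) (⟨[a], P, []⟩ :: dragRight a P.tgt)
      (dragRight a P.src ++ [⟨[], P, [a]⟩]) := by
  cases P with
  | cup o =>
    -- The minimum slides across the strand; of the crossings now present, two form a second
    -- Reidemeister move. The maximum is treated in the same way with the order of the two moves
    -- reversed.
    have h := (TIso.of_localMove (.slideCup o a true) (s := [a]) (t := [o, a, !o])
      ⟨rfl, rfl, rfl⟩).comp_right (z := [⟨[o], .cross a (!o) true, []⟩]) (u := [o, !o, a]) ⟨rfl, rfl⟩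
    have h2 := (TIso.reidemeisterTwo [o] [] (!o) a false).comp_left (u := [a])
      (z := [⟨[], .cup o, [a]⟩]) ⟨rfl, rfl⟩
    simpa [dragRight, Piece.src, Piece.tgt] using h.trans h2
  | cap o =>
    have h := (TIso.of_localMove (.slideCap o a false) (s := [o, a, !o]) (t := [a])
      ⟨rfl, rfl, rfl⟩).comp_left (z := [⟨[], .cross a o true, [!o]⟩]) (u := [a, o, !o]) ⟨rfl, rfl⟩
    have h2 := (TIso.reidemeisterTwo [] [!o] a o true).comp_right (u := [a])
      (z := [⟨[a], .cap o, []⟩]) ⟨rfl, rfl⟩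
    simpa [dragRight, Piece.src, Piece.tgt] using h2.symm.trans h
  | cross b c f =>
    have h := TIso.of_localMove (.reidemeisterThree a b c true f true fun _ => rfl)
      (s := [a, b, c]) (t := [c, b, a]) ⟨rfl, rfl, rfl, rfl⟩
    simpa [dragRight, Piece.src, Piece.tgt] using h.symm

/-- A slice passes under a strand. -/
theorem TIso.dragRight_slice (a : Bool) (x : Slice) :
    TIso (a :: x.src) (x.tgt ++ [a]) (⟨a :: x.left, x.piece, x.right⟩ :: dragRight a x.tgt)
      (dragRight a x.src ++ [⟨x.left, x.piece, x.right ++ [a]⟩]) := by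
  obtain ⟨l, P, r⟩ := x
  have h1 := ((TIso.interchange (isPath_dragRight a l)
    (show IsPath P.src [⟨[], P, []⟩] P.tgt from ⟨by simp [Slice.src], by simp [Slice.tgt, IsPath]⟩)).whisker
      [] r).comp_right (z := TangleDiagram.whisker l (dragRight a P.tgt) r ++
        TangleDiagram.whisker (l ++ P.tgt) (dragRight a r) []) (u := l ++ P.tgt ++ r ++ [a]) (by
      have e1 := (isPath_dragRight a P.tgt).whisker l r
      have e2 := (isPath_dragRight a r).whisker (l ++ P.tgt) []
      simp only [List.append_assoc, List.cons_append, List.nil_append, List.append_nil] at e1 e2 ⊢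
      exact e1.append e2)
  have h2 := ((TIso.dragRight_piece a P).whisker l r).comp
    (TIso.refl ((isPath_dragRight a r).whisker (l ++ P.tgt) []) |> fun h => by
      simpa using h : TIso (l ++ (P.tgt ++ [a]) ++ r) (l ++ P.tgt ++ r ++ [a])
        (TangleDiagram.whisker (l ++ P.tgt) (dragRight a r) [])
        (TangleDiagram.whisker (l ++ P.tgt) (dragRight a r) []))
  have h3 := (TIso.interchange (show IsPath P.src [⟨[], P, []⟩] P.tgt from
    ⟨by simp [Slice.src], by simp [Slice.tgt, IsPath]⟩) (isPath_dragRight a r)).whisker l []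
  have h4 := (h2.trans (by
    have h5 := h3.comp_left (z := TangleDiagram.whisker l (dragRight a P.src) r)
      (u := l ++ (a :: P.src) ++ r) (by
        have e1 := (isPath_dragRight a P.src).whisker l r
        simpa using e1)
    simpa [whisker_whisker] using h5)).comp_left (z := TangleDiagram.whisker [] (dragRight a l) (P.src ++ r))
      (u := a :: l ++ P.src ++ r) (by simpa using (isPath_dragRight a l).whisker [] (P.src ++ r))
  simp [Slice.src, Slice.tgt, dragRight_append, whisker_whisker] at h1 h4 ⊢
  exact h1.symm.trans h4

/-- A curl at a minimum. -/
theorem TIso.cup_curl (o f : Bool) :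
    TIso [] [!o, o] [⟨[], .cup o, []⟩, ⟨[], .cross o (!o) f, []⟩] [⟨[], .cup (!o), []⟩] := by
  -- The moves are applied in the order `h5` to `h1`: a zigzag is inserted, its maximum rises above
  -- the crossing, the crossing slides around the new minimum, the two minima change heights, and
  -- what remains on top of the other minimum is a curl on a single strand.
  have h1 := ((TIso.of_localMove (.reidemeisterOneRight o (!f)) (s := [o]) (t := [o])
    ⟨rfl, rfl, rfl, rfl⟩).whisker [!o] []).comp_left (z := [⟨[], .cup (!o), []⟩]) (u := [])
      (by simp [IsPath, Slice.src, Slice.tgt, Piece.src, Piece.tgt])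
  have h2 := (TIso.of_localMove (.interchange (.cup (!o)) (.cup o) []) (s := []) (t := [!o, o, o, !o])
    (by simp [IsPath, Slice.src, Slice.tgt, Piece.src, Piece.tgt])).comp_right
      (z := [⟨[!o], .cross o o (!f), [!o]⟩, ⟨[!o, o], .cap o, []⟩]) (u := [!o, o])
      (by simp [IsPath, Slice.src, Slice.tgt, Piece.src, Piece.tgt])
  have h3 := (((TIso.of_localMove (.slideCup (!o) o f) (s := [o]) (t := [!o, o, o])
    (by simp [IsPath, Slice.src, Slice.tgt, Piece.src, Piece.tgt])).whisker [] [!o]).comp_left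
      (z := [⟨[], .cup o, []⟩]) (u := [])
      (by simp [IsPath, Slice.src, Slice.tgt, Piece.src, Piece.tgt])).comp_right
      (z := [⟨[!o, o], .cap o, []⟩]) (u := [!o, o])
      (by simp [IsPath, Slice.src, Slice.tgt, Piece.src, Piece.tgt])
  have h4 := (TIso.of_localMove (.interchange (.cross o (!o) f) (.cap o) []) (s := [o, !o, o, !o])
    (t := [!o, o]) (by simp [IsPath, Slice.src, Slice.tgt, Piece.src, Piece.tgt])).comp_left
      (z := [⟨[], .cup o, []⟩, ⟨[o], .cup (!o), [!o]⟩]) (u := [])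
      (by simp [IsPath, Slice.src, Slice.tgt, Piece.src, Piece.tgt])
  have h5 := (((TIso.of_localMove (.zigzagRight (!o)) (s := [!o]) (t := [!o])
    (by simp [IsPath, Slice.src, Slice.tgt, Piece.src, Piece.tgt])).whisker [o] []).comp_left
      (z := [⟨[], .cup o, []⟩]) (u := [])
      (by simp [IsPath, Slice.src, Slice.tgt, Piece.src, Piece.tgt])).comp_right
      (z := [⟨[], .cross o (!o) f, []⟩]) (u := [!o, o])
      (by simp [IsPath, Slice.src, Slice.tgt, Piece.src, Piece.tgt])
  simp [Piece.src, Piece.tgt] at h1 h2 h3 h4 h5 ⊢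
  exact h5.symm.trans (h4.symm.trans (h3.trans (h2.symm.trans h1)))

/-- A curl at a maximum. -/
theorem TIso.cap_curl (o f : Bool) :
    TIso [!o, o] [] [⟨[], .cross (!o) o f, []⟩, ⟨[], .cap o, []⟩] [⟨[], .cap (!o), []⟩] := by
  have h1 := ((TIso.of_localMove (.reidemeisterOneRight o (!f)) (s := [o]) (t := [o])
    ⟨rfl, rfl, rfl, rfl⟩).whisker [!o] []).comp_right (z := [⟨[], .cap (!o), []⟩]) (u := [])
      (by simp [IsPath, Slice.src, Slice.tgt, Piece.src, Piece.tgt])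
  have h2 := (TIso.of_localMove (.interchange (.cap (!o)) (.cap o) []) (s := [!o, o, o, !o]) (t := [])
    (by simp [IsPath, Slice.src, Slice.tgt, Piece.src, Piece.tgt])).comp_left
      (z := [⟨[!o, o], .cup o, []⟩, ⟨[!o], .cross o o (!f), [!o]⟩]) (u := [!o, o])
      (by simp [IsPath, Slice.src, Slice.tgt, Piece.src, Piece.tgt])
  have h3 := (((TIso.of_localMove (.slideCap (!o) o f) (s := [!o, o, o]) (t := [o])
    (by simp [IsPath, Slice.src, Slice.tgt, Piece.src, Piece.tgt])).whisker [] [!o]).comp_left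
      (z := [⟨[!o, o], .cup o, []⟩]) (u := [!o, o])
      (by simp [IsPath, Slice.src, Slice.tgt, Piece.src, Piece.tgt])).comp_right
      (z := [⟨[], .cap o, []⟩]) (u := [])
      (by simp [IsPath, Slice.src, Slice.tgt, Piece.src, Piece.tgt])
  have h4 := (TIso.of_localMove (.interchange (.cross (!o) o f) (.cup o) []) (s := [!o, o])
    (t := [o, !o, o, !o]) (by simp [IsPath, Slice.src, Slice.tgt, Piece.src, Piece.tgt])).comp_right
      (z := [⟨[o], .cap (!o), [!o]⟩, ⟨[], .cap o, []⟩]) (u := [])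
      (by simp [IsPath, Slice.src, Slice.tgt, Piece.src, Piece.tgt])
  have h5 := (((TIso.of_localMove (.zigzagLeft (!o)) (s := [!o]) (t := [!o])
    (by simp [IsPath, Slice.src, Slice.tgt, Piece.src, Piece.tgt])).whisker [o] []).comp_left
      (z := [⟨[], .cross (!o) o f, []⟩]) (u := [!o, o])
      (by simp [IsPath, Slice.src, Slice.tgt, Piece.src, Piece.tgt])).comp_right
      (z := [⟨[], .cap o, []⟩]) (u := [])
      (by simp [IsPath, Slice.src, Slice.tgt, Piece.src, Piece.tgt])
  simp [Piece.src, Piece.tgt] at h1 h2 h3 h4 h5 ⊢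
  exact h5.symm.trans (h4.trans (h3.trans (h2.trans h1)))

/-- A maximum formed with a strand that passes over other strands. -/
theorem TIso.dragRight_cap (a : Bool) (t : List Bool) :
    TIso (a :: (t ++ [!a])) t
      (TangleDiagram.whisker [] (dragRight a t) [!a] ++ [⟨t, .cap a, []⟩])
      (TangleDiagram.whisker [a] (dragLeft (!a) t) [] ++ [⟨[], .cap a, t⟩]) := by
  induction t with
  | nil => exact .refl ⟨rfl, rfl⟩
  | cons b t ih =>
    have h1 := (ih.whisker [b] []).comp_left (z := [⟨[], .cross a b true, t ++ [!a]⟩])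
      (u := a :: b :: (t ++ [!a])) (by simp [IsPath, Slice.src, Slice.tgt, Piece.src, Piece.tgt])
    have h2 := (TIso.interchange
      (show IsPath [a, b] [⟨[], .cross a b true, []⟩] [b, a] from ⟨rfl, rfl⟩)
      (isPath_dragLeft (!a) t)).comp_right (z := [⟨[b], .cap a, t⟩]) (u := b :: t)
      (by simp [IsPath, Slice.src, Slice.tgt, Piece.src, Piece.tgt])
    have h3 := ((TIso.of_localMove (.slideCap a b true) (s := [a, b, !a]) (t := [b])
      ⟨rfl, rfl, rfl⟩).whisker [] t).comp_left (z := TangleDiagram.whisker [a, b] (dragLeft (!a) t) [])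
      (u := a :: b :: (t ++ [!a])) (by simpa using (isPath_dragLeft (!a) t).whisker [a, b] [])
    simp [dragRight, dragLeft, whisker_whisker] at h1 h2 h3 ⊢
    exact h1.trans (h2.trans h3)

/-! ### Layers -/

/-- A strand that starts and ends at the top, to the left and between the strands `t₁` and `t₂`, and
passes over all other strands. -/
def layer (o : Bool) (t₁ t₂ : List Bool) : List Slice :=
  ⟨[], .cup o, t₁ ++ t₂⟩ :: whisker [o] (dragRight (!o) t₁) t₂

theorem isPath_layer (o : Bool) (t₁ t₂ : List Bool) :
    IsPath (t₁ ++ t₂) (layer o t₁ t₂) (o :: (t₁ ++ (!o) :: t₂)) := by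
  refine ⟨rfl, ?_⟩
  simpa [Slice.tgt, Piece.tgt] using (isPath_dragRight (!o) t₁).whisker [o] t₂

theorem layer_eq_whisker (o : Bool) (t₁ t₂ : List Bool) :
    layer o t₁ t₂ = whisker [] (layer o t₁ []) t₂ := by
  simp [layer, whisker_whisker]

theorem layer_concat (o b : Bool) (t₁ t₂ : List Bool) :
    layer o (t₁ ++ [b]) t₂ =
      layer o t₁ (b :: t₂) ++ [⟨o :: t₁, .cross (!o) b true, t₂⟩] := by
  simp [layer, dragRight_append, dragRight, whisker_whisker]

/-- The slice lies between the two ends of the layer, whose strand runs over everything there. The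
slice can therefore be pulled down under it. -/
theorem TIso.layer_inner (o : Bool) (x : Slice) (t₂ : List Bool) :
    TIso (x.src ++ t₂) (o :: (x.tgt ++ (!o) :: t₂))
      (layer o x.src t₂ ++ [⟨o :: x.left, x.piece, x.right ++ (!o) :: t₂⟩])
      ([⟨x.left, x.piece, x.right ++ t₂⟩] ++ layer o x.tgt t₂) := by
  have h1 := ((TIso.dragRight_slice (!o) x).whisker [o] t₂).comp_left
    (z := [⟨[], .cup o, x.src ++ t₂⟩]) (u := x.src ++ t₂)
    (by simp [IsPath, Slice.src, Slice.tgt, Piece.src, Piece.tgt])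
  have h2 := (TIso.interchange (show IsPath [] [⟨[], .cup o, []⟩] [o, !o] from ⟨rfl, rfl⟩)
    (show IsPath (x.src ++ t₂) [⟨x.left, x.piece, x.right ++ t₂⟩] (x.tgt ++ t₂) by
      simp [IsPath, Slice.src, Slice.tgt])).comp_right
    (z := TangleDiagram.whisker [o] (dragRight (!o) x.tgt) t₂) (u := o :: (x.tgt ++ (!o) :: t₂))
    (by simpa using (isPath_dragRight (!o) x.tgt).whisker [o] t₂)
  simp [layer] at h1 h2 ⊢
  exact h1.symm.trans h2

/-- To the right of the layer nothing is crossed, so this is only an exchange of heights. -/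
theorem TIso.layer_outer (o : Bool) (t₁ : List Bool) (x : Slice) :
    TIso (t₁ ++ x.src) (o :: (t₁ ++ (!o) :: x.tgt))
      (layer o t₁ x.src ++ [⟨o :: (t₁ ++ (!o) :: x.left), x.piece, x.right⟩])
      ([⟨t₁ ++ x.left, x.piece, x.right⟩] ++ layer o t₁ x.tgt) := by
  have h := TIso.interchange (isPath_layer o t₁ [])
    (show IsPath x.src [x] x.tgt from ⟨rfl, rfl⟩)
  rw [← layer_eq_whisker, ← layer_eq_whisker] at h
  simpa using h

/-- The right end is joined to its right neighbour. The maximum slides back along the layer to the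
minimum where the layer starts, and the resulting zigzag is straightened. -/
theorem TIso.layer_cap (o : Bool) (t₁ t₂ : List Bool) :
    TIso (t₁ ++ o :: t₂) (o :: (t₁ ++ t₂))
      (layer o t₁ (o :: t₂) ++ [⟨o :: t₁, .cap (!o), t₂⟩])
      (TangleDiagram.whisker [] (dragLeft o t₁) t₂) := by
  have h1 := ((TIso.dragRight_cap (!o) t₁).whisker [o] t₂).comp_left
    (z := [⟨[], .cup o, t₁ ++ o :: t₂⟩]) (u := t₁ ++ o :: t₂)
    (by simp [IsPath, Slice.src, Slice.tgt, Piece.src, Piece.tgt])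
  have h2 := ((TIso.interchange (show IsPath [] [⟨[], .cup o, []⟩] [o, !o] from ⟨rfl, rfl⟩)
    (isPath_dragLeft o t₁)).whisker [] t₂).comp_right (z := [⟨[o], .cap (!o), t₁ ++ t₂⟩])
    (u := o :: (t₁ ++ t₂)) (by simp [IsPath, Slice.src, Slice.tgt, Piece.src, Piece.tgt])
  have h3 := ((TIso.of_localMove (.zigzagRight o) (s := [o]) (t := [o])
    (by simp [IsPath, Slice.src, Slice.tgt, Piece.src, Piece.tgt])).whisker [] (t₁ ++ t₂)).comp_left
    (z := TangleDiagram.whisker [] (dragLeft o t₁) t₂) (u := t₁ ++ o :: t₂)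
    (by simpa using (isPath_dragLeft o t₁).whisker [] t₂)
  simp [layer, whisker_whisker] at h1 h2 h3 ⊢
  exact h1.trans (h2.trans h3)

/-- The right end is joined to the strand that it crossed last; the curl at the maximum absorbs this
crossing and leaves the situation of `TIso.layer_cap`. -/
theorem TIso.layer_cap' (o : Bool) (t₁ t₂ : List Bool) :
    TIso (t₁ ++ o :: t₂) (o :: (t₁ ++ t₂))
      (layer o (t₁ ++ [o]) t₂ ++ [⟨o :: t₁, .cap o, t₂⟩])
      (TangleDiagram.whisker [] (dragLeft o t₁) t₂) := by
  have h := ((TIso.cap_curl o true).whisker (o :: t₁) t₂).comp_left (z := layer o t₁ (o :: t₂))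
    (u := t₁ ++ o :: t₂) (by simpa using isPath_layer o t₁ (o :: t₂))
  rw [layer_concat]
  simp at h ⊢
  exact h.trans (by simpa using TIso.layer_cap o t₁ t₂)

theorem layer_cons (o b : Bool) (t₁ t₂ : List Bool) :
    layer o (b :: t₁) t₂ = ⟨[], .cup o, b :: (t₁ ++ t₂)⟩ :: ⟨[o], .cross (!o) b true, t₁ ++ t₂⟩ ::
      whisker [o, b] (dragRight (!o) t₁) t₂ := by
  simp [layer, dragRight, whisker_whisker]

/-- Both legs of the layer now pass over its first strand. The minimum slides across that strand, a
second Reidemeister move cancels the remaining crossings, and the layer starts one place further to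
the right. -/
theorem TIso.layer_cross (o b : Bool) (t₁ t₂ : List Bool) :
    TIso (b :: (t₁ ++ t₂)) (b :: o :: (t₁ ++ (!o) :: t₂))
      (layer o (b :: t₁) t₂ ++ [⟨[], .cross o b true, t₁ ++ (!o) :: t₂⟩])
      (⟨[b], .cup o, t₁ ++ t₂⟩ :: TangleDiagram.whisker [b, o] (dragRight (!o) t₁) t₂) := by
  have h1 := ((TIso.interchange
    (show IsPath [o, b] [⟨[], .cross o b true, []⟩] [b, o] from ⟨rfl, rfl⟩)
    (isPath_dragRight (!o) t₁)).whisker [] t₂).comp_left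
      (z := [⟨[], .cup o, b :: (t₁ ++ t₂)⟩, ⟨[o], .cross (!o) b true, t₁ ++ t₂⟩])
      (u := b :: (t₁ ++ t₂)) (by simp [IsPath, Slice.src, Slice.tgt, Piece.src, Piece.tgt])
  have h2 := ((TIso.of_localMove (.slideCup o b false) (s := [b]) (t := [o, b, !o])
    ⟨rfl, rfl, rfl⟩).whisker [] (t₁ ++ t₂)).comp_right
      (z := ⟨[], .cross o b true, (!o) :: (t₁ ++ t₂)⟩ ::
        TangleDiagram.whisker [b, o] (dragRight (!o) t₁) t₂) (u := b :: o :: (t₁ ++ (!o) :: t₂)) (by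
      refine ⟨by simp [Slice.src, Piece.src], ?_⟩
      simpa [Slice.tgt, Piece.tgt] using (isPath_dragRight (!o) t₁).whisker [b, o] t₂)
  have h3 := ((TIso.reidemeisterTwo [] ((!o) :: (t₁ ++ t₂)) b o false).comp_left
    (z := [⟨[b], .cup o, t₁ ++ t₂⟩]) (u := b :: (t₁ ++ t₂))
    (by simp [IsPath, Slice.src, Slice.tgt, Piece.src, Piece.tgt])).comp_right
      (z := TangleDiagram.whisker [b, o] (dragRight (!o) t₁) t₂) (u := b :: o :: (t₁ ++ (!o) :: t₂))
      (by simpa using (isPath_dragRight (!o) t₁).whisker [b, o] t₂)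
  rw [layer_cons]
  simp [whisker_whisker] at h1 h2 h3 ⊢
  exact h1.symm.trans (h2.symm.trans h3)

/-- The layer crosses its first strand and then joins it: a curl, removed by Reidemeister I. The
rest of the layer continues that strand. -/
theorem TIso.layer_cap_left (o : Bool) (t₁ t₂ : List Bool) :
    TIso ((!o) :: (t₁ ++ t₂)) (t₁ ++ (!o) :: t₂)
      (layer o ((!o) :: t₁) t₂ ++ [⟨[], .cap o, t₁ ++ (!o) :: t₂⟩])
      (TangleDiagram.whisker [] (dragRight (!o) t₁) t₂) := by
  have h1 := ((TIso.interchange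
    (show IsPath [o, !o] [⟨[], .cap o, []⟩] [] from ⟨rfl, rfl⟩)
    (isPath_dragRight (!o) t₁)).whisker [] t₂).comp_left
      (z := [⟨[], .cup o, (!o) :: (t₁ ++ t₂)⟩, ⟨[o], .cross (!o) (!o) true, t₁ ++ t₂⟩])
      (u := (!o) :: (t₁ ++ t₂)) (by simp [IsPath, Slice.src, Slice.tgt, Piece.src, Piece.tgt])
  have h2 := ((TIso.of_localMove (.reidemeisterOneLeft (!o) true) (s := [!o]) (t := [!o])
    (by simp [IsPath, Slice.src, Slice.tgt, Piece.src, Piece.tgt])).whisker [] (t₁ ++ t₂)).comp_right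
      (z := TangleDiagram.whisker [] (dragRight (!o) t₁) t₂) (u := t₁ ++ (!o) :: t₂)
      (by simpa using (isPath_dragRight (!o) t₁).whisker [] t₂)
  rw [layer_cons]
  simp [whisker_whisker] at h1 h2 ⊢
  exact h1.symm.trans h2

/-! ### Normal forms span the skein modules -/

section Span

variable {R : Type*} [CommRing R]

/-- A function on diagrams that satisfies the skein relation with parameter `z` and vanishes on
diagrams with a split unknot. -/
structure IsSkeinFunctional (z : R) (D : List Slice → R) : Prop where
  iso : ∀ {s t : List Bool} {x y u : List Slice}, TIso s t x y → IsPath [] u s → ∀ v,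
    D (u ++ x ++ v) = D (u ++ y ++ v)
  skein : ∀ {l r : List Bool} {a b fp fm : Bool} {u : List Slice},
    isPositive a b fp = true → isPositive a b fm = false → IsPath [] u (l ++ [a, b] ++ r) → ∀ v,
    D (u ++ [⟨l, .cross a b fp, r⟩] ++ v) - D (u ++ [⟨l, .cross a b fm, r⟩] ++ v) =
      z * D (u ++ smoothCrossing l a b r ++ v)
  circle : ∀ {s : List Bool} {u : List Slice} (o : Bool), IsPath [] u s → ∀ v,
    D (u ++ [⟨[], .cup o, s⟩, ⟨[], .cap o, s⟩] ++ v) = 0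

/-- Diagrams that consist of layers, each of which is one strand that passes over all strands of the
previous layers. -/
inductive Layered : List Bool → List Slice → Prop
  | nil : Layered [] []
  | cons (o : Bool) (t₁ t₂ : List Bool) {X : List Slice} (h : Layered (t₁ ++ t₂) X) :
      Layered (o :: (t₁ ++ (!o) :: t₂)) (X ++ layer o t₁ t₂)

theorem Layered.isPath {s : List Bool} {X : List Slice} (h : Layered s X) : IsPath [] X s := by
  induction h with
  | nil => rfl
  | cons o t₁ t₂ _ ih => exact ih.append (isPath_layer o t₁ t₂)

/-- The operation on functions of the continuations of a diagram that corresponds to putting `Y` on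
top of the diagram. -/
def extend (R : Type*) [CommRing R] (Y : List Slice) :
    (List Slice → R) →ₗ[R] (List Slice → R) :=
  LinearMap.funLeft R R (fun v => Y ++ v)

theorem extend_apply (Y : List Slice) (f : List Slice → R) (v : List Slice) :
    extend R Y f v = f (Y ++ v) := rfl

theorem extend_append (Y Z : List Slice) (f : List Slice → R) :
    extend R (Y ++ Z) f = extend R Z (extend R Y f) := by
  funext v
  simp [extend_apply]

variable (D : List Slice → R)

/-- The span of the layered diagrams with top boundary `s`. -/
def layeredSpan (s : List Bool) : Submodule R (List Slice → R) :=
  Submodule.span R {f | ∃ X, Layered s X ∧ f = fun v => D (X ++ v)}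

/-- Putting `Y` on top maps the span of layered diagrams to the span of layered diagrams. -/
def Acts (s : List Bool) (Y : List Slice) (t : List Bool) : Prop :=
  ∀ f ∈ layeredSpan D s, extend R Y f ∈ layeredSpan D t

variable {D}

theorem acts_of_layered {s t : List Bool} {Y : List Slice}
    (h : ∀ X, Layered s X → (fun v => D (X ++ Y ++ v)) ∈ layeredSpan D t) : Acts D s Y t := by
  intro f hf
  induction hf using Submodule.span_induction with
  | mem f hf =>
    obtain ⟨X, hX, rfl⟩ := hf
    have := h X hX
    simpa [extend, LinearMap.funLeft, Function.comp_def] using this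
  | zero => rw [map_zero]; exact zero_mem _
  | add f g _ _ hf hg => rw [map_add]; exact add_mem hf hg
  | smul k f _ hf => rw [map_smul]; exact Submodule.smul_mem _ k hf

theorem acts_nil (s : List Bool) : Acts D s [] s := fun _ hf => hf

theorem Acts.comp {s t u : List Bool} {Y Z : List Slice} (h : Acts D s Y t) (h' : Acts D t Z u) :
    Acts D s (Y ++ Z) u := by
  intro f hf
  rw [extend_append]
  exact h' _ (h f hf)

theorem acts_layer (o : Bool) (t₁ t₂ : List Bool) :
    Acts D (t₁ ++ t₂) (layer o t₁ t₂) (o :: (t₁ ++ (!o) :: t₂)) :=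
  acts_of_layered fun _ hX => Submodule.subset_span ⟨_, hX.cons o t₁ t₂, rfl⟩

/-- It suffices to consider the last layer. -/
theorem acts_of_layer {o : Bool} {s t : List Bool} {Y : List Slice}
    (h : ∀ t₁ t₂, s = t₁ ++ (!o) :: t₂ → Acts D (t₁ ++ t₂) (layer o t₁ t₂ ++ Y) t) :
    Acts D (o :: s) Y t := by
  refine acts_of_layered fun X hX => ?_
  generalize hs : o :: s = s' at hX
  cases hX with
  | nil => cases hs
  | cons o' t₁ t₂ hX =>
    obtain ⟨rfl, rfl⟩ : o = o' ∧ s = t₁ ++ (!o') :: t₂ := by simpa using hs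
    rename_i X
    have := h t₁ t₂ rfl (fun v => D (X ++ v)) (Submodule.subset_span ⟨_, hX, rfl⟩)
    simpa [extend, LinearMap.funLeft, Function.comp_def] using this

variable {z : R}

theorem Acts.iso (hD : IsSkeinFunctional z D) {s t : List Bool} {Y Y' : List Slice}
    (h : Acts D s Y' t) (hY : TIso s t Y Y') : Acts D s Y t := by
  refine acts_of_layered fun X hX => ?_
  have h1 : (fun v => D (X ++ Y ++ v)) = fun v => D (X ++ Y' ++ v) :=
    funext fun v => hD.iso hY hX.isPath v
  rw [h1]
  have := h (fun v => D (X ++ v)) (Submodule.subset_span ⟨_, hX, rfl⟩)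
  simpa [extend, LinearMap.funLeft, Function.comp_def] using this

/-- It suffices to treat one sign of a crossing, together with the smoothing; the skein relation
supplies the other sign. -/
theorem Acts.skein (hD : IsSkeinFunctional z D) {s l r t : List Bool} {a b f : Bool}
    {Y : List Slice} (hY : IsPath s Y (l ++ [a, b] ++ r))
    (h : Acts D s (Y ++ [⟨l, .cross a b f, r⟩]) t)
    (h' : Acts D s (Y ++ smoothCrossing l a b r) t) :
    Acts D s (Y ++ [⟨l, .cross a b (!f), r⟩]) t := by
  refine acts_of_layered fun X hX => ?_
  have e1 := h (fun v => D (X ++ v)) (Submodule.subset_span ⟨_, hX, rfl⟩)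
  have e2 := h' (fun v => D (X ++ v)) (Submodule.subset_span ⟨_, hX, rfl⟩)
  by_cases hp : isPositive a b f = true
  · have hm : isPositive a b (!f) = false := by
      revert hp; cases a <;> cases b <;> cases f <;> decide
    convert sub_mem e1 (Submodule.smul_mem _ z e2) using 1
    funext v
    have := hD.skein hp hm (hX.isPath.append hY) v
    simp only [List.append_assoc] at this
    simp only [extend_apply, Pi.sub_apply, Pi.smul_apply, smul_eq_mul, List.append_assoc]
    linear_combination -this
  · have hp' : isPositive a b (!f) = true := by
      revert hp; cases a <;> cases b <;> cases f <;> decide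
    convert add_mem e1 (Submodule.smul_mem _ z e2) using 1
    funext v
    have := hD.skein hp' (by simpa using hp) (hX.isPath.append hY) v
    simp only [List.append_assoc] at this
    simp only [extend_apply, Pi.add_apply, Pi.smul_apply, smul_eq_mul, List.append_assoc]
    linear_combination this

theorem acts_circle (hD : IsSkeinFunctional z D) (o : Bool) (s : List Bool) :
    Acts D s [⟨[], .cup o, s⟩, ⟨[], .cap o, s⟩] s := by
  refine acts_of_layered fun X hX => ?_
  have h : (fun v => D (X ++ [⟨[], .cup o, s⟩, ⟨[], .cap o, s⟩] ++ v)) = 0 :=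
    funext fun v => hD.circle o hX.isPath v
  rw [h]
  exact zero_mem _

/-- A minimum at the far left is itself a layer. Any other minimum is pushed below the last layer,
where two strands fewer are present. -/
theorem acts_cup (hD : IsSkeinFunctional z D) (n : ℕ) : ∀ (l r : List Bool) (o : Bool),
    (l ++ r).length = n → Acts D (l ++ r) [⟨l, .cup o, r⟩] (l ++ [o, !o] ++ r) := by
  induction n using Nat.strong_induction_on with
  | _ n ih =>
    intro l r o hn
    cases l with
    | nil => exact acts_layer o [] r
    | cons o' l =>
      refine acts_of_layer fun t₁ t₂ h => ?_
      -- The position of the minimum relative to the right end of the last layer decides whether it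
      -- passes under the layer or beside it.
      rcases List.append_eq_append_iff.1 h with ⟨m, rfl, rfl⟩ | ⟨m, rfl, hm⟩
      · have h1 := (ih (l ++ (m ++ t₂)).length (by simp at hn ⊢; omega) l (m ++ t₂) o rfl).comp
          (by simpa using acts_layer o' (l ++ [o, !o] ++ m) t₂)
        refine Acts.iso hD (by simpa using h1) ?_
        simpa [Slice.src, Slice.tgt, Piece.src, Piece.tgt] using
          TIso.layer_inner o' ⟨l, .cup o, m⟩ t₂
      · cases m with
        | nil =>
          obtain rfl : (!o') :: t₂ = r := by simpa using hm
          have h1 := (ih (t₁ ++ t₂).length (by simp at hn ⊢; omega) t₁ t₂ o rfl).comp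
            (by simpa using acts_layer o' (t₁ ++ [o, !o]) t₂)
          refine Acts.iso hD (by simpa using h1) ?_
          simpa [Slice.src, Slice.tgt, Piece.src, Piece.tgt] using
            TIso.layer_inner o' ⟨t₁, .cup o, []⟩ t₂
        | cons b m =>
          obtain ⟨rfl, rfl⟩ : (!o') = b ∧ t₂ = m ++ r := by simpa using hm
          have h1 := (ih (t₁ ++ m ++ r).length (by simp at hn ⊢; omega) (t₁ ++ m) r o rfl).comp
            (by simpa using acts_layer o' t₁ (m ++ [o, !o] ++ r))
          refine Acts.iso hD (by simpa using h1) ?_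
          simpa [Slice.src, Slice.tgt, Piece.src, Piece.tgt] using
            TIso.layer_outer o' t₁ ⟨m, .cup o, r⟩

/-- Crossings between `n` strands with at least `k` strands to their left preserve the span of
layered diagrams. -/
def CrossingsAct (D : List Slice → R) (k n : ℕ) : Prop := ∀ (l r : List Bool) (a b f : Bool),
  k ≤ l.length → (l ++ [a, b] ++ r).length = n →
    Acts D (l ++ [a, b] ++ r) [⟨l, .cross a b f, r⟩] (l ++ [b, a] ++ r)

/-- All slices are crossings with at least `k` strands to their left. -/
def IsBraid (k : ℕ) (Y : List Slice) : Prop :=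
  ∀ x ∈ Y, k ≤ x.left.length ∧ ∃ a b f, x.piece = .cross a b f

theorem CrossingsAct.acts {k n : ℕ} (h : CrossingsAct D k n) {Y : List Slice}
    (hY : IsBraid k Y) {s t : List Bool} (hp : IsPath s Y t)
    (hn : s.length = n) : Acts D s Y t := by
  induction Y generalizing s with
  | nil => cases hp; exact acts_nil t
  | cons x Y ih =>
    obtain ⟨rfl, hp⟩ := hp
    obtain ⟨hk, a, b, f, hx⟩ := hY x (by simp)
    obtain ⟨l, P, r⟩ := x
    obtain rfl : P = .cross a b f := hx
    have h1 : Acts D _ Y t := ih (fun x hx => hY x (by simp [hx])) hp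
      (by simp [Slice.src, Slice.tgt, Piece.src, Piece.tgt] at hn ⊢; omega)
    have h2 := (h l r a b f hk hn).comp h1
    exact h2

theorem IsBraid.whisker {k : ℕ} {l r : List Bool} {Y : List Slice} (h : IsBraid 0 Y)
    (hk : k ≤ l.length) : IsBraid k (whisker l Y r) := by
  intro x hx
  obtain ⟨y, hy, rfl⟩ := List.mem_map.1 hx
  exact ⟨by simp; omega, (h y hy).2⟩

theorem isBraid_dragRight (a : Bool) (t : List Bool) : IsBraid 0 (dragRight a t) := by
  induction t with
  | nil => simp [dragRight, IsBraid]
  | cons b t ih =>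
    rintro x (_ | ⟨_, hx⟩)
    · exact ⟨Nat.zero_le _, _, _, _, rfl⟩
    · exact ih.whisker (Nat.zero_le _) x hx

theorem isBraid_dragLeft (a : Bool) (t : List Bool) : IsBraid 0 (dragLeft a t) := by
  induction t with
  | nil => simp [dragLeft, IsBraid]
  | cons b t ih =>
    intro x hx
    rcases List.mem_append.1 hx with hx | hx
    · exact ih.whisker (Nat.zero_le _) x hx
    · obtain rfl := List.mem_singleton.1 hx
      exact ⟨Nat.zero_le _, _, _, _, rfl⟩

theorem CrossingsAct.dragRight {k n : ℕ} (h : CrossingsAct D k n) (a : Bool) (l t r : List Bool)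
    (hk : k ≤ l.length) (hn : l.length + t.length + r.length + 1 = n) :
    Acts D (l ++ a :: (t ++ r)) (whisker l (dragRight a t) r) (l ++ (t ++ a :: r)) :=
  h.acts ((isBraid_dragRight a t).whisker hk)
    (by simpa using (isPath_dragRight a t).whisker l r) (by simp; omega)

theorem CrossingsAct.dragLeft {n : ℕ} (h : CrossingsAct D 0 n) (a : Bool) (t r : List Bool)
    (hn : t.length + r.length + 1 = n) :
    Acts D (t ++ a :: r) (whisker [] (dragLeft a t) r) (a :: (t ++ r)) :=
  h.acts ((isBraid_dragLeft a t).whisker (Nat.zero_le _))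
    (by simpa using (isPath_dragLeft a t).whisker [] r) (by simp; omega)

/-- A maximum on the left preserves the span of layered diagrams. -/
theorem acts_cap_left (hD : IsSkeinFunctional z D) (o : Bool) (s : List Bool)
    (h : CrossingsAct D 0 s.length) : Acts D (o :: (!o) :: s) [⟨[], .cap o, s⟩] s := by
  refine acts_of_layer fun t₁ t₂ hs => ?_
  cases t₁ with
  -- With nothing between its ends, the last layer closes up to a split circle.
  | nil =>
    obtain rfl : s = t₂ := by simpa using hs
    exact acts_circle hD o s
  | cons b t₁ =>
    obtain ⟨rfl, rfl⟩ : (!o) = b ∧ s = t₁ ++ (!o) :: t₂ := by simpa using hs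
    refine Acts.iso hD ?_ (TIso.layer_cap_left o t₁ t₂)
    simpa using h.dragRight (!o) [] t₁ t₂ (Nat.zero_le _) (by simp; omega)

theorem smoothCrossing_self (l r : List Bool) (a : Bool) : smoothCrossing l a a r = [] := by
  simp [smoothCrossing]

theorem smoothCrossing_not (l r : List Bool) (a : Bool) :
    smoothCrossing l a (!a) r = [⟨l, .cap a, r⟩, ⟨l, .cup (!a), r⟩] := by
  simp [smoothCrossing]

theorem smoothCrossing_not' (l r : List Bool) (a : Bool) :
    smoothCrossing l (!a) a r = [⟨l, .cap (!a), r⟩, ⟨l, .cup a, r⟩] := by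
  simp [smoothCrossing]

/-- Such a crossing avoids the left end of the last layer. If it avoids the right end as well, it
moves below the layer, to `n - 2` strands. If it involves the right end, one sign merely lengthens
or shortens the layer, and the other sign follows from the skein relation: in the smoothing, the
maximum dissolves the layer into crossings between `n - 2` strands, followed by a minimum. -/
theorem crossingsAct_one (hD : IsSkeinFunctional z D) {n : ℕ}
    (ih : ∀ m < n, CrossingsAct D 0 m) : CrossingsAct D 1 n := by
  intro l r a b f hl hn
  obtain ⟨o, l, rfl⟩ := List.exists_cons_of_length_pos hl
  refine acts_of_layer fun t₁ t₂ hs => ?_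
  -- The right end of the layer is the left strand of the crossing. Splitting the list of strands
  -- produces this case twice.
  have outer : ∀ b' r', b :: r = b' :: r' → (!o) = a → l = t₁ → t₂ = b :: r →
      Acts D (t₁ ++ t₂) (layer o t₁ t₂ ++ [⟨o :: l, .cross a b f, r⟩])
        ((o :: l) ++ [b, a] ++ r) := by
    rintro - - - rfl rfl rfl
    have h1 : Acts D (l ++ b :: r) (layer o l (b :: r) ++ [⟨o :: l, .cross (!o) b true, r⟩])
        ((o :: l) ++ [b, !o] ++ r) := by
      rw [← layer_concat]
      simpa using acts_layer o (l ++ [b]) r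
    cases f with
    | true => exact h1
    | false =>
      refine Acts.skein hD (by simpa using isPath_layer o l (b :: r)) h1 ?_
      rcases Bool.eq_or_eq_not b (!o) with rfl | hb
      · simpa [smoothCrossing_self] using acts_layer o l ((!o) :: r)
      · obtain rfl : b = o := by simpa using hb
        rw [smoothCrossing_not']
        have h2 := ((ih (n - 2) (by simp at hn; omega)).dragLeft b l r (by simp at hn; omega)).iso hD
          (TIso.layer_cap b l r)
        have h3 := h2.comp (acts_cup hD _ (b :: l) r b rfl)
        simpa using h3
  rcases List.append_eq_append_iff.1 ((List.append_assoc _ _ _).symm.trans hs) with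
    ⟨m, rfl, hm⟩ | ⟨m, rfl, hm⟩
  · cases m with
    | nil =>
      obtain ⟨rfl, rfl⟩ : a = (!o) ∧ b :: r = t₂ := by simpa using hm
      simpa using outer b r rfl rfl (by simp) rfl
    | cons a' m =>
      cases m with
      | nil =>
        obtain ⟨rfl, rfl, rfl⟩ : a = a' ∧ b = (!o) ∧ r = t₂ := by simpa using hm
        -- The right end crosses back over the strand that it crossed last, so the layer becomes
        -- shorter by Reidemeister II.
        have h1 : Acts D (l ++ [a] ++ r) (layer o (l ++ [a]) r ++
            [⟨o :: l, .cross a (!o) false, r⟩]) ((o :: l) ++ [!o, a] ++ r) := by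
          have h2 := (TIso.reidemeisterTwo (o :: l) r (!o) a true).comp_left
            (z := layer o l (a :: r)) (u := l ++ [a] ++ r)
            (by simpa using isPath_layer o l (a :: r))
          rw [layer_concat]
          refine Acts.iso hD (Y' := layer o l (a :: r)) ?_ (by simpa using h2)
          simpa using acts_layer o l (a :: r)
        cases f with
        | false => exact h1
        | true =>
          refine Acts.skein hD (by simpa using isPath_layer o (l ++ [a]) r) h1 ?_
          rcases Bool.eq_or_eq_not a (!o) with rfl | hb
          · simpa [smoothCrossing_self] using acts_layer o (l ++ [!o]) r
          · obtain rfl : a = o := by simpa using hb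
            rw [smoothCrossing_not]
            have h2 := ((ih (n - 2) (by simp at hn; omega)).dragLeft a l r
              (by simp at hn; omega)).iso hD (TIso.layer_cap' a l r)
            have h3 := h2.comp (acts_cup hD _ (a :: l) r (!a) rfl)
            simpa using h3
      | cons b' m =>
        obtain ⟨rfl, rfl, rfl⟩ : a = a' ∧ b = b' ∧ r = m ++ (!o) :: t₂ := by simpa using hm
        have h1 := (ih (n - 2) (by simp at hn; omega) l (m ++ t₂) a b f (Nat.zero_le _)
          (by simp at hn ⊢; omega)).comp (by simpa using acts_layer o (l ++ [b, a] ++ m) t₂)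
        refine Acts.iso hD (by simpa using h1) ?_
        simpa [Slice.src, Slice.tgt, Piece.src, Piece.tgt] using
          TIso.layer_inner o ⟨l, .cross a b f, m⟩ t₂
  · cases m with
    | nil =>
      obtain ⟨rfl, rfl⟩ : (!o) = a ∧ t₂ = b :: r := by simpa using hm
      simpa using outer b r rfl rfl (by simp) rfl
    | cons a' m =>
      obtain ⟨rfl, rfl⟩ : (!o) = a' ∧ t₂ = m ++ a :: b :: r := by simpa using hm
      have h1 := (ih (n - 2) (by simp at hn; omega) (t₁ ++ m) r a b f (Nat.zero_le _)
        (by simp at hn ⊢; omega)).comp (by simpa using acts_layer o t₁ (m ++ [b, a] ++ r))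
      refine Acts.iso hD (by simpa using h1) ?_
      simpa [Slice.src, Slice.tgt, Piece.src, Piece.tgt] using
        TIso.layer_outer o t₁ ⟨m, .cross a b f, r⟩

/-- What remains is a crossing at the far left, which involves the left end of the last layer. With
that end on top, the crossing is either a curl of the layer with itself or moves the start of the
layer to the right. The latter leaves crossings between the same number of strands, but with a
strand to their left, which is why `crossingsAct_one` comes first. -/
theorem crossingsAct (hD : IsSkeinFunctional z D) (n : ℕ) : CrossingsAct D 0 n := by
  induction n using Nat.strong_induction_on with
  | _ n ih =>
    intro l r a b f _ hn
    cases l with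
    | cons o l => exact crossingsAct_one hD ih (o :: l) r a b f (by simp) hn
    | nil =>
      have h1 : Acts D ([] ++ [a, b] ++ r) [⟨[], .cross a b true, r⟩] ([] ++ [b, a] ++ r) := by
        refine acts_of_layer fun t₁ t₂ hs => ?_
        cases t₁ with
        | nil =>
          obtain ⟨rfl, rfl⟩ : b = (!a) ∧ r = t₂ := by simpa using hs
          have h2 := (TIso.cup_curl a true).whisker [] r
          refine Acts.iso hD (Y' := layer (!a) [] r) ?_ (by simpa [layer, dragRight] using h2)
          simpa using acts_layer (!a) [] r
        | cons b' t₁ =>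
          obtain ⟨rfl, rfl⟩ : b = b' ∧ r = t₁ ++ (!a) :: t₂ := by simpa using hs
          refine Acts.iso hD ?_ (by simpa using TIso.layer_cross a b t₁ t₂)
          have h2 := (acts_cup hD _ [b] (t₁ ++ t₂) a rfl).comp (by
            simpa using (crossingsAct_one hD ih).dragRight (!a) [b, a] t₁ t₂ (by simp)
              (by simp at hn ⊢; omega))
          simpa using h2
      cases f with
      | true => exact h1
      | false =>
        refine Acts.skein hD (Y := []) rfl h1 ?_
        rcases Bool.eq_or_eq_not b a with rfl | rfl
        · simpa [smoothCrossing_self] using acts_nil _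
        · rw [smoothCrossing_not]
          exact (acts_cap_left hD a r (ih _ (by simp at hn; omega))).comp
            (acts_cup hD _ [] r (!a) rfl) |> fun h => by simpa using h

/-- A strand to the left of the maximum is taken over to its right, until the maximum is leftmost.
The crossings needed for this are already known to act. -/
theorem acts_cap (hD : IsSkeinFunctional z D) (l : List Bool) : ∀ (r : List Bool) (o : Bool),
    Acts D (l ++ [o, !o] ++ r) [⟨l, .cap o, r⟩] (l ++ r) := by
  induction l using List.reverseRecOn with
  | nil => exact fun r o => acts_cap_left hD o r (crossingsAct hD _)
  | append_singleton l b ih =>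
    intro r o
    have h1 := (crossingsAct hD _).dragRight b l [o, !o] r (Nat.zero_le _) rfl
    have h2 := h1.comp (by simpa using ih (b :: r) o)
    have h3 := (TIso.dragRight_piece b (.cap o)).whisker l r
    refine Acts.iso hD (by simpa using h2) ?_
    simpa [dragRight, Piece.src, Piece.tgt] using h3

/-- Every diagram without lower boundary arises from the empty one by adding slices, so this is the
statement that layered diagrams span. -/
theorem acts_of_isPath (hD : IsSkeinFunctional z D) {s t : List Bool} {Y : List Slice}
    (h : IsPath s Y t) : Acts D s Y t := by
  induction Y generalizing s with
  | nil => cases h; exact acts_nil t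
  | cons x Y ih =>
    obtain ⟨rfl, h⟩ := h
    have h1 : Acts D x.src [x] x.tgt := by
      obtain ⟨l, P, r⟩ := x
      cases P with
      | cup o => simpa [Slice.src, Slice.tgt, Piece.src, Piece.tgt] using acts_cup hD _ l r o rfl
      | cap o => simpa [Slice.src, Slice.tgt, Piece.src, Piece.tgt] using acts_cap hD l r o
      | cross a b f => exact crossingsAct hD _ l r a b f (Nat.zero_le _) rfl
    exact h1.comp (ih h)

/-- The skein relation determines a function on link diagrams. -/
theorem IsSkeinFunctional.eq_smul (hD : IsSkeinFunctional z D) {w : List Slice}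
    (hw : IsPath [] w []) : ∃ k : R, D w = k * D [] := by
  have h := acts_of_isPath hD hw (fun v => D ([] ++ v))
    (Submodule.subset_span ⟨[], .nil, rfl⟩)
  -- Every layer adds two upper endpoints; over the empty boundary only the empty diagram is
  -- layered.
  have h1 : layeredSpan D [] = Submodule.span R {D} := by
    unfold layeredSpan
    congr 1
    ext f
    constructor
    · rintro ⟨X, hX, rfl⟩
      cases hX
      rfl
    · rintro rfl
      exact ⟨[], .nil, rfl⟩
  rw [h1] at h
  obtain ⟨k, hk⟩ := Submodule.mem_span_singleton.1 h
  refine ⟨k, ?_⟩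
  have := congrFun hk []
  simpa [extend_apply] using this.symm

end Span

/-! ### Uniqueness of the Alexander polynomial -/

section Unique

variable {R : Type*} [CommRing R]

open Classical in
/-- Extend a function on link diagrams by zero. -/
noncomputable def extendByZero (B : LinkDiagram → R) (w : List Slice) : R :=
  if h : IsPath [] w [] ∧ w ≠ [] then B ⟨w, h.1, h.2⟩ else 0

theorem extendByZero_eq (B : LinkDiagram → R) {w : List Slice} (h : IsPath [] w []) (h' : w ≠ []) :
    extendByZero B w = B ⟨w, h, h'⟩ := dif_pos ⟨h, h'⟩

theorem extendByZero_of_not (B : LinkDiagram → R) {w : List Slice} (h : ¬ IsPath [] w []) :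
    extendByZero B w = 0 := dif_neg fun h' => h h'.1

theorem extendByZero_nil (B : LinkDiagram → R) : extendByZero B [] = 0 :=
  dif_neg fun h' => h'.2 rfl

theorem isPath_append_iff {s t : List Bool} {u v x : List Slice} (hu : IsPath [] u s)
    (hx : IsPath s x t) : IsPath [] (u ++ x ++ v) [] ↔ IsPath t v [] := by
  constructor
  · intro h
    obtain ⟨m, h1, h2⟩ := isPath_append.1 h
    rwa [h1.tgt_unique (hu.append hx)] at h2
  · exact fun h => (hu.append hx).append h

/-- An isotopy invariant with a skein relation, up to its value on the unknot. -/
structure IsSkeinInvariant (z : R) (B : LinkDiagram → R) : Prop where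
  move : ∀ L L' : LinkDiagram, Move L.word L'.word → B L = B L'
  unknot : B unknot = 0
  skein : ∀ Lp Lm L0, SkeinTriple Lp Lm L0 → B Lp - B Lm = z * B L0

variable {z : R} {B : LinkDiagram → R}

/-- Words that do not fit together have value 0 on both sides simultaneously. When they do fit,
neither side is the artificial empty diagram, because a move that deletes all its slices takes place
on a strand. -/
theorem IsSkeinInvariant.iso (hB : IsSkeinInvariant z B) {s t : List Bool} {x y u : List Slice}
    (h : TIso s t x y) (hu : IsPath [] u s) (v : List Slice) :
    extendByZero B (u ++ x ++ v) = extendByZero B (u ++ y ++ v) := by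
  induction h generalizing u v with
  | refl => rfl
  | symm _ ih => exact (ih hu v).symm
  | trans _ _ ih ih' => exact (ih hu v).trans (ih' hu v)
  | comp h h' ih ih' =>
    have e1 := ih hu
    have e2 := ih' (hu.append h.isPath.2)
    rw [← List.append_assoc, ← List.append_assoc, List.append_assoc, e1, ← List.append_assoc, e2]
  | @move s t x y l r h hx hy =>
    have hx' := hx.whisker l r
    have hy' := hy.whisker l r
    by_cases hv : IsPath (l ++ t ++ r) v []
    · have h1 := (isPath_append_iff hu hx').2 hv
      have h2 := (isPath_append_iff hu hy').2 hv
      have hne : x ≠ [] := by rintro rfl; cases h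
      obtain ⟨s', t', h3, -, h4⟩ := h.src_eq
      obtain rfl := hx.src_unique h3 hne
      rw [extendByZero_eq B h1 (by simp [whisker_eq_nil, hne]), extendByZero_eq B h2]
      · exact hB.move _ _ ⟨u, v, x, y, l, r, h, rfl, rfl⟩
      · intro he
        simp only [List.append_eq_nil_iff, whisker_eq_nil] at he
        obtain ⟨⟨rfl, rfl⟩, rfl⟩ := he
        have hs : [] = l ++ s ++ r := hu
        exact (h4 (Or.inr rfl)).1 (by simpa using hs.symm : l = [] ∧ s = [] ∧ r = []).2.1
    · rw [extendByZero_of_not, extendByZero_of_not]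
      · rwa [isPath_append_iff hu hy']
      · rwa [isPath_append_iff hu hx']

theorem isPath_smoothCrossing (l r : List Bool) (a b : Bool) :
    IsPath (l ++ [a, b] ++ r) (smoothCrossing l a b r) (l ++ [b, a] ++ r) := by
  rcases Bool.eq_or_eq_not b a with rfl | rfl
  · rw [smoothCrossing_self]; rfl
  · rw [smoothCrossing_not]
    simp [IsPath, Slice.src, Slice.tgt, Piece.src, Piece.tgt]

theorem IsSkeinInvariant.skein_word (hB : IsSkeinInvariant z B) {l r : List Bool}
    {a b fp fm : Bool} {u : List Slice} (hp : isPositive a b fp = true)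
    (hm : isPositive a b fm = false) (hu : IsPath [] u (l ++ [a, b] ++ r)) (v : List Slice) :
    extendByZero B (u ++ [⟨l, .cross a b fp, r⟩] ++ v) -
      extendByZero B (u ++ [⟨l, .cross a b fm, r⟩] ++ v) =
        z * extendByZero B (u ++ smoothCrossing l a b r ++ v) := by
  have hc : ∀ f, IsPath (l ++ [a, b] ++ r) [⟨l, .cross a b f, r⟩] (l ++ [b, a] ++ r) :=
    fun f => ⟨rfl, rfl⟩
  have hs := isPath_smoothCrossing l r a b
  by_cases hv : IsPath (l ++ [b, a] ++ r) v []
  · have hne : u ≠ [] := by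
      rintro rfl
      have : [] = l ++ [a, b] ++ r := hu
      simp at this
    rw [extendByZero_eq B ((isPath_append_iff hu (hc fp)).2 hv) (by simp),
      extendByZero_eq B ((isPath_append_iff hu (hc fm)).2 hv) (by simp),
      extendByZero_eq B ((isPath_append_iff hu hs).2 hv) (by simp [hne])]
    exact hB.skein _ _ _ ⟨u, v, l, r, a, b, fp, fm, hp, hm, rfl, rfl, rfl⟩
  · rw [extendByZero_of_not, extendByZero_of_not, extendByZero_of_not]
    · simp
    · rwa [isPath_append_iff hu hs]
    · rwa [isPath_append_iff hu (hc fm)]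
    · rwa [isPath_append_iff hu (hc fp)]

/-- The two orientations of an unknot. -/
theorem TIso.circle (o : Bool) : TIso [] [] [⟨[], .cup o, []⟩, ⟨[], .cap o, []⟩]
    [⟨[], .cup (!o), []⟩, ⟨[], .cap (!o), []⟩] := by
  have h1 := (TIso.cup_curl o true).comp_right (z := [⟨[], .cap (!o), []⟩]) (u := [])
    (by simp [IsPath, Slice.src, Slice.tgt, Piece.src, Piece.tgt])
  have h2 := (TIso.cap_curl (!o) true).comp_left (z := [⟨[], .cup o, []⟩]) (u := [])
    (by simp [IsPath, Slice.src, Slice.tgt, Piece.src, Piece.tgt])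
  simp at h1 h2
  exact h2.symm.trans h1

theorem isPath_circle (o : Bool) (s : List Bool) :
    IsPath s [⟨[], .cup o, s⟩, ⟨[], .cap o, s⟩] s := by
  simp [IsPath, Slice.src, Slice.tgt, Piece.src, Piece.tgt]

/-- Curls of both signs on the neighbouring strand are isotopic to that strand, so their difference
is 0. By the skein relation it is also `z` times the strand with a circle beside it, and `z` may be
cancelled. -/
theorem IsSkeinInvariant.circle_cons [NoZeroDivisors R] (hz : z ≠ 0) (hB : IsSkeinInvariant z B)
    {a : Bool} {s : List Bool} {u : List Slice} (o : Bool) (hu : IsPath [] u (a :: s))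
    (v : List Slice) :
    extendByZero B (u ++ [⟨[], .cup o, a :: s⟩, ⟨[], .cap o, a :: s⟩] ++ v) = 0 := by
  -- The curl yields only this orientation of the circle; the other one is isotopic to it.
  have key : extendByZero B (u ++ [⟨[], .cup (!a), a :: s⟩, ⟨[], .cap (!a), a :: s⟩] ++ v) = 0 := by
    have h1 : ∀ f, extendByZero B ((u ++ [⟨[], .cup (!a), a :: s⟩]) ++
        [⟨[!a], .cross a a f, s⟩] ++ ([⟨[], .cap (!a), a :: s⟩] ++ v)) =
          extendByZero B (u ++ v) := by
      intro f
      have h2 := (TIso.of_localMove (.reidemeisterOneLeft a f) (s := [a]) (t := [a])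
        (by simp [IsPath, Slice.src, Slice.tgt, Piece.src, Piece.tgt])).whisker [] s
      simpa using hB.iso h2 (by simpa using hu) v
    have h2 := hB.skein_word (l := [!a]) (r := s) (a := a) (b := a) (fp := true) (fm := false)
      (u := u ++ [⟨[], .cup (!a), a :: s⟩]) (by simp [isPositive]) (by simp [isPositive])
      (hu.append (by simp [IsPath, Slice.src, Slice.tgt, Piece.src, Piece.tgt]))
      ([⟨[], .cap (!a), a :: s⟩] ++ v)
    rw [h1, h1, sub_self, smoothCrossing_self] at h2
    have h3 := (mul_eq_zero.1 h2.symm).resolve_left hz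
    simpa using h3
  rcases Bool.eq_or_eq_not o (!a) with rfl | ho
  · exact key
  · obtain rfl : o = a := by simpa using ho
    have h := hB.iso (by simpa using (TIso.circle o).whisker [] (o :: s)) hu v
    rw [h]
    exact key

/-- If no strand is beside the circle, it is moved past the next minimum above it or the last
maximum below it, where a strand is present. If there is neither, the diagram is an unknot. -/
theorem IsSkeinInvariant.circle [NoZeroDivisors R] (hz : z ≠ 0) (hB : IsSkeinInvariant z B)
    {s : List Bool} {u : List Slice} (o : Bool) (hu : IsPath [] u s) (v : List Slice) :
    extendByZero B (u ++ [⟨[], .cup o, s⟩, ⟨[], .cap o, s⟩] ++ v) = 0 := by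
  cases s with
  | cons a s => exact hB.circle_cons hz o hu v
  | nil =>
    by_cases hv : IsPath [] v []
    · rcases eq_or_ne u [] with rfl | hne
      · cases v with
        | nil =>
          have key : extendByZero B [⟨[], .cup true, []⟩, ⟨[], .cap true, []⟩] = 0 :=
            (extendByZero_eq B TangleDiagram.unknot.isPath TangleDiagram.unknot.nonempty).trans
              hB.unknot
          cases o with
          | true => simpa using key
          | false =>
            have h := hB.iso (u := []) (TIso.circle false) rfl []
            simpa using h.trans (by simpa using key)
        | cons x v =>
          obtain ⟨o', rfl⟩ := Slice.src_eq_nil hv.1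
          have h := hB.iso (u := []) (TIso.interchange (isPath_circle o [])
            (show IsPath [] [⟨[], .cup o', []⟩] [o', !o'] from ⟨rfl, rfl⟩)) rfl v
          have h2 := hB.circle_cons hz (u := [⟨[], .cup o', []⟩]) (a := o') (s := [!o']) o
            ⟨rfl, rfl⟩ v
          simp at h h2 ⊢
          rw [h, h2]
      · obtain ⟨u, o', rfl, hu'⟩ := exists_last_cap hu hne
        have h := hB.iso (TIso.interchange (isPath_circle o [])
          (show IsPath [o', !o'] [⟨[], .cap o', []⟩] [] from ⟨rfl, rfl⟩)) hu' v
        have h2 := hB.circle_cons hz (u := u) (a := o') (s := [!o']) o hu'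
          ([⟨[], .cap o', []⟩] ++ v)
        simp at h h2 ⊢
        rw [← h, h2]
    · exact extendByZero_of_not B fun h => hv ((isPath_append_iff hu (isPath_circle o [])).1 h)

/-- The value at a link is a multiple of the value at the empty diagram, which is 0 by the choice of
the extension. -/
theorem IsSkeinInvariant.eq_zero [NoZeroDivisors R] (hz : z ≠ 0) (hB : IsSkeinInvariant z B)
    (L : LinkDiagram) : B L = 0 := by
  have hD : IsSkeinFunctional z (extendByZero B) :=
    ⟨fun h hu v => hB.iso h hu v, fun hp hm hu v => hB.skein_word hp hm hu v,
      fun o hu v => hB.circle hz o hu v⟩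
  obtain ⟨k, hk⟩ := hD.eq_smul L.isPath
  rw [extendByZero_nil, mul_zero, extendByZero_eq B L.isPath L.nonempty] at hk
  exact hk

end Unique

open LaurentPolynomial in
theorem T_injective : Function.Injective (T : ℤ → ℤ[T;T⁻¹]) := by
  intro m n h
  have h1 := congrArg (fun f : ℤ[T;T⁻¹] => f.coeff m) h
  simp only [T, AddMonoidAlgebra.coeff_single, Finsupp.single_apply] at h1
  by_contra hne
  simp [Ne.symm hne] at h1

open LaurentPolynomial in
theorem T_one_sub_T_neg_one_ne_zero : (T 1 - T (-1) : ℤ[T;T⁻¹]) ≠ 0 := by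
  intro h
  have h1 := T_injective (sub_eq_zero.1 h)
  omega

theorem IsAlexanderPolynomial.unique {A A' : LinkDiagram → LaurentPolynomial ℤ}
    (h : IsAlexanderPolynomial A) (h' : IsAlexanderPolynomial A') : A = A' := by
  have hB : IsSkeinInvariant (LaurentPolynomial.T 1 - LaurentPolynomial.T (-1))
      (fun L => A L - A' L) :=
    { move := fun L L' hm => by
        rw [h.invariant L L' (.rel _ _ hm), h'.invariant L L' (.rel _ _ hm)]
      unknot := by rw [h.unknot, h'.unknot, sub_self]
      skein := fun Lp Lm L0 ht => by
        linear_combination h.skein Lp Lm L0 ht - h'.skein Lp Lm L0 ht }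
  funext L
  exact sub_eq_zero.1 (hB.eq_zero T_one_sub_T_neg_one_ne_zero L)

/-! ### Planar matchings -/

/-- Renumber positions when `k` strands are inserted at position `l`. -/
def shift (l k i : ℕ) : ℕ := if i < l then i else i + k

/-- Renumber positions when `k` strands at position `l` are removed. -/
def unshift (l k i : ℕ) : ℕ := if i < l then i else i - k

theorem unshift_shift (l k i : ℕ) : unshift l k (shift l k i) = i := by
  unfold unshift shift; split_ifs <;> omega

theorem shift_lt_shift {l k i j : ℕ} : shift l k i < shift l k j ↔ i < j := by
  unfold shift; split_ifs <;> omega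

theorem shift_injective (l k : ℕ) : Function.Injective (shift l k) :=
  fun i j h => by rw [← unshift_shift l k i, h, unshift_shift]

theorem shift_lt_add {l k i n : ℕ} (hl : l ≤ n) : shift l k i < n + k ↔ i < n := by
  unfold shift; split_ifs <;> omega

theorem shift_cases (l k i : ℕ) : (∃ j, i = shift l k j) ∨ (l ≤ i ∧ i < l + k) := by
  by_cases h : i < l
  · exact .inl ⟨i, by simp [shift, h]⟩
  · by_cases h' : i < l + k
    · exact .inr ⟨by omega, h'⟩
    · exact .inl ⟨i - k, by unfold shift; split_ifs <;> omega⟩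

theorem shift_ne {l k i j : ℕ} (h : l ≤ j) (h' : j < l + k) : shift l k i ≠ j := by
  unfold shift; split_ifs <;> omega

/-- How the points on the upper line of a piece are joined, if the points on the lower line are
joined according to `m`; `none` stands for a strand that ends in the interior. -/
def linkStep (l : ℕ) (p : FlatPiece) (m : ℕ → Option ℕ) (i : ℕ) : Option ℕ :=
  match p with
  | .cup => if i = l then some (l + 1) else if i = l + 1 then some l else
      (m (unshift l 2 i)).map (shift l 2)
  | .birth => if i = l then none else (m (unshift l 1 i)).map (shift l 1)
  | .death => (m (shift l 1 i)).bind fun j => if j = l then none else some (unshift l 1 j)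
  | .cap => (m (shift l 2 i)).bind fun j =>
      if j = l then (m (l + 1)).map (unshift l 2) else
      if j = l + 1 then (m l).map (unshift l 2) else some (unshift l 2 j)

/-- The points `0, …, N - 1`, where `t` gives the orientations of the strands, are partially matched
by `m` without crossings. -/
structure IsMatching (N : ℕ) (t : ℕ → Bool) (m : ℕ → Option ℕ) : Prop where
  lt : ∀ i j, m i = some j → i < N
  symm : ∀ i j, m i = some j → m j = some i
  ne : ∀ i j, m i = some j → i ≠ j
  orient : ∀ i j, m i = some j → t j = !t i
  planar : ∀ i j k r, m i = some j → m k = some r → i < k → k < j → i < r ∧ r < j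

theorem IsMatching.lt' {N : ℕ} {t : ℕ → Bool} {m : ℕ → Option ℕ} (h : IsMatching N t m) {i j : ℕ}
    (hij : m i = some j) : j < N := h.lt j i (h.symm i j hij)

theorem linkStep_cup_left (l : ℕ) (m : ℕ → Option ℕ) : linkStep l .cup m l = some (l + 1) := by
  simp [linkStep]

theorem linkStep_cup_right (l : ℕ) (m : ℕ → Option ℕ) : linkStep l .cup m (l + 1) = some l := by
  simp [linkStep]

theorem linkStep_cup_shift (l : ℕ) (m : ℕ → Option ℕ) (i : ℕ) :
    linkStep l .cup m (shift l 2 i) = (m i).map (shift l 2) := by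
  simp [linkStep, shift_ne (l := l) (k := 2) (i := i) (j := l) le_rfl (by omega),
    shift_ne (l := l) (k := 2) (i := i) (j := l + 1) (by omega) (by omega), unshift_shift]

theorem linkStep_birth_self (l : ℕ) (m : ℕ → Option ℕ) : linkStep l .birth m l = none := by
  simp [linkStep]

theorem linkStep_birth_shift (l : ℕ) (m : ℕ → Option ℕ) (i : ℕ) :
    linkStep l .birth m (shift l 1 i) = (m i).map (shift l 1) := by
  simp [linkStep, shift_ne (l := l) (k := 1) (i := i) (j := l) le_rfl (by omega), unshift_shift]

theorem linkStep_death_eq_some {l : ℕ} {m : ℕ → Option ℕ} {i j : ℕ} :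
    linkStep l .death m i = some j ↔ m (shift l 1 i) = some (shift l 1 j) := by
  simp only [linkStep, Option.bind_eq_some_iff]
  constructor
  · rintro ⟨r, hr, h⟩
    rcases shift_cases l 1 r with ⟨r, rfl⟩ | h1
    · rw [if_neg (shift_ne le_rfl (by omega)), unshift_shift] at h
      simp_all
    · rw [if_pos (by omega)] at h
      simp at h
  · intro h
    exact ⟨_, h, by rw [if_neg (shift_ne le_rfl (by omega)), unshift_shift]⟩

theorem linkStep_cap_eq_some {N l : ℕ} {t : ℕ → Bool} {m : ℕ → Option ℕ} (h : IsMatching N t m)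
    {i j : ℕ} : linkStep l .cap m i = some j ↔ m (shift l 2 i) = some (shift l 2 j) ∨
      (m (shift l 2 i) = some l ∧ m (l + 1) = some (shift l 2 j)) ∨
      (m (shift l 2 i) = some (l + 1) ∧ m l = some (shift l 2 j)) := by
  have n1 : ∀ i, shift l 2 i ≠ l := fun i => shift_ne le_rfl (by omega)
  have n2 : ∀ i, shift l 2 i ≠ l + 1 := fun i => shift_ne (by omega) (by omega)
  simp only [linkStep, Option.bind_eq_some_iff]
  constructor
  · rintro ⟨r, hr, h'⟩
    split_ifs at h' with h1 h2
    · subst h1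
      obtain ⟨r', hr', rfl⟩ := Option.map_eq_some_iff.1 h'
      rcases shift_cases r 2 r' with ⟨r'', rfl⟩ | h3
      · rw [unshift_shift]; exact .inr (.inl ⟨hr, hr'⟩)
      · have e1 := h.symm _ _ hr
        have e2 := h.symm _ _ hr'
        have e3 := h.ne _ _ hr'
        obtain rfl : r' = r := by omega
        rw [e1] at e2
        exact absurd (Option.some.inj e2) (n2 i)
    · subst h2
      obtain ⟨r', hr', rfl⟩ := Option.map_eq_some_iff.1 h'
      rcases shift_cases l 2 r' with ⟨r'', rfl⟩ | h3
      · rw [unshift_shift]; exact .inr (.inr ⟨hr, hr'⟩)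
      · have e1 := h.symm _ _ hr
        have e2 := h.symm _ _ hr'
        have e3 := h.ne _ _ hr'
        obtain rfl : r' = l + 1 := by omega
        rw [e1] at e2
        exact absurd (Option.some.inj e2) (n1 i)
    · rcases shift_cases l 2 r with ⟨r, rfl⟩ | h3
      · rw [unshift_shift] at h'
        obtain rfl := Option.some.inj h'
        exact .inl hr
      · omega
  · rintro (h1 | ⟨h1, h2⟩ | ⟨h1, h2⟩)
    · exact ⟨_, h1, by rw [if_neg (n1 j), if_neg (n2 j), unshift_shift]⟩
    · exact ⟨_, h1, by rw [if_pos rfl, h2, Option.map_some, unshift_shift]⟩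
    · exact ⟨_, h1, by rw [if_neg (by omega), if_pos rfl, h2, Option.map_some, unshift_shift]⟩

theorem IsMatching.cup {N l : ℕ} {t t' : ℕ → Bool} {m : ℕ → Option ℕ} (h : IsMatching N t m)
    (hl : l ≤ N) (ht : ∀ i, t' (shift l 2 i) = t i) (ho : t' (l + 1) = !t' l) :
    IsMatching (N + 2) t' (linkStep l .cup m) := by
  have key : ∀ i j, linkStep l .cup m i = some j → (i = l ∧ j = l + 1) ∨ (i = l + 1 ∧ j = l) ∨
      ∃ i' j', m i' = some j' ∧ i = shift l 2 i' ∧ j = shift l 2 j' := by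
    intro i j hij
    rcases shift_cases l 2 i with ⟨i, rfl⟩ | h3
    · rw [linkStep_cup_shift] at hij
      obtain ⟨j', hj', rfl⟩ := Option.map_eq_some_iff.1 hij
      exact .inr (.inr ⟨_, _, hj', rfl, rfl⟩)
    · obtain rfl | rfl : i = l ∨ i = l + 1 := by omega
      · rw [linkStep_cup_left] at hij
        exact .inl ⟨rfl, (Option.some.inj hij).symm⟩
      · rw [linkStep_cup_right] at hij
        exact .inr (.inl ⟨rfl, (Option.some.inj hij).symm⟩)
  constructor
  · intro i j hij
    rcases key i j hij with ⟨rfl, rfl⟩ | ⟨rfl, rfl⟩ | ⟨i, j, h1, rfl, rfl⟩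
    · omega
    · omega
    · exact (shift_lt_add hl).2 (h.lt _ _ h1)
  · intro i j hij
    rcases key i j hij with ⟨rfl, rfl⟩ | ⟨rfl, rfl⟩ | ⟨i, j, h1, rfl, rfl⟩
    · exact linkStep_cup_right _ _
    · exact linkStep_cup_left _ _
    · rw [linkStep_cup_shift, h.symm _ _ h1]; rfl
  · intro i j hij
    rcases key i j hij with ⟨rfl, rfl⟩ | ⟨rfl, rfl⟩ | ⟨i, j, h1, rfl, rfl⟩
    · omega
    · omega
    · exact fun he => h.ne _ _ h1 (shift_injective _ _ he)
  · intro i j hij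
    rcases key i j hij with ⟨rfl, rfl⟩ | ⟨rfl, rfl⟩ | ⟨i, j, h1, rfl, rfl⟩
    · exact ho
    · simp [ho]
    · rw [ht, ht, h.orient _ _ h1]
  · intro i j k r hij hkr h1 h2
    rcases key i j hij with ⟨rfl, rfl⟩ | ⟨rfl, rfl⟩ | ⟨i, j, e1, rfl, rfl⟩
    · omega
    · omega
    · rcases key k r hkr with ⟨rfl, rfl⟩ | ⟨rfl, rfl⟩ | ⟨k, r, e2, rfl, rfl⟩
      · have := shift_ne (l := k) (k := 2) (i := j) (j := k + 1) (by omega) (by omega)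
        omega
      · have := shift_ne (l := r) (k := 2) (i := i) (j := r) (by omega) (by omega)
        omega
      · rw [shift_lt_shift] at *
        rw [shift_lt_shift]
        exact h.planar _ _ _ _ e1 e2 h1 h2

theorem IsMatching.birth {N l : ℕ} {t t' : ℕ → Bool} {m : ℕ → Option ℕ} (h : IsMatching N t m)
    (hl : l ≤ N) (ht : ∀ i, t' (shift l 1 i) = t i) :
    IsMatching (N + 1) t' (linkStep l .birth m) := by
  have key : ∀ i j, linkStep l .birth m i = some j →
      ∃ i' j', m i' = some j' ∧ i = shift l 1 i' ∧ j = shift l 1 j' := by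
    intro i j hij
    rcases shift_cases l 1 i with ⟨i, rfl⟩ | h3
    · rw [linkStep_birth_shift] at hij
      obtain ⟨j', hj', rfl⟩ := Option.map_eq_some_iff.1 hij
      exact ⟨_, _, hj', rfl, rfl⟩
    · obtain rfl : i = l := by omega
      rw [linkStep_birth_self] at hij
      cases hij
  constructor
  · intro i j hij
    obtain ⟨i, j, h1, rfl, rfl⟩ := key i j hij
    exact (shift_lt_add hl).2 (h.lt _ _ h1)
  · intro i j hij
    obtain ⟨i, j, h1, rfl, rfl⟩ := key i j hij
    rw [linkStep_birth_shift, h.symm _ _ h1]; rfl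
  · intro i j hij
    obtain ⟨i, j, h1, rfl, rfl⟩ := key i j hij
    exact fun he => h.ne _ _ h1 (shift_injective _ _ he)
  · intro i j hij
    obtain ⟨i, j, h1, rfl, rfl⟩ := key i j hij
    rw [ht, ht, h.orient _ _ h1]
  · intro i j k r hij hkr h1 h2
    obtain ⟨i, j, e1, rfl, rfl⟩ := key i j hij
    obtain ⟨k, r, e2, rfl, rfl⟩ := key k r hkr
    rw [shift_lt_shift] at *
    rw [shift_lt_shift]
    exact h.planar _ _ _ _ e1 e2 h1 h2

theorem IsMatching.death {N l : ℕ} {t t' : ℕ → Bool} {m : ℕ → Option ℕ}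
    (h : IsMatching (N + 1) t m) (hl : l ≤ N) (ht : ∀ i, t (shift l 1 i) = t' i) :
    IsMatching N t' (linkStep l .death m) := by
  constructor
  · intro i j hij
    exact (shift_lt_add hl).1 (h.lt _ _ (linkStep_death_eq_some.1 hij))
  · intro i j hij
    exact linkStep_death_eq_some.2 (h.symm _ _ (linkStep_death_eq_some.1 hij))
  · rintro i j hij rfl
    exact h.ne _ _ (linkStep_death_eq_some.1 hij) rfl
  · intro i j hij
    rw [← ht, ← ht, h.orient _ _ (linkStep_death_eq_some.1 hij)]
  · intro i j k r hij hkr h1 h2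
    have := h.planar _ _ _ _ (linkStep_death_eq_some.1 hij) (linkStep_death_eq_some.1 hkr)
    simp only [shift_lt_shift] at this
    exact this h1 h2

/-- The merged arc is coherently oriented because the legs of the maximum have opposite
orientations. It crosses no other arc because the legs are adjacent, so no third arc can start
between them. -/
theorem IsMatching.cap {N l : ℕ} {t t' : ℕ → Bool} {m : ℕ → Option ℕ}
    (h : IsMatching (N + 2) t m) (hl : l ≤ N) (ht : ∀ i, t (shift l 2 i) = t' i)
    (ho : t (l + 1) = !t l) : IsMatching N t' (linkStep l .cap m) := by
  have n1 : ∀ i, shift l 2 i ≠ l := fun i => shift_ne le_rfl (by omega)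
  have n2 : ∀ i, shift l 2 i ≠ l + 1 := fun i => shift_ne (by omega) (by omega)
  constructor
  · intro i j hij
    rw [linkStep_cap_eq_some h] at hij
    refine (shift_lt_add (k := 2) hl).1 ?_
    rcases hij with h1 | ⟨h1, -⟩ | ⟨h1, -⟩ <;> exact h.lt _ _ h1
  · intro i j hij
    rw [linkStep_cap_eq_some h] at hij ⊢
    rcases hij with h1 | ⟨h1, h2⟩ | ⟨h1, h2⟩
    · exact .inl (h.symm _ _ h1)
    · exact .inr (.inr ⟨h.symm _ _ h2, h.symm _ _ h1⟩)
    · exact .inr (.inl ⟨h.symm _ _ h2, h.symm _ _ h1⟩)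
  · rintro i j hij rfl
    rw [linkStep_cap_eq_some h] at hij
    rcases hij with h1 | ⟨h1, h2⟩ | ⟨h1, h2⟩
    · exact h.ne _ _ h1 rfl
    · have := (h.symm _ _ h2).symm.trans h1
      simp at this
    · have := (h.symm _ _ h2).symm.trans h1
      simp at this
  · intro i j hij
    rw [linkStep_cap_eq_some h] at hij
    rw [← ht, ← ht]
    rcases hij with h1 | ⟨h1, h2⟩ | ⟨h1, h2⟩
    · exact h.orient _ _ h1
    · have e1 := h.orient _ _ h1
      have e2 := h.orient _ _ h2
      rw [e2, ho, e1]; simp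
    · have e1 := h.orient _ _ h1
      have e2 := h.orient _ _ h2
      rw [e2, ← e1, ho]
  · intro i j k r hij hkr hik hkj
    rw [linkStep_cap_eq_some h] at hij hkr
    rw [← shift_lt_shift (l := l) (k := 2)] at hik hkj
    rw [← shift_lt_shift (l := l) (k := 2), ← shift_lt_shift (l := l) (k := 2) (i := r)]
    have a1 := n1 i
    have a2 := n2 i
    have b1 := n1 j
    have b2 := n2 j
    have c1 := n1 k
    have c2 := n2 k
    have d1 := n1 r
    have d2 := n2 r
    generalize shift l 2 i = I at *
    generalize shift l 2 j = J at *
    generalize shift l 2 k = K' at *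
    generalize shift l 2 r = R' at *
    have pl := h.planar
    have sy := h.symm
    rcases hij with h1 | ⟨h1, h2⟩ | ⟨h1, h2⟩ <;> rcases hkr with h3 | ⟨h3, h4⟩ | ⟨h3, h4⟩
    · exact pl _ _ _ _ h1 h3 hik hkj
    · have := pl _ _ _ _ h1 h3 hik hkj
      have := pl _ _ _ _ h1 h4
      omega
    · have := pl _ _ _ _ h1 h3 hik hkj
      have := pl _ _ _ _ h1 h4
      omega
    -- A merged arc is compared with an untouched one. The latter crosses neither of the two arcs
    -- that were merged, and these instances of planarity exclude every position in which it would
    -- separate the endpoints of the merged arc.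
    · have := pl _ _ _ _ h1 h3
      have := pl _ _ _ _ h2 h3
      have := pl _ _ _ _ (sy _ _ h1) (sy _ _ h3)
      have := pl _ _ _ _ (sy _ _ h1) h3
      have := pl _ _ _ _ (sy _ _ h2) h3
      have := pl _ _ _ _ h3 (sy _ _ h1)
      have := pl _ _ _ _ h3 h1
      have := pl _ _ _ _ h3 h2
      have := pl _ _ _ _ h3 (sy _ _ h2)
      have := pl _ _ _ _ (sy _ _ h3) (sy _ _ h1)
      have := pl _ _ _ _ (sy _ _ h3) h1
      have := pl _ _ _ _ (sy _ _ h3) h2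
      have := pl _ _ _ _ (sy _ _ h3) (sy _ _ h2)
      have := h.ne _ _ h3
      have : R' ≠ I := by rintro rfl; have := sy _ _ h3; rw [h1] at this; simp at this; omega
      have : R' ≠ J := by
        rintro rfl; have := sy _ _ h3; rw [sy _ _ h2] at this; simp at this; omega
      omega
    · have := (sy _ _ h1).symm.trans (sy _ _ h3); simp at this; omega
    · have := h2.symm.trans (sy _ _ h3); simp at this; omega
    · have := pl _ _ _ _ h1 h3
      have := pl _ _ _ _ h2 h3
      have := pl _ _ _ _ (sy _ _ h1) (sy _ _ h3)
      have := pl _ _ _ _ (sy _ _ h1) h3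
      have := pl _ _ _ _ (sy _ _ h2) h3
      have := pl _ _ _ _ h3 (sy _ _ h1)
      have := pl _ _ _ _ h3 h1
      have := pl _ _ _ _ h3 h2
      have := pl _ _ _ _ h3 (sy _ _ h2)
      have := pl _ _ _ _ (sy _ _ h3) (sy _ _ h1)
      have := pl _ _ _ _ (sy _ _ h3) h1
      have := pl _ _ _ _ (sy _ _ h3) h2
      have := pl _ _ _ _ (sy _ _ h3) (sy _ _ h2)
      have := h.ne _ _ h3
      have : R' ≠ I := by rintro rfl; have := sy _ _ h3; rw [h1] at this; simp at this; omega
      have : R' ≠ J := by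
        rintro rfl; have := sy _ _ h3; rw [sy _ _ h2] at this; simp at this; omega
      omega
    · have := h2.symm.trans (sy _ _ h3); simp at this; omega
    · have := (sy _ _ h1).symm.trans (sy _ _ h3); simp at this; omega

/-! ### Evaluation of planar matchings -/

section Evaluation

variable {γ : Type*} {K : Type*} [CommRing K]

/-- The first `l` entries of `c`, followed by `d`. -/
def glue (l : ℕ) (c d : ℕ → γ) (i : ℕ) : γ := if i < l then c i else d (i - l)

theorem liftN_apply (l : ℕ) (F : Module.End K ((ℕ → γ) → K)) (v : (ℕ → γ) → K) (c : ℕ → γ) :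
    liftN l F v c = F (fun d => v (glue l c d)) (fun i => c (i + l)) := by
  induction l generalizing v c with
  | zero =>
    have h : ∀ d, glue 0 c d = d := fun d => by funext i; simp [glue]
    simp [h]
  | succ l ih =>
    rw [liftN_succ]
    obtain ⟨x, c, rfl⟩ := exists_scons c
    rw [lift_apply, ih]
    have h : ∀ d, scons x (glue l c d) = glue (l + 1) (scons x c) d := by
      intro d
      funext i
      cases i with
      | zero => simp [glue]
      | succ i => simp [glue]
    simp only [h]
    rfl

theorem glue_shift_one (l : ℕ) (x : γ) (c : ℕ → γ) (i : ℕ) :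
    glue l c (scons x fun i => c (i + l)) (shift l 1 i) = c i := by
  by_cases h : i < l
  · simp [glue, shift, h]
  · rw [shift, if_neg h, glue, if_neg (by omega), show i + 1 - l = (i - l) + 1 by omega, scons_succ]
    congr 1; omega

theorem glue_self (l : ℕ) (x : γ) (c d : ℕ → γ) : glue l c (scons x d) l = x := by
  simp [glue]

theorem glue_succ (l : ℕ) (x y : γ) (c d : ℕ → γ) : glue l c (scons x (scons y d)) (l + 1) = y := by
  simp [glue]

theorem glue_shift_two (l : ℕ) (x y : γ) (c : ℕ → γ) (i : ℕ) :
    glue l c (scons x (scons y fun i => c (i + l))) (shift l 2 i) = c i := by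
  by_cases h : i < l
  · simp [glue, shift, h]
  · rw [shift, if_neg h, glue, if_neg (by omega), show i + 2 - l = (i - l) + 1 + 1 by omega,
      scons_succ, scons_succ]
    congr 1; omega

theorem glue_tail (l k : ℕ) (c : ℕ → γ) :
    glue l c (fun i => c (i + k + l)) = fun i => c (shift l k i) := by
  funext i
  by_cases h : i < l
  · simp [glue, shift, h]
  · rw [shift, if_neg h, glue, if_neg h]
    congr 1; omega

theorem prod_range_shift_one {l N : ℕ} (hl : l ≤ N) (f : ℕ → K) :
    ∏ i ∈ Finset.range (N + 1), f i = f l * ∏ i ∈ Finset.range N, f (shift l 1 i) := by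
  obtain ⟨r, rfl⟩ := Nat.exists_eq_add_of_le hl
  rw [show l + r + 1 = l + (1 + r) by omega, Finset.prod_range_add, Finset.prod_range_add,
    Finset.prod_range_add]
  have h1 : ∏ i ∈ Finset.range l, f (shift l 1 i) = ∏ i ∈ Finset.range l, f i :=
    Finset.prod_congr rfl fun i hi => by simp [shift, Finset.mem_range.1 hi]
  have h2 : ∏ i ∈ Finset.range r, f (shift l 1 (l + i)) = ∏ i ∈ Finset.range r, f (l + (1 + i)) :=
    Finset.prod_congr rfl fun i _ => by
      simp only [shift, show ¬ l + i < l by omega, if_false]; congr 1; omega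
  rw [h1, h2]
  simp only [Finset.prod_range_one, add_zero]
  ring

theorem prod_range_shift_two {l N : ℕ} (hl : l ≤ N) (f : ℕ → K) :
    ∏ i ∈ Finset.range (N + 2), f i =
      f l * f (l + 1) * ∏ i ∈ Finset.range N, f (shift l 2 i) := by
  rw [prod_range_shift_one (l := l) (N := N + 1) (by omega), prod_range_shift_one hl]
  have h1 : shift l 1 l = l + 1 := by simp [shift]
  have h2 : ∀ i, shift l 1 (shift l 1 i) = shift l 2 i := by
    intro i; unfold shift; split_ifs <;> omega
  simp only [h1, h2, mul_assoc]

variable [DecidableEq γ]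

/-- The weight of an arc whose left leg has orientation `o` and whose legs have colours `x`, `y`. -/
def arcWeight (u : γ → K) (o : Bool) (x y : γ) : K := if x = y then (if o then u x else 1) else 0

/-- The weight of a point: that of the arc that it is the left endpoint of, or that of a strand that
ends in the interior. -/
def pointWeight (u ω : γ → K) (t : ℕ → Bool) (m : ℕ → Option ℕ) (c : ℕ → γ) (i : ℕ) : K :=
  match m i with
  | none => ω (c i)
  | some j => if i < j then arcWeight u (t i) (c i) (c j) else 1

/-- The value of a planar matching of `N` points. -/
def matchingValue (u ω : γ → K) (N : ℕ) (t : ℕ → Bool) (m : ℕ → Option ℕ) (c : ℕ → γ) : K :=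
  ∏ i ∈ Finset.range N, pointWeight u ω t m c i

variable {u u' ω : γ → K} {t t' : ℕ → Bool} {m : ℕ → Option ℕ} {N l : ℕ}

theorem pointWeight_none {c : ℕ → γ} {i : ℕ} (h : m i = none) :
    pointWeight u ω t m c i = ω (c i) := by simp [pointWeight, h]

theorem pointWeight_some {c : ℕ → γ} {i j : ℕ} (h : m i = some j) :
    pointWeight u ω t m c i = if i < j then arcWeight u (t i) (c i) (c j) else 1 := by
  simp [pointWeight, h]

theorem arcWeight_comm (u : γ → K) (o : Bool) (x y : γ) : arcWeight u o x y = arcWeight u o y x := by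
  unfold arcWeight
  by_cases h : x = y
  · subst h; rfl
  · rw [if_neg h, if_neg (Ne.symm h)]

/-- The weight of an arc is stored at its left endpoint; taking both endpoints together makes it
independent of which one is named first. -/
theorem pointWeight_mul (h : IsMatching N t m) {c : ℕ → γ} {i j : ℕ} (hij : m i = some j) :
    pointWeight u ω t m c i * pointWeight u ω t m c j =
      arcWeight u (t (min i j)) (c i) (c j) := by
  rw [pointWeight_some hij, pointWeight_some (h.symm _ _ hij)]
  have := h.ne _ _ hij
  rcases lt_or_ge i j with h1 | h1
  · rw [if_pos h1, if_neg (by omega), min_eq_left h1.le, mul_one]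
  · rw [if_neg (by omega), if_pos (by omega), min_eq_right h1, one_mul, arcWeight_comm]

theorem cup_matchingValue (hl : l ≤ N) (ht : ∀ i, t' (shift l 2 i) = t i) :
    liftN l (cupOp fun x => if t' l then u x else 1) (matchingValue u ω N t m) =
      matchingValue u ω (N + 2) t' (linkStep l .cup m) := by
  funext c
  have h1 : ∀ i, pointWeight u ω t' (linkStep l .cup m) c (shift l 2 i) =
      pointWeight u ω t m (fun i => c (shift l 2 i)) i := by
    intro i
    cases h : m i with
    | none => rw [pointWeight_none h, pointWeight_none (by simp [linkStep_cup_shift, h])]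
    | some j =>
      rw [pointWeight_some h, pointWeight_some (j := shift l 2 j) (by simp [linkStep_cup_shift, h])]
      simp only [shift_lt_shift, ht]
  rw [matchingValue, prod_range_shift_two hl, pointWeight_some (linkStep_cup_left l m),
    pointWeight_some (linkStep_cup_right l m)]
  simp only [h1, liftN_apply]
  change (if c (0 + l) = c (1 + l) then (if t' l then u (c (0 + l)) else 1) *
    matchingValue u ω N t m (glue l c fun i => c (i + 2 + l)) else 0) = _
  rw [glue_tail]
  simp only [matchingValue, zero_add, add_comm 1 l, arcWeight, lt_add_one, if_pos,
    if_neg (show ¬ l + 1 < l by omega), mul_one, ite_mul, zero_mul]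

theorem birth_matchingValue (hl : l ≤ N) (ht : ∀ i, t' (shift l 1 i) = t i) :
    liftN l (birthOp ω) (matchingValue u ω N t m) =
      matchingValue u ω (N + 1) t' (linkStep l .birth m) := by
  funext c
  have h1 : ∀ i, pointWeight u ω t' (linkStep l .birth m) c (shift l 1 i) =
      pointWeight u ω t m (fun i => c (shift l 1 i)) i := by
    intro i
    cases h : m i with
    | none => rw [pointWeight_none h, pointWeight_none (by simp [linkStep_birth_shift, h])]
    | some j =>
      rw [pointWeight_some h, pointWeight_some (j := shift l 1 j) (by simp [linkStep_birth_shift, h])]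
      simp only [shift_lt_shift, ht]
  rw [matchingValue, prod_range_shift_one hl, pointWeight_none (linkStep_birth_self l m)]
  simp only [h1, liftN_apply]
  change ω (c (0 + l)) * matchingValue u ω N t m (glue l c fun i => c (i + 1 + l)) = _
  rw [glue_tail]
  simp only [matchingValue, zero_add]

variable [Fintype γ]

/-- The factor that appears when a piece is put on top of a planar matching. -/
def stepFactor (u u' ω : γ → K) (m : ℕ → Option ℕ) (l : ℕ) (o : Bool) : FlatPiece → K
  | .cup => 1
  | .birth => 1
  | .death => if m l = none then ∑ x, ω x * ω x else 1
  | .cap => if m l = some (l + 1) then ∑ x, (if o then u x else u' x) else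
      if m l = none ∧ m (l + 1) = none then ∑ x, ω x * ω x else 1

/-- `u` acts as 1 wherever `ω` lives, so an arc continued to an interior end is just an end,
whatever its orientation. -/
theorem sum_mul_arcWeight (hω : ∀ x, ω x * u x = ω x) (o : Bool) (y : γ) :
    ∑ x, ω x * arcWeight u o x y = ω y := by
  simp only [arcWeight, mul_ite, mul_zero, Finset.sum_ite_eq', Finset.mem_univ, if_true]
  cases o <;> simp [hω]

/-- If the strand already has an interior end, a component is completed and contributes the sum of
`ω x * ω x`. Otherwise the other endpoint of its arc becomes the endpoint of a strand that ends in
the interior. -/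
theorem death_matchingValue (hω : ∀ x, ω x * u x = ω x) (h : IsMatching (N + 1) t m) (hl : l ≤ N)
    (ht : ∀ i, t (shift l 1 i) = t' i) (o : Bool) :
    liftN l (deathOp ω) (matchingValue u ω (N + 1) t m) =
      stepFactor u u' ω m l o .death • matchingValue u ω N t' (linkStep l .death m) := by
  funext c
  rw [liftN_apply, deathOp_apply, Pi.smul_apply, smul_eq_mul]
  have hsome : ∀ i j, linkStep l .death m i = some j ↔ m (shift l 1 i) = some (shift l 1 j) :=
    fun i j => linkStep_death_eq_some
  have key : ∀ i x, m (shift l 1 i) ≠ some l →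
      pointWeight u ω t m (glue l c (scons x fun i => c (i + l))) (shift l 1 i) =
        pointWeight u ω t' (linkStep l .death m) c i := by
    intro i x hi
    cases hm : linkStep l .death m i with
    | some j =>
      rw [pointWeight_some hm, pointWeight_some ((hsome i j).1 hm)]
      simp only [shift_lt_shift, ht, glue_shift_one]
    | none =>
      rw [pointWeight_none hm, pointWeight_none, glue_shift_one]
      cases h2 : m (shift l 1 i) with
      | none => rfl
      | some r =>
        rcases shift_cases l 1 r with ⟨r, rfl⟩ | h3
        · rw [(hsome i r).2 h2] at hm; cases hm
        · obtain rfl : r = l := by omega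
          exact absurd h2 hi
  simp only [matchingValue, prod_range_shift_one hl]
  cases hm : m l with
  | none =>
    have h1 : ∀ i, m (shift l 1 i) ≠ some l := by
      intro i hi
      rw [h.symm _ _ hi] at hm; cases hm
    rw [stepFactor, if_pos hm, Finset.sum_mul]
    refine Finset.sum_congr rfl fun x _ => ?_
    rw [pointWeight_none hm, glue_self, mul_assoc, Finset.prod_congr rfl fun i _ => key i x (h1 i)]
  | some j =>
    obtain ⟨j, rfl⟩ : ∃ j', j = shift l 1 j' := by
      rcases shift_cases l 1 j with h1 | h1
      · exact h1
      · exact absurd (show l = j by omega) (h.ne _ _ hm)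
    have hj : j < N := (shift_lt_add hl).1 (h.lt' hm)
    have hj' : linkStep l .death m j = none := by
      rw [Option.eq_none_iff_forall_ne_some]
      intro r hr
      rw [hsome, h.symm _ _ hm] at hr
      exact shift_ne le_rfl (by omega) (Option.some.inj hr).symm
    have h2 : ∀ i ∈ (Finset.range N).erase j, m (shift l 1 i) ≠ some l := by
      intro i hi hm'
      rw [h.symm _ _ hm'] at hm
      exact (Finset.mem_erase.1 hi).1 (shift_injective _ _ (Option.some.inj hm))
    rw [← Finset.mul_prod_erase _ _ (Finset.mem_range.2 hj), pointWeight_none hj']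
    have h3 : ∀ x, ∏ i ∈ Finset.range N,
        pointWeight u ω t m (glue l c (scons x fun i => c (i + l))) (shift l 1 i) =
        pointWeight u ω t m (glue l c (scons x fun i => c (i + l))) (shift l 1 j) *
          ∏ i ∈ (Finset.range N).erase j, pointWeight u ω t' (linkStep l .death m) c i := by
      intro x
      rw [← Finset.mul_prod_erase _ _ (Finset.mem_range.2 hj)]
      congr 1
      exact Finset.prod_congr rfl fun i hi => key i x (h2 i hi)
    rw [stepFactor, if_neg (by simp [hm]), one_mul,
      ← sum_mul_arcWeight hω (t (min l (shift l 1 j))) (c j), Finset.sum_mul]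
    refine Finset.sum_congr rfl fun x _ => ?_
    rw [h3, ← mul_assoc (pointWeight _ _ _ _ _ _), pointWeight_mul h hm, glue_self, glue_shift_one,
      mul_assoc]

/-- The hypothesis balances exponents of `u`: one for every arc with upward left leg, and minus one
for a maximum with downward left leg. -/
theorem sum_mul_arcWeight_mul_arcWeight (hu : ∀ x, u x * u' x = 1) {o a b e : Bool}
    (h : a.toNat + b.toNat = e.toNat + (!o).toNat) (y z : γ) :
    ∑ x, (if o then 1 else u' x) * (arcWeight u a x y * arcWeight u b x z) = arcWeight u e y z := by
  have hu' : ∀ x, u' x * u x = 1 := fun x => by rw [mul_comm, hu]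
  have hu'' : ∀ x, u' x * (u x * u x) = u x := fun x => by rw [← mul_assoc, hu', one_mul]
  simp only [arcWeight, ite_mul, zero_mul, mul_ite, mul_zero, Finset.sum_ite_eq', Finset.mem_univ,
    if_true]
  by_cases hy : y = z
  · subst hy
    cases o <;> cases a <;> cases b <;> cases e <;> simp_all
  · simp [hy, Ne.symm hy]

/-- A maximum closes a loop, completes a strand with two interior ends, prolongs such a strand from
one end, or merges two arcs. Only the first two complete a component and produce a factor. -/
theorem cap_matchingValue (hu : ∀ x, u x * u' x = 1) (hω : ∀ x, ω x * u x = ω x)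
    (h : IsMatching (N + 2) t m) (hl : l ≤ N) (ht : ∀ i, t (shift l 2 i) = t' i)
    (ho : t (l + 1) = !t l) :
    liftN l (capOp fun x => if t l then 1 else u' x) (matchingValue u ω (N + 2) t m) =
      stepFactor u u' ω m l (t l) .cap • matchingValue u ω N t' (linkStep l .cap m) := by
  funext c
  rw [liftN_apply, capOp_apply, Pi.smul_apply, smul_eq_mul]
  have hω' : ∀ x, ω x * u' x = ω x := fun x => by
    rw [← hω, mul_assoc, hu, mul_one, hω]
  have hω'' : ∀ x, (if t l then 1 else u' x) * ω x = ω x := fun x => by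
    split_ifs
    · exact one_mul _
    · rw [mul_comm, hω']
  have n1 : ∀ i, shift l 2 i ≠ l := fun i => shift_ne le_rfl (by omega)
  have n2 : ∀ i, shift l 2 i ≠ l + 1 := fun i => shift_ne (by omega) (by omega)
  have hsome : ∀ i j, linkStep l .cap m i = some j ↔ _ := fun i j => linkStep_cap_eq_some h
  have key : ∀ i x, m (shift l 2 i) ≠ some l → m (shift l 2 i) ≠ some (l + 1) →
      pointWeight u ω t m (glue l c (scons x (scons x fun i => c (i + l)))) (shift l 2 i) =
        pointWeight u ω t' (linkStep l .cap m) c i := by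
    intro i x hi hi'
    cases hm : m (shift l 2 i) with
    | none =>
      rw [pointWeight_none hm, pointWeight_none, glue_shift_two]
      simp [linkStep, hm]
    | some r =>
      rcases shift_cases l 2 r with ⟨r, rfl⟩ | h3
      · rw [pointWeight_some hm, pointWeight_some ((hsome i r).2 (.inl hm))]
        simp only [shift_lt_shift, ht, glue_shift_two]
      · obtain rfl | rfl : r = l ∨ r = l + 1 := by omega
        · exact absurd hm hi
        · exact absurd hm hi'
  have back : ∀ {i r j}, m r = some (shift l 2 j) → m (shift l 2 i) = some r → i = j :=
    fun h1 h2 => shift_injective _ _ (Option.some.inj ((h.symm _ _ h2).symm.trans h1))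
  have none_of : ∀ {r}, m r = none → ∀ i, m i ≠ some r := by
    intro r hr i hi
    rw [h.symm _ _ hi] at hr; cases hr
  have cases_of : ∀ {r j}, (r = l ∨ r = l + 1) → m r = some j →
      j = l ∨ j = l + 1 ∨ ∃ j', j = shift l 2 j' ∧ j' < N := by
    intro r j _ hm
    rcases shift_cases l 2 j with ⟨j, rfl⟩ | h1
    · exact .inr (.inr ⟨j, rfl, (shift_lt_add hl).1 (h.lt' hm)⟩)
    · omega
  -- a strand that ends in the interior is prolonged by the maximum
  have single : ∀ {r r' j}, (r = l ∧ r' = l + 1 ∨ r = l + 1 ∧ r' = l) → m r = none →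
      m r' = some (shift l 2 j) → j < N → ∀ F : γ → K,
      (∀ x, F x = ω x * (pointWeight u ω t m
          (glue l c (scons x (scons x fun i => c (i + l)))) r' *
        ∏ i ∈ Finset.range N, pointWeight u ω t m
          (glue l c (scons x (scons x fun i => c (i + l)))) (shift l 2 i))) →
      ∑ x, F x = matchingValue u ω N t' (linkStep l .cap m) c := by
    intro r r' j hr hm hm' hj F hF
    have hj' : linkStep l .cap m j = none := by
      rw [Option.eq_none_iff_forall_ne_some]
      intro k hk
      rw [hsome, h.symm _ _ hm'] at hk
      have := n1 k
      have := n2 k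
      rcases hr with ⟨rfl, rfl⟩ | ⟨rfl, rfl⟩ <;> simp [Ne.symm, *] at hk
    have h2 : ∀ x, ∀ i ∈ (Finset.range N).erase j,
        pointWeight u ω t m (glue l c (scons x (scons x fun i => c (i + l)))) (shift l 2 i) =
        pointWeight u ω t' (linkStep l .cap m) c i := by
      intro x i hi
      have e1 : m (shift l 2 i) ≠ some r := none_of hm _
      have e2 : m (shift l 2 i) ≠ some r' := fun e => (Finset.mem_erase.1 hi).1 (back hm' e)
      rcases hr with ⟨rfl, rfl⟩ | ⟨rfl, rfl⟩
      · exact key i x e1 e2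
      · exact key i x e2 e1
    rw [matchingValue, ← Finset.mul_prod_erase _ _ (Finset.mem_range.2 hj), pointWeight_none hj',
      ← sum_mul_arcWeight hω (t (min r' (shift l 2 j))) (c j), Finset.sum_mul]
    refine Finset.sum_congr rfl fun x _ => ?_
    rw [hF, ← Finset.mul_prod_erase _ _ (Finset.mem_range.2 hj), Finset.prod_congr rfl (h2 x),
      ← mul_assoc (pointWeight _ _ _ _ _ _), pointWeight_mul h hm', glue_shift_two, mul_assoc]
    congr 3
    rcases hr with ⟨rfl, rfl⟩ | ⟨rfl, rfl⟩
    · exact glue_succ _ _ _ _ _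
    · exact glue_self _ _ _ _
  simp only [matchingValue, prod_range_shift_two hl]
  cases hm : m l with
  | none =>
    cases hm' : m (l + 1) with
    | none =>
      rw [stepFactor, if_neg (by simp [hm]), if_pos ⟨hm, hm'⟩, Finset.sum_mul]
      refine Finset.sum_congr rfl fun x _ => ?_
      rw [pointWeight_none hm, pointWeight_none hm', glue_self, glue_succ,
        Finset.prod_congr rfl fun i _ => key i x (none_of hm _) (none_of hm' _), ← mul_assoc,
        ← mul_assoc, hω'']
    | some j =>
      rw [stepFactor, if_neg (by simp [hm]), if_neg (by simp [hm']), one_mul]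
      rcases cases_of (.inr rfl) hm' with rfl | rfl | ⟨j, rfl, hj⟩
      · exact absurd (h.symm _ _ hm') (by simp [hm])
      · exact absurd rfl (h.ne _ _ hm')
      · refine single (.inl ⟨rfl, rfl⟩) hm hm' hj _ fun x => ?_
        rw [pointWeight_none hm, glue_self, mul_assoc, ← mul_assoc, hω'']
  | some i =>
    rcases cases_of (.inl rfl) hm with rfl | rfl | ⟨i, rfl, hi⟩
    · exact absurd rfl (h.ne _ _ hm)
    · rw [stepFactor, if_pos hm, Finset.sum_mul]
      refine Finset.sum_congr rfl fun x _ => ?_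
      have hm' := h.symm _ _ hm
      have e1 : ∀ i, m (shift l 2 i) ≠ some l := fun i e =>
        n2 i (Option.some.inj ((h.symm _ _ e).symm.trans hm))
      have e2 : ∀ i, m (shift l 2 i) ≠ some (l + 1) := fun i e =>
        n1 i (Option.some.inj ((h.symm _ _ e).symm.trans hm'))
      rw [pointWeight_mul h hm, min_eq_left (by omega), glue_self,
        glue_succ, Finset.prod_congr rfl fun i _ => key i x (e1 i) (e2 i), ← mul_assoc, arcWeight,
        if_pos rfl]
      congr 1
      cases t l <;> simp
    · cases hm' : m (l + 1) with
      | none =>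
        rw [stepFactor, if_neg (by simp [hm, n2 i]), if_neg (by simp [hm]), one_mul]
        refine single (.inr ⟨rfl, rfl⟩) hm' hm hi _ fun x => ?_
        rw [pointWeight_none hm', glue_succ, mul_comm (pointWeight _ _ _ _ _ l), mul_assoc,
          ← mul_assoc, hω'']
      | some j =>
        rw [stepFactor, if_neg (by simp [hm, n2 i]), if_neg (by simp [hm]), one_mul]
        rcases cases_of (.inr rfl) hm' with rfl | rfl | ⟨j, rfl, hj⟩
        · have := (h.symm _ _ hm').symm.trans hm
          exact absurd (Option.some.inj this).symm (n2 i)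
        · exact absurd rfl (h.ne _ _ hm')
        · have hij : linkStep l .cap m i = some j := (hsome i j).2 (.inr (.inl ⟨h.symm _ _ hm, hm'⟩))
          have hne : j ≠ i := by
            rintro rfl
            have := (h.symm _ _ hm).symm.trans (h.symm _ _ hm')
            simp at this
          have hj1 : j ∈ (Finset.range N).erase i := by simp [hne, hj]
          -- By planarity the partners of the legs are both to the left, one on each side, or both
          -- to the right, with determined nesting. In each case the exponents balance.
          have horient : (t (min l (shift l 2 i))).toNat + (t (min (l + 1) (shift l 2 j))).toNat =
              (t' (min i j)).toNat + (!t l).toNat := by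
            have p1 := h.planar _ _ _ _ (h.symm _ _ hm) (h.symm _ _ hm')
            have p2 := h.planar _ _ _ _ hm hm'
            have p3 := h.planar _ _ _ _ (h.symm _ _ hm') (h.symm _ _ hm)
            have o1 := h.orient _ _ hm
            have o2 := h.orient _ _ hm'
            have a1 := n1 i
            have a2 := n2 i
            have b1 := n1 j
            have b2 := n2 j
            have hmin : shift l 2 (min i j) = min (shift l 2 i) (shift l 2 j) := by
              have := @shift_lt_shift l 2 i j
              rcases lt_or_ge i j with h1 | h1
              · rw [min_eq_left h1.le, min_eq_left (this.2 h1).le]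
              · rw [min_eq_right h1, min_eq_right]
                rw [← not_lt, this]; omega
            rw [← ht, hmin]
            have hIJ : shift l 2 i ≠ shift l 2 j := fun e => hne (shift_injective _ _ e.symm)
            generalize shift l 2 i = I at *
            generalize shift l 2 j = J at *
            have : (I < l ∧ J < I) ∨ (I < l ∧ l + 1 < J) ∨ (l + 1 < J ∧ J < I) := by
              omega
            rcases this with ⟨h1, h2⟩ | ⟨h1, h2⟩ | ⟨h1, h2⟩
            · rw [min_eq_right h1.le, min_eq_right (by omega), min_eq_right (by omega), o1, o2, ho]
              cases t l <;> rfl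
            · rw [min_eq_right h1.le, min_eq_left (by omega), min_eq_left (by omega), o1, ho]
            · rw [min_eq_left (by omega), min_eq_left (by omega), min_eq_right (by omega), o2, ho]
              cases t l <;> rfl
          have h2 : ∀ x, ∀ k ∈ ((Finset.range N).erase i).erase j,
              pointWeight u ω t m (glue l c (scons x (scons x fun i => c (i + l)))) (shift l 2 k) =
              pointWeight u ω t' (linkStep l .cap m) c k := by
            intro x k hk
            simp only [Finset.mem_erase] at hk
            exact key k x (fun e => hk.2.1 (back hm e)) (fun e => hk.1 (back hm' e))
          rw [← Finset.mul_prod_erase _ _ (Finset.mem_range.2 hi),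
            ← Finset.mul_prod_erase _ _ hj1, ← mul_assoc,
            pointWeight_mul (h.cap hl ht ho) hij,
            ← sum_mul_arcWeight_mul_arcWeight hu horient, Finset.sum_mul]
          refine Finset.sum_congr rfl fun x _ => ?_
          have q1 := pointWeight_mul (u := u) (ω := ω) h
            (c := glue l c (scons x (scons x fun i => c (i + l)))) hm
          have q2 := pointWeight_mul (u := u) (ω := ω) h
            (c := glue l c (scons x (scons x fun i => c (i + l)))) hm'
          rw [glue_self, glue_shift_two] at q1
          rw [glue_succ, glue_shift_two] at q2
          rw [← Finset.mul_prod_erase _ _ (Finset.mem_range.2 hi),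
            ← Finset.mul_prod_erase _ _ hj1, Finset.prod_congr rfl (h2 x), ← q1, ← q2]
          ring

end Evaluation

/-! ### Oriented crossingless diagrams -/

/-- The number of strands at the bottom of a piece. -/
def FlatPiece.bot : FlatPiece → ℕ
  | .cup => 0
  | .cap => 2
  | .birth => 0
  | .death => 1

/-- The number of strands at the top of a piece. -/
def FlatPiece.top (p : FlatPiece) : ℕ := p.flip.bot

/-- A slice of a crossingless diagram with orientations; `o` is the orientation of the left leg of
the piece. -/
structure OrientedSlice where
  left : List Bool
  piece : FlatPiece
  o : Bool
  right : List Bool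

namespace OrientedSlice

def pieceSrc (x : OrientedSlice) : List Bool :=
  match x.piece with
  | .cup => []
  | .cap => [x.o, !x.o]
  | .birth => []
  | .death => [x.o]

def pieceTgt (x : OrientedSlice) : List Bool :=
  match x.piece with
  | .cup => [x.o, !x.o]
  | .cap => []
  | .birth => [x.o]
  | .death => []

def src (x : OrientedSlice) : List Bool := x.left ++ x.pieceSrc ++ x.right

def tgt (x : OrientedSlice) : List Bool := x.left ++ x.pieceTgt ++ x.right

/-- Forget the orientations. -/
def flat (x : OrientedSlice) : FlatSlice := ⟨x.left.length, x.piece, x.right.length⟩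

theorem length_pieceSrc (x : OrientedSlice) : x.pieceSrc.length = x.piece.bot := by
  obtain ⟨l, p, o, r⟩ := x
  cases p <;> rfl

theorem length_pieceTgt (x : OrientedSlice) : x.pieceTgt.length = x.piece.top := by
  obtain ⟨l, p, o, r⟩ := x
  cases p <;> rfl

theorem length_src (x : OrientedSlice) :
    x.src.length = x.left.length + x.right.length + x.piece.bot := by
  simp only [src, List.length_append, length_pieceSrc]; omega

theorem length_tgt (x : OrientedSlice) :
    x.tgt.length = x.left.length + x.right.length + x.piece.top := by
  simp only [tgt, List.length_append, length_pieceTgt]; omega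

end OrientedSlice

/-- The slices of `D` fit together to a diagram with bottom boundary `s` and top boundary `t`. -/
def IsOrientedPath : List Bool → List OrientedSlice → List Bool → Prop
  | s, [], t => s = t
  | s, x :: D, t => x.src = s ∧ IsOrientedPath x.tgt D t

theorem isOrientedPath_append {s t : List Bool} {D D' : List OrientedSlice} :
    IsOrientedPath s (D ++ D') t ↔ ∃ m, IsOrientedPath s D m ∧ IsOrientedPath m D' t := by
  induction D generalizing s with
  | nil => simp [IsOrientedPath]
  | cons x D ih => simp [IsOrientedPath, ih, and_assoc]

/-- The orientations of the strands at a line, followed by that of an additional strand. -/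
def orientAt (a : Bool) (s : List Bool) (i : ℕ) : Bool := (s ++ [!a]).getD i false

theorem getD_shift (l m r : List Bool) (i : ℕ) :
    (l ++ m ++ r).getD (shift l.length m.length i) false = (l ++ r).getD i false := by
  by_cases h : i < l.length
  · rw [shift, if_pos h, List.append_assoc, List.getD_append _ _ _ _ h, List.getD_append _ _ _ _ h]
  · rw [shift, if_neg h, List.getD_append_right _ _ _ _ (by simp; omega),
      List.getD_append_right _ _ _ _ (by omega)]
    congr 1
    simp; omega

theorem orientAt_shift (a : Bool) (l m r : List Bool) (i : ℕ) :
    orientAt a (l ++ m ++ r) (shift l.length m.length i) = orientAt a (l ++ r) i := by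
  simpa [orientAt] using getD_shift l m (r ++ [!a]) i

theorem orientAt_length (a : Bool) (l m r : List Bool) (o : Bool) :
    orientAt a (l ++ o :: m ++ r) l.length = o := by
  simp [orientAt]

theorem orientAt_length_succ (a : Bool) (l m r : List Bool) (o o' : Bool) :
    orientAt a (l ++ o :: o' :: m ++ r) (l.length + 1) = o' := by
  simp [orientAt]

/-- How the points on the upper line of a diagram are joined, if the points on its lower line are
joined according to `m`. -/
def linkFrom (m : ℕ → Option ℕ) (D : List FlatSlice) : ℕ → Option ℕ :=
  D.foldl (fun m s => linkStep s.left s.piece m) m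

theorem linkFrom_append (m : ℕ → Option ℕ) (D D' : List FlatSlice) :
    linkFrom m (D ++ D') = linkFrom (linkFrom m D) D' := List.foldl_append

theorem linkFrom_concat (m : ℕ → Option ℕ) (D : List FlatSlice) (s : FlatSlice) :
    linkFrom m (D ++ [s]) = linkStep s.left s.piece (linkFrom m D) := by
  rw [linkFrom_append]; rfl

theorem IsMatching.step {a : Bool} {m : ℕ → Option ℕ} {x : OrientedSlice}
    (h : IsMatching (x.src.length + 1) (orientAt a x.src) m) :
    IsMatching (x.tgt.length + 1) (orientAt a x.tgt) (linkStep x.left.length x.piece m) := by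
  rw [OrientedSlice.length_src] at h
  rw [OrientedSlice.length_tgt]
  have hs := orientAt_shift a x.left x.pieceSrc x.right
  have ht := orientAt_shift a x.left x.pieceTgt x.right
  rw [OrientedSlice.length_pieceSrc] at hs
  rw [OrientedSlice.length_pieceTgt] at ht
  obtain ⟨l, p, o, r⟩ := x
  cases p with
  | cup =>
    exact IsMatching.cup h (by simp; omega)
      (fun i => (ht i).trans (by simp [OrientedSlice.src, OrientedSlice.pieceSrc]))
      (by
        change orientAt a (l ++ [o, !o] ++ r) (l.length + 1) = !orientAt a (l ++ [o, !o] ++ r) l.length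
        rw [orientAt_length, orientAt_length_succ])
  | cap =>
    refine IsMatching.cap (N := l.length + r.length + 1) h (by simp; omega)
      (fun i => (hs i).trans (by simp [OrientedSlice.tgt, OrientedSlice.pieceTgt])) ?_
    change orientAt a (l ++ [o, !o] ++ r) (l.length + 1) = !orientAt a (l ++ [o, !o] ++ r) l.length
    rw [orientAt_length, orientAt_length_succ]
  | birth =>
    exact IsMatching.birth h (by simp; omega)
      (fun i => (ht i).trans (by simp [OrientedSlice.src, OrientedSlice.pieceSrc]))
  | death =>
    exact IsMatching.death (N := l.length + r.length + 1) h (by simp; omega)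
      (fun i => (hs i).trans (by simp [OrientedSlice.tgt, OrientedSlice.pieceTgt]))

theorem isMatching_linkFrom {a : Bool} {s t : List Bool} {m : ℕ → Option ℕ}
    {D : List OrientedSlice} (hD : IsOrientedPath s D t)
    (h : IsMatching (s.length + 1) (orientAt a s) m) :
    IsMatching (t.length + 1) (orientAt a t) (linkFrom m (D.map OrientedSlice.flat)) := by
  induction D generalizing s m with
  | nil => cases hD; exact h
  | cons x D ih =>
    obtain ⟨rfl, hD⟩ := hD
    exact ih hD h.step

/-- The points at the bottom line of a tangle with one bottom endpoint: it is joined to the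
additional strand. -/
def startLink (i : ℕ) : Option ℕ := if i = 0 then some 1 else if i = 1 then some 0 else none

theorem isMatching_startLink (a : Bool) : IsMatching 2 (orientAt a [a]) startLink := by
  have key : ∀ i j, startLink i = some j → (i = 0 ∧ j = 1) ∨ (i = 1 ∧ j = 0) := by
    intro i j h
    unfold startLink at h
    split_ifs at h with h1 h2 <;> simp_all
  constructor
  · intro i j h
    have := key i j h
    omega
  · intro i j h
    rcases key i j h with ⟨rfl, rfl⟩ | ⟨rfl, rfl⟩ <;> rfl
  · intro i j h
    have := key i j h
    omega
  · intro i j h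
    rcases key i j h with ⟨rfl, rfl⟩ | ⟨rfl, rfl⟩ <;> simp [orientAt]
  · intro i j k r h h' h1 h2
    have := key i j h
    have := key k r h'
    omega

/-! ### Evaluation of oriented crossingless diagrams -/

section Evaluation

variable {γ : Type*} {K : Type*} [CommRing K] [DecidableEq γ] [Fintype γ]

/-- The operator of an oriented slice without crossings. -/
def orientedSliceOp (u u' ω : γ → K) (x : OrientedSlice) : Module.End K ((ℕ → γ) → K) :=
  liftN x.left.length <|
    match x.piece with
    | .cup => cupOp fun c => if x.o then u c else 1
    | .cap => capOp fun c => if x.o then 1 else u' c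
    | .birth => birthOp ω
    | .death => deathOp ω

/-- The operator of an oriented diagram without crossings. -/
def orientedOp (u u' ω : γ → K) : List OrientedSlice → Module.End K ((ℕ → γ) → K)
  | [] => 1
  | x :: D => orientedOp u u' ω D * orientedSliceOp u u' ω x

theorem orientedOp_append (u u' ω : γ → K) (D D' : List OrientedSlice) :
    orientedOp u u' ω (D ++ D') = orientedOp u u' ω D' * orientedOp u u' ω D := by
  induction D with
  | nil => simp [orientedOp]
  | cons x D ih => simp [orientedOp, ih, mul_assoc]

/-- The product of the factors of the components that do not reach the upper line. -/
def closedFactor (u u' ω : γ → K) (m : ℕ → Option ℕ) : List OrientedSlice → K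
  | [] => 1
  | x :: D => closedFactor u u' ω (linkStep x.left.length x.piece m) D *
      stepFactor u u' ω m x.left.length x.o x.piece

variable {u u' ω : γ → K} {a : Bool}

theorem orientedSliceOp_matchingValue (hu : ∀ x, u x * u' x = 1) (hω : ∀ x, ω x * u x = ω x)
    {m : ℕ → Option ℕ} {x : OrientedSlice}
    (h : IsMatching (x.src.length + 1) (orientAt a x.src) m) :
    orientedSliceOp u u' ω x (matchingValue u ω (x.src.length + 1) (orientAt a x.src) m) =
      stepFactor u u' ω m x.left.length x.o x.piece •
        matchingValue u ω (x.tgt.length + 1) (orientAt a x.tgt)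
          (linkStep x.left.length x.piece m) := by
  rw [OrientedSlice.length_src] at h ⊢
  rw [OrientedSlice.length_tgt]
  have hs := orientAt_shift a x.left x.pieceSrc x.right
  have ht := orientAt_shift a x.left x.pieceTgt x.right
  rw [OrientedSlice.length_pieceSrc] at hs
  rw [OrientedSlice.length_pieceTgt] at ht
  obtain ⟨l, p, o, r⟩ := x
  cases p with
  | cup =>
    have := cup_matchingValue (u := u) (ω := ω) (m := m) (N := l.length + r.length + 1)
      (l := l.length) (t := orientAt a (l ++ [] ++ r)) (t' := orientAt a (l ++ [o, !o] ++ r)) (by omega)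
      (fun i => (ht i).trans (by simp))
    rw [orientAt_length] at this
    exact this.trans (one_smul _ _).symm
  | cap =>
    have := cap_matchingValue (N := l.length + r.length + 1) (l := l.length)
      (t := orientAt a (l ++ [o, !o] ++ r)) (t' := orientAt a (l ++ [] ++ r)) hu hω
      h (by omega) (fun i => (hs i).trans (by simp))
      (by rw [orientAt_length, orientAt_length_succ])
    rw [orientAt_length] at this
    exact this
  | birth =>
    exact (birth_matchingValue (N := l.length + r.length + 1)
      (l := l.length) (t := orientAt a (l ++ [] ++ r)) (t' := orientAt a (l ++ [o] ++ r)) (by omega)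
      (fun i => (ht i).trans (by simp))).trans (one_smul _ _).symm
  | death =>
    exact death_matchingValue (N := l.length + r.length + 1) (l := l.length)
      (t := orientAt a (l ++ [o] ++ r)) (t' := orientAt a (l ++ [] ++ r)) hω
      h (by omega) (fun i => (hs i).trans (by simp)) o

/-- The value stays a product over the components that reach the current line; the scalars left
behind by completed components accumulate in `closedFactor`. The weights are kept general because
two different choices are used. -/
theorem orientedOp_matchingValue (hu : ∀ x, u x * u' x = 1) (hω : ∀ x, ω x * u x = ω x)
    {m : ℕ → Option ℕ} {s t : List Bool} {D : List OrientedSlice} (hD : IsOrientedPath s D t)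
    (h : IsMatching (s.length + 1) (orientAt a s) m) :
    orientedOp u u' ω D (matchingValue u ω (s.length + 1) (orientAt a s) m) =
      closedFactor u u' ω m D • matchingValue u ω (t.length + 1) (orientAt a t)
        (linkFrom m (D.map OrientedSlice.flat)) := by
  induction D generalizing s m with
  | nil => cases hD; exact (one_smul _ _).symm
  | cons x D ih =>
    obtain ⟨rfl, hD⟩ := hD
    rw [orientedOp, Module.End.mul_apply, orientedSliceOp_matchingValue hu hω h, map_smul,
      ih hD h.step, smul_smul, closedFactor, mul_comm]
    rfl

end Evaluation

/-- Some maximum in the diagram joins the two ends of a strand. -/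
def ClosesLoop (m : ℕ → Option ℕ) (D : List OrientedSlice) : Prop :=
  ∃ D₁ x D₂, D = D₁ ++ x :: D₂ ∧ x.piece = .cap ∧
    linkFrom m (D₁.map OrientedSlice.flat) x.left.length = some (x.left.length + 1)

theorem closesLoop_cons {m : ℕ → Option ℕ} {x : OrientedSlice} {D : List OrientedSlice} :
    ClosesLoop m (x :: D) ↔ (x.piece = .cap ∧ m x.left.length = some (x.left.length + 1)) ∨
      ClosesLoop (linkStep x.left.length x.piece m) D := by
  constructor
  · rintro ⟨D₁, y, D₂, h, hy, h'⟩
    cases D₁ with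
    | nil =>
      obtain ⟨rfl, rfl⟩ := List.cons.inj h
      exact .inl ⟨hy, h'⟩
    | cons z D₁ =>
      obtain ⟨rfl, rfl⟩ := List.cons.inj h
      exact .inr ⟨D₁, y, D₂, rfl, hy, h'⟩
  · rintro (⟨h, h'⟩ | ⟨D₁, y, D₂, rfl, hy, h'⟩)
    · exact ⟨[], x, D, rfl, h, h'⟩
    · exact ⟨x :: D₁, y, D₂, rfl, hy, h'⟩

/-! ### Travelling along the strands of a crossingless diagram -/

open Relation

theorem shift_zero (l i : ℕ) : shift l 0 i = i := by simp [shift]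

/-- A strand that does not belong to the piece runs straight through and is only renumbered. Applied
to the flipped piece, this also covers downward travel. -/
theorem pass_shift (l : ℕ) (p : FlatPiece) (i : ℕ) :
    pass l p (shift l p.bot i) = some (true, shift l p.top i) := by
  by_cases h : i < l
  · simp [pass, shift, h]
  · cases p <;> simp [pass, shift, h, FlatPiece.bot, FlatPiece.top, FlatPiece.flip] <;>
      split_ifs <;> first | rfl | omega

theorem FlatPiece.flip_flip (p : FlatPiece) : p.flip.flip = p := by cases p <;> rfl

/-- A step to a node at height at most `k`. -/
def StepBelow (D : List FlatSlice) (k : ℕ) (x y : Node) : Prop := Step D x y ∧ y.level ≤ k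

/-- The node at which the strand with number `i` at a line is entered from above; the strand with
number `n` is the one that leads to the bottom endpoint. -/
def downNode (k n i : ℕ) : Node := if i < n then ⟨k, i, false⟩ else ⟨0, 0, true⟩

/-- The node at which the strand with number `i` at a line is left through the top. -/
def upNode (k n i : ℕ) : Node := if i < n then ⟨k, i, true⟩ else ⟨0, 0, false⟩

theorem level_downNode_le (k n i : ℕ) : (downNode k n i).level ≤ k := by
  unfold downNode; split_ifs <;> simp

section Steps

variable {D : List FlatSlice} {k n : ℕ} {s : FlatSlice}

theorem next_up (hs : D[k]? = some s) (i : ℕ) :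
    next D ⟨k, i, true⟩ = (pass s.left s.piece i).map fun y =>
      if y.1 then ⟨k + 1, y.2, true⟩ else ⟨k, y.2, false⟩ := by
  simp [next, hs]

theorem next_down (hs : D[k]? = some s) (i : ℕ) :
    next D ⟨k + 1, i, false⟩ = (pass s.left s.piece.flip i).map fun y =>
      if y.1 then ⟨k, y.2, false⟩ else ⟨k + 1, y.2, true⟩ := by
  simp [next, hs]

theorem reach_up (hs : D[k]? = some s) (hn : s.left ≤ n) (i : ℕ) :
    ReflTransGen (StepBelow D (k + 1)) (upNode k (n + s.piece.bot) (shift s.left s.piece.bot i))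
      (upNode (k + 1) (n + s.piece.top) (shift s.left s.piece.top i)) := by
  by_cases h : i < n
  · rw [upNode, upNode, if_pos ((shift_lt_add hn).2 h), if_pos ((shift_lt_add hn).2 h)]
    refine .single ⟨?_, le_rfl⟩
    rw [Step, next_up hs, pass_shift]
    rfl
  · rw [upNode, upNode, if_neg (by rwa [shift_lt_add hn]), if_neg (by rwa [shift_lt_add hn])]

theorem reach_down (hs : D[k]? = some s) (hn : s.left ≤ n) (i : ℕ) :
    ReflTransGen (StepBelow D (k + 1))
      (downNode (k + 1) (n + s.piece.top) (shift s.left s.piece.top i))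
      (downNode k (n + s.piece.bot) (shift s.left s.piece.bot i)) := by
  by_cases h : i < n
  · rw [downNode, downNode, if_pos ((shift_lt_add hn).2 h), if_pos ((shift_lt_add hn).2 h)]
    refine .single ⟨?_, by simp⟩
    rw [Step, next_down hs, FlatPiece.top, pass_shift, FlatPiece.top, FlatPiece.flip_flip]
    rfl
  · rw [downNode, downNode, if_neg (by rwa [shift_lt_add hn]), if_neg (by rwa [shift_lt_add hn])]

theorem step_cap_left (hs : D[k]? = some s) (hp : s.piece = .cap) (hn : s.left + 1 < n) :
    StepBelow D k (upNode k n s.left) (downNode k n (s.left + 1)) := by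
  rw [upNode, downNode, if_pos (by omega), if_pos hn]
  refine ⟨?_, le_rfl⟩
  rw [Step, next_up hs, hp]
  simp [pass]

theorem step_cap_right (hs : D[k]? = some s) (hp : s.piece = .cap) (hn : s.left + 1 < n) :
    StepBelow D k (upNode k n (s.left + 1)) (downNode k n s.left) := by
  rw [upNode, downNode, if_pos (by omega), if_pos (by omega)]
  refine ⟨?_, le_rfl⟩
  rw [Step, next_up hs, hp]
  simp [pass]

theorem step_cup_left (hs : D[k]? = some s) (hp : s.piece = .cup) (hn : s.left + 1 < n) :
    StepBelow D (k + 1) (downNode (k + 1) n s.left) (upNode (k + 1) n (s.left + 1)) := by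
  rw [upNode, downNode, if_pos (by omega), if_pos (by omega)]
  refine ⟨?_, le_rfl⟩
  rw [Step, next_down hs, hp]
  simp [pass, FlatPiece.flip]

theorem step_cup_right (hs : D[k]? = some s) (hp : s.piece = .cup) (hn : s.left + 1 < n) :
    StepBelow D (k + 1) (downNode (k + 1) n (s.left + 1)) (upNode (k + 1) n s.left) := by
  rw [upNode, downNode, if_pos (by omega), if_pos (by omega)]
  refine ⟨?_, le_rfl⟩
  rw [Step, next_down hs, hp]
  simp [pass, FlatPiece.flip]

end Steps

/-- The points at height `k` that are joined by `m` are joined by strands below. -/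
def Joins (D : List FlatSlice) (k n : ℕ) (m : ℕ → Option ℕ) : Prop :=
  ∀ i j, m i = some j → ReflTransGen (StepBelow D k) (downNode k n i) (upNode k n j)

/-- The points at height `k` that are not joined by `m` lie on strands that end in the interior. -/
def Ends (D : List FlatSlice) (k n : ℕ) (m : ℕ → Option ℕ) : Prop :=
  ∀ i ≤ n, m i = none → ∃ z, ReflTransGen (Step D) (downNode k n i) z ∧ next D z = none ∧
    (z.up = true → z.level < D.length)

/-- At a maximum, the strand arriving at one leg turns and follows the arc of the other leg. The
bound on the height is carried along because it is needed to recognise the highest maximum of a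
loop. -/
theorem Joins.step {D : List FlatSlice} {k n : ℕ} {s : FlatSlice} {m : ℕ → Option ℕ} {t : ℕ → Bool}
    (h : Joins D k (n + s.piece.bot) m) (hs : D[k]? = some s) (hn : s.left ≤ n)
    (hm : IsMatching (n + s.piece.bot + 1) t m) :
    Joins D (k + 1) (n + s.piece.top) (linkStep s.left s.piece m) := by
  intro i j hij
  have up := fun i => reach_up hs hn i
  have down := fun i => reach_down hs hn i
  have lift : ∀ {y z}, ReflTransGen (StepBelow D k) y z → ReflTransGen (StepBelow D (k + 1)) y z :=
    fun h => ReflTransGen.mono (fun _ _ h => ⟨h.1, h.2.trans (Nat.le_succ _)⟩) _ _ h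
  have capl := fun hp => step_cap_left (n := n + 2) hs hp (by omega)
  have capr := fun hp => step_cap_right (n := n + 2) hs hp (by omega)
  have cupl := fun hp => step_cup_left (n := n + 2) hs hp (by omega)
  have cupr := fun hp => step_cup_right (n := n + 2) hs hp (by omega)
  obtain ⟨l, p, r⟩ := s
  cases p with
  | cup =>
    rcases shift_cases l 2 i with ⟨i, rfl⟩ | h3
    · rw [linkStep_cup_shift] at hij
      obtain ⟨j, hj, rfl⟩ := Option.map_eq_some_iff.1 hij
      have := h i j hj
      rw [← shift_zero l i, ← shift_zero l j] at this
      exact (down i).trans ((lift this).trans (up j))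
    · obtain rfl | rfl : i = l ∨ i = l + 1 := by omega
      · rw [linkStep_cup_left] at hij
        obtain rfl := Option.some.inj hij
        exact .single (cupl rfl)
      · rw [linkStep_cup_right] at hij
        obtain rfl := Option.some.inj hij
        exact .single (cupr rfl)
  | birth =>
    rcases shift_cases l 1 i with ⟨i, rfl⟩ | h3
    · rw [linkStep_birth_shift] at hij
      obtain ⟨j, hj, rfl⟩ := Option.map_eq_some_iff.1 hij
      have := h i j hj
      rw [← shift_zero l i, ← shift_zero l j] at this
      exact (down i).trans ((lift this).trans (up j))
    · obtain rfl : i = l := by omega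
      rw [linkStep_birth_self] at hij
      cases hij
  | death =>
    have hij := linkStep_death_eq_some.1 hij
    have h1 := down i
    have h2 := up j
    rw [show FlatPiece.death.top = 0 from rfl, shift_zero] at h1 h2
    exact h1.trans ((lift (h _ _ hij)).trans h2)
  | cap =>
    have h1 := down i
    have h2 := up j
    rw [show FlatPiece.cap.top = 0 from rfl, shift_zero] at h1 h2
    refine h1.trans (ReflTransGen.trans ?_ h2)
    refine lift ?_
    rcases (linkStep_cap_eq_some hm).1 hij with h3 | ⟨h3, h4⟩ | ⟨h3, h4⟩
    · exact h _ _ h3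
    · exact ((h _ _ h3).tail (capl rfl)).trans (h _ _ h4)
    · exact ((h _ _ h3).tail (capr rfl)).trans (h _ _ h4)

/-- A birth or death supplies the dead end directly; in all other cases the way leads along arcs to
a dead end found further below. The clause on `z.up` separates interior dead ends from the upper
boundary point. -/
theorem Ends.step {D : List FlatSlice} {k n : ℕ} {s : FlatSlice} {m : ℕ → Option ℕ} {t : ℕ → Bool}
    (h : Ends D k (n + s.piece.bot) m) (h' : Joins D k (n + s.piece.bot) m) (hs : D[k]? = some s)
    (hn : s.left ≤ n) (hm : IsMatching (n + s.piece.bot + 1) t m) :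
    Ends D (k + 1) (n + s.piece.top) (linkStep s.left s.piece m) := by
  intro i hi hij
  have down : ∀ i, ReflTransGen (Step D) _ _ := fun i =>
    ReflTransGen.mono (fun _ _ h => h.1) _ _ (reach_down hs hn i)
  have joins : ∀ i j, m i = some j → ReflTransGen (Step D) _ _ := fun i j h =>
    ReflTransGen.mono (fun _ _ h => h.1) _ _ (h' i j h)
  have capl := fun hp => (step_cap_left (n := n + 2) hs hp (by omega)).1
  have capr := fun hp => (step_cap_right (n := n + 2) hs hp (by omega)).1
  have hk : k < D.length := (List.getElem?_eq_some_iff.1 hs).1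
  have hnu := next_up hs
  have hnd := next_down hs
  have extend : ∀ {x y : Node}, ReflTransGen (Step D) x y →
      (∃ z, ReflTransGen (Step D) y z ∧ next D z = none ∧ (z.up = true → z.level < D.length)) →
      ∃ z, ReflTransGen (Step D) x z ∧ next D z = none ∧ (z.up = true → z.level < D.length) :=
    fun hxy ⟨z, h1, h2⟩ => ⟨z, hxy.trans h1, h2⟩
  obtain ⟨l, p, r⟩ := s
  dsimp only at hn hnu hnd hi
  cases p with
  | cup =>
    rcases shift_cases l 2 i with ⟨i, rfl⟩ | h3
    · rw [linkStep_cup_shift, Option.map_eq_none_iff] at hij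
      have hi' : i ≤ n := by
        have := (shift_lt_add (k := 2) (i := i) (n := n + 1) (l := l) (by omega)).1
        change shift l 2 i ≤ n + 2 at hi
        omega
      refine extend (down i) ?_
      dsimp only
      rw [show FlatPiece.cup.bot = 0 from rfl, shift_zero]
      exact h i hi' hij
    · obtain rfl | rfl : i = l ∨ i = l + 1 := by omega
      · rw [linkStep_cup_left] at hij
        cases hij
      · rw [linkStep_cup_right] at hij
        cases hij
  | birth =>
    rcases shift_cases l 1 i with ⟨i, rfl⟩ | h3
    · rw [linkStep_birth_shift, Option.map_eq_none_iff] at hij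
      have hi' : i ≤ n := by
        have := (shift_lt_add (k := 1) (i := i) (n := n + 1) (l := l) (by omega)).1
        change shift l 1 i ≤ n + 1 at hi
        omega
      refine extend (down i) ?_
      dsimp only
      rw [show FlatPiece.birth.bot = 0 from rfl, shift_zero]
      exact h i hi' hij
    · obtain rfl : i = l := by omega
      refine ⟨⟨k + 1, i, false⟩, ?_, ?_, by simp⟩
      · have : downNode (k + 1) (n + 1) i = ⟨k + 1, i, false⟩ := if_pos (by omega)
        exact this ▸ .refl
      · rw [hnd]
        simp [pass, FlatPiece.flip]
  | death =>
    have h1 := down i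
    rw [show FlatPiece.death.top = 0 from rfl, shift_zero] at h1
    refine extend h1 ?_
    change i ≤ n at hi
    have hi' : shift l 1 i ≤ n + 1 := by
      have := (shift_lt_add (k := 1) (i := i) (n := n + 1) (l := l) (by omega)).2 (by omega)
      omega
    cases hmi : m (shift l 1 i) with
    | none => exact h _ hi' hmi
    | some j =>
      obtain rfl : j = l := by
        simp [linkStep, hmi] at hij
        exact hij
      refine extend (joins _ _ hmi) ⟨⟨k, j, true⟩, ?_, ?_, fun _ => hk⟩
      · have : upNode k (n + 1) j = ⟨k, j, true⟩ := if_pos (by omega)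
        exact this ▸ .refl
      · rw [hnu]
        simp [pass]
  | cap =>
    have h1 := down i
    rw [show FlatPiece.cap.top = 0 from rfl, shift_zero] at h1
    refine extend h1 ?_
    change i ≤ n at hi
    have hi' : shift l 2 i ≤ n + 2 := by
      have := (shift_lt_add (k := 2) (i := i) (n := n + 1) (l := l) (by omega)).2 (by omega)
      omega
    cases hmi : m (shift l 2 i) with
    | none => exact h _ hi' hmi
    | some j =>
      simp only [linkStep, hmi, Option.bind_some] at hij
      split_ifs at hij with h2 h3
      · subst h2
        exact extend ((joins _ _ hmi).tail (capl rfl))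
          (h (j + 1) (show j + 1 ≤ n + 2 by omega) (Option.map_eq_none_iff.1 hij))
      · subst h3
        exact extend ((joins _ _ hmi).tail (capr rfl))
          (h l (show l ≤ n + 2 by omega) (Option.map_eq_none_iff.1 hij))

/-- The points on the upper line of a part of a diagram are joined by strands as described by
`linkFrom startLink`. -/
theorem joins_and_ends {a : Bool} {D₁ : List OrientedSlice} {D₂ : List FlatSlice} {s : List Bool}
    (h : IsOrientedPath [a] D₁ s) :
    Joins (D₁.map OrientedSlice.flat ++ D₂) D₁.length s.length
        (linkFrom startLink (D₁.map OrientedSlice.flat)) ∧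
      Ends (D₁.map OrientedSlice.flat ++ D₂) D₁.length s.length
        (linkFrom startLink (D₁.map OrientedSlice.flat)) := by
  induction D₁ using List.reverseRecOn generalizing D₂ s with
  | nil =>
    obtain rfl : [a] = s := h
    constructor
    · intro i j hij
      change startLink i = some j at hij
      unfold startLink at hij
      split_ifs at hij with h1 h2
      · obtain rfl := Option.some.inj hij
        subst h1
        exact .refl
      · obtain rfl := Option.some.inj hij
        subst h2
        exact .refl
    · intro i hi hij
      change startLink i = none at hij
      change i ≤ 1 at hi
      unfold startLink at hij
      split_ifs at hij with h1 h2
      omega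
  | append_singleton D₁ x ih =>
    obtain ⟨s', h1, rfl, rfl⟩ := isOrientedPath_append.1 h
    have hm := isMatching_linkFrom h1 (isMatching_startLink a)
    have ih := ih (D₂ := x.flat :: D₂) h1
    rw [OrientedSlice.length_src] at hm ih
    rw [List.map_append, List.map_singleton, linkFrom_concat, List.append_assoc,
      List.singleton_append, List.length_append, List.length_singleton, OrientedSlice.length_tgt]
    have hs : (D₁.map OrientedSlice.flat ++ x.flat :: D₂)[D₁.length]? = some x.flat := by simp
    exact ⟨ih.1.step hs (Nat.le_add_right _ _) hm,
      ih.2.step ih.1 hs (Nat.le_add_right _ _) hm⟩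

/-! ### Loops as cycles of a deterministic step relation -/

section Cycles

variable {D : List FlatSlice} {x y z : Node}

theorem Step.unique (h : Step D x y) (h' : Step D x z) : y = z :=
  Option.some.inj (h.symm.trans h')

theorem transGen_self_of_step (h : TransGen (Step D) x x) (hxy : Step D x y) :
    TransGen (Step D) y y ∧ ReflTransGen (Step D) y x := by
  obtain ⟨y', h1, h2⟩ := TransGen.head'_iff.1 h
  obtain rfl := h1.unique hxy
  exact ⟨TransGen.tail' h2 hxy, h2⟩

/-- Each node has at most one successor, so a path that starts on a cycle never leaves it. -/
theorem transGen_self_of_reflTransGen (h : TransGen (Step D) x x)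
    (hxy : ReflTransGen (Step D) x y) : TransGen (Step D) y y ∧ ReflTransGen (Step D) y x := by
  induction hxy with
  | refl => exact ⟨h, .refl⟩
  | tail _ h2 ih =>
    have := transGen_self_of_step ih.1 h2
    exact ⟨this.1, this.2.trans ih.2⟩

theorem exists_step_of_transGen (h : TransGen (Step D) x y) : ∃ z, Step D x z := by
  obtain ⟨z, h1, -⟩ := TransGen.head'_iff.1 h
  exact ⟨z, h1⟩

theorem level_le_of_step (h : Step D x y) : x.level ≤ D.length := by
  obtain ⟨k, i, b⟩ := x
  cases b
  · cases k with
    | zero => exact Nat.zero_le _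
    | succ k =>
      by_contra hk
      simp only at hk
      simp [Step, next, show D[k]? = none from List.getElem?_eq_none (by omega)] at h
  · by_contra hk
    simp only at hk
    simp [Step, next, show D[k]? = none from List.getElem?_eq_none (by omega)] at h

/-- If a path that stays below height `k` can be closed to a loop, then this loop stays below
height `k`. -/
theorem level_le_of_reflTransGen {k : ℕ} (hx : x.level ≤ k) (h : ReflTransGen (StepBelow D k) x y)
    (hyx : Step D y x) (hz : ReflTransGen (Step D) x z) : z.level ≤ k := by
  suffices z.level ≤ k ∧ ReflTransGen (StepBelow D k) z y from this.1
  induction hz with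
  | refl => exact ⟨hx, h⟩
  | tail _ h2 ih =>
    rcases ih.2.cases_head with rfl | ⟨w, h3, h4⟩
    · obtain rfl := h2.unique hyx
      exact ⟨hx, h⟩
    · obtain rfl := h2.unique h3.1
      exact ⟨h3.2, h4⟩

theorem pass_eq_some_false {l i j : ℕ} {p : FlatPiece} (h : pass l p i = some (false, j)) :
    p = .cap ∧ (i = l ∧ j = l + 1 ∨ i = l + 1 ∧ j = l) := by
  unfold pass at h
  cases p <;> simp only at h <;> split_ifs at h <;> simp_all

/-- From one leg of the maximum the loop descends and comes back to height `k` along an arc of the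
matching. It may not rise further, so it turns at this very maximum, and the arc joins the two legs.
-/
theorem link_of_cycle {k n i : ℕ} {s : FlatSlice} {m : ℕ → Option ℕ} {t : ℕ → Bool}
    (hs : D[k]? = some s) (hi : i = s.left ∨ i = s.left + 1)
    (hm : IsMatching (n + 1) t m) (hn : s.left + 1 < n) (hj : Joins D k n m) (he : Ends D k n m)
    (hc : TransGen (Step D) (downNode k n i) (downNode k n i))
    (hl : ∀ y, ReflTransGen (Step D) (downNode k n i) y → y.level ≤ k) :
    m s.left = some (s.left + 1) := by
  have cyc := fun y h => exists_step_of_transGen (transGen_self_of_reflTransGen (y := y) hc h).1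
  cases hmi : m i with
  | none =>
    obtain ⟨z, h1, h2, -⟩ := he i (by omega) hmi
    obtain ⟨w, hw⟩ := cyc z h1
    rw [Step, h2] at hw
    cases hw
  | some j =>
    have h1 : ReflTransGen (Step D) _ _ := ReflTransGen.mono (fun _ _ h => h.1) _ _ (hj i j hmi)
    obtain ⟨w, hw⟩ := cyc _ h1
    -- Number `n` would lead down through the bottom endpoint, where travel stops; a cycle cannot do
    -- that.
    have hjn : j < n := by
      by_contra h
      rw [upNode, if_neg h] at hw
      cases hw
    rw [upNode, if_pos hjn] at h1 hw
    have hwl := hl w (h1.tail hw)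
    rw [Step, next_up hs, Option.map_eq_some_iff] at hw
    obtain ⟨⟨b, r⟩, h3, rfl⟩ := hw
    cases b
    · have h4 := pass_eq_some_false h3
      have h5 := hm.ne _ _ hmi
      have h6 := hm.symm _ _ hmi
      rcases hi with rfl | rfl
      · rw [hmi]; congr 1; omega
      · rw [show s.left = j by omega, h6]; congr 1; omega
    · simp at hwl

/-- The highest points of a loop lie on a maximum. -/
theorem exists_cap_of_hasLoop (h : HasLoop D) : ∃ k i s, D[k]? = some s ∧ s.piece = .cap ∧
    (i = s.left ∨ i = s.left + 1) ∧ TransGen (Step D) ⟨k, i, false⟩ ⟨k, i, false⟩ ∧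
    ∀ y, ReflTransGen (Step D) ⟨k, i, false⟩ y → y.level ≤ k := by
  obtain ⟨x, hx⟩ := h
  set S : Set ℕ := {k | ∃ y, ReflTransGen (Step D) x y ∧ y.level = k} with hS
  -- Every node on the loop has a successor, which bounds its height.
  have hb : BddAbove S := ⟨D.length, by
    rintro _ ⟨y, hy, rfl⟩
    obtain ⟨z, hz⟩ := exists_step_of_transGen (transGen_self_of_reflTransGen hx hy).1
    exact level_le_of_step hz⟩
  obtain ⟨y, hy, hyS⟩ := Nat.sSup_mem (s := S) ⟨_, x, .refl, rfl⟩ hb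
  have hmax : ∀ z, ReflTransGen (Step D) x z → z.level ≤ y.level := fun z hz => by
    rw [hyS]; exact le_csSup hb ⟨z, hz, rfl⟩
  suffices ∃ k i s, D[k]? = some s ∧ s.piece = .cap ∧ (i = s.left ∨ i = s.left + 1) ∧
      ReflTransGen (Step D) x ⟨k, i, false⟩ ∧ k = y.level by
    obtain ⟨k, i, s, h1, h2, h3, h4, rfl⟩ := this
    exact ⟨_, i, s, h1, h2, h3, (transGen_self_of_reflTransGen hx h4).1,
      fun z hz => hmax z (h4.trans hz)⟩
  have hyy := (transGen_self_of_reflTransGen hx hy).1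
  -- a step from an upward node to a downward node takes place at a maximum
  have turn : ∀ k i (w : Node), ReflTransGen (Step D) x ⟨k, i, true⟩ → Step D ⟨k, i, true⟩ w →
      w.level ≤ k → ∃ i s, D[k]? = some s ∧ s.piece = .cap ∧ (i = s.left ∨ i = s.left + 1) ∧
        ReflTransGen (Step D) x ⟨k, i, false⟩ := by
    intro k i w h1 h2 h3
    have h4 := h1.tail h2
    cases hs : D[k]? with
    | none => simp [Step, next, hs] at h2
    | some s =>
      rw [Step, next_up hs, Option.map_eq_some_iff] at h2
      obtain ⟨⟨b, r⟩, h5, rfl⟩ := h2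
      cases b
      · have h6 := pass_eq_some_false h5
        exact ⟨r, s, rfl, h6.1, by omega, h4⟩
      · simp at h3
  obtain ⟨K, i, b⟩ := y
  cases b
  -- The predecessor of a downward node at the greatest height cannot be a downward node, which
  -- would be higher. So it is an upward node, and the loop turns there.
  · obtain ⟨p, h1, h2⟩ := TransGen.tail'_iff.1 hyy
    have hp := hmax p (hy.trans h1)
    obtain ⟨k, j, b⟩ := p
    cases b
    · cases k with
      | zero => cases h2
      | succ k =>
        cases hs : D[k]? with
        | none => simp [Step, next, hs] at h2
        | some s =>
          rw [Step, next_down hs, Option.map_eq_some_iff] at h2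
          obtain ⟨⟨b, r⟩, h5, h6⟩ := h2
          cases b
          · simp at h6
          · simp only [if_true, Node.mk.injEq] at h6
            simp only at hp
            omega
    · obtain ⟨i', s, h3⟩ := turn k j _ (hy.trans h1) h2 (by
        cases hs : D[k]? with
        | none => simp [Step, next, hs] at h2
        | some s =>
          rw [Step, next_up hs, Option.map_eq_some_iff] at h2
          obtain ⟨⟨b, r⟩, h5, h6⟩ := h2
          cases b
          · simp at h6
            simp [h6]
          · simp at h6)
      have : k = K := by
        cases hs : D[k]? with
        | none => simp [Step, next, hs] at h2
        | some s =>
          rw [Step, next_up hs, Option.map_eq_some_iff] at h2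
          obtain ⟨⟨b, r⟩, h5, h6⟩ := h2
          cases b
          · simp at h6
            exact h6.1
          · simp at h6
      subst this
      exact ⟨k, i', s, h3.1, h3.2.1, h3.2.2.1, h3.2.2.2, rfl⟩
  · obtain ⟨w, hw⟩ := exists_step_of_transGen hyy
    obtain ⟨i', s, h3⟩ := turn K i w hy hw (hmax w (hy.tail hw))
    exact ⟨K, i', s, h3.1, h3.2.1, h3.2.2.1, h3.2.2.2, rfl⟩

end Cycles

/-! ### Loops and through strands in terms of matchings -/

section Oriented

variable {a : Bool} {t : List Bool}

theorem OrientedSlice.left_succ_lt {x : OrientedSlice} (h : x.piece = .cap) :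
    x.left.length + 1 < x.src.length := by
  rw [length_src, h, FlatPiece.bot]; omega

/-- The maximum in a slice is the highest one of a loop iff it joins the two ends of a strand. -/
theorem isTopOfLoop_iff {D₁ D₂ : List OrientedSlice} {x : OrientedSlice}
    (h : IsOrientedPath [a] (D₁ ++ x :: D₂) t) (hx : x.piece = .cap) :
    IsTopOfLoop ((D₁ ++ x :: D₂).map OrientedSlice.flat) D₁.length x.left.length ↔
      linkFrom startLink (D₁.map OrientedSlice.flat) x.left.length = some (x.left.length + 1) := by
  obtain ⟨s, h1, rfl, -⟩ := isOrientedPath_append.1 h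
  have hm := isMatching_linkFrom h1 (isMatching_startLink a)
  obtain ⟨hj, he⟩ := joins_and_ends (D₂ := x.flat :: D₂.map OrientedSlice.flat) h1
  rw [List.map_append, List.map_cons]
  set D := D₁.map OrientedSlice.flat ++ x.flat :: D₂.map OrientedSlice.flat with hD
  set m := linkFrom startLink (D₁.map OrientedSlice.flat)
  set k := D₁.length with hk
  have hs : D[k]? = some x.flat := by simp [hD, hk]
  have hn := OrientedSlice.left_succ_lt hx
  have hcap := step_cap_left hs hx hn
  have hup : upNode k x.src.length x.left.length = ⟨k, x.left.length, true⟩ :=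
    if_pos (by omega)
  change StepBelow D k (upNode k x.src.length x.left.length) _ at hcap
  rw [hup] at hcap
  constructor
  · rintro ⟨h2, h3⟩
    have h4 := transGen_self_of_step h2 hcap.1
    exact link_of_cycle hs (.inr rfl) hm hn hj he h4.1 fun y hy => h3 y (TransGen.head' hcap.1 hy)
  · intro h2
    have h3 := hj _ _ (hm.symm _ _ h2)
    rw [hup] at h3
    refine ⟨TransGen.head' hcap.1 (ReflTransGen.mono (fun _ _ h => h.1) _ _ h3), fun y hy => ?_⟩
    obtain ⟨w, h5, h6⟩ := TransGen.head'_iff.1 hy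
    obtain rfl := h5.unique hcap.1
    exact level_le_of_reflTransGen (level_downNode_le _ _ _) h3 hcap.1 h6

/-- A loop is completed at its highest maximum, where the matching below joins the two legs;
conversely, such an arc and the maximum together form a loop. -/
theorem hasLoop_iff {D : List OrientedSlice} (h : IsOrientedPath [a] D t) :
    HasLoop (D.map OrientedSlice.flat) ↔ ClosesLoop startLink D := by
  constructor
  · intro h'
    obtain ⟨k, i, s, hs, hp, hi, hc, hl⟩ := exists_cap_of_hasLoop h'
    rw [List.getElem?_map, Option.map_eq_some_iff] at hs
    obtain ⟨x, hx, rfl⟩ := hs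
    obtain ⟨hk, rfl⟩ := List.getElem?_eq_some_iff.1 hx
    have hD : D = D.take k ++ D[k] :: D.drop (k + 1) := by
      rw [← List.drop_eq_getElem_cons hk, List.take_append_drop]
    refine ⟨_, _, _, hD, hp, ?_⟩
    rw [hD] at h
    obtain ⟨s, h1, rfl, -⟩ := isOrientedPath_append.1 h
    have hm := isMatching_linkFrom h1 (isMatching_startLink a)
    obtain ⟨hj, he⟩ := joins_and_ends
      (D₂ := D[k].flat :: (D.drop (k + 1)).map OrientedSlice.flat) h1
    have hk' : (D.take k).length = k := by simp; omega
    have hD' : (D.take k).map OrientedSlice.flat ++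
        D[k].flat :: (D.drop (k + 1)).map OrientedSlice.flat = D.map OrientedSlice.flat := by
      rw [← List.map_cons, ← List.map_append, ← hD]
    rw [hD', hk'] at hj he
    have hn := OrientedSlice.left_succ_lt hp
    have hdown : downNode k D[k].src.length i = ⟨k, i, false⟩ := if_pos (by
      change i = D[k].left.length ∨ i = D[k].left.length + 1 at hi
      omega)
    rw [← hdown] at hc hl
    exact link_of_cycle (by simp [hx]) hi hm hn hj he hc hl
  · rintro ⟨D₁, x, D₂, rfl, hx, h'⟩
    exact ⟨_, ((isTopOfLoop_iff h hx).2 h').1⟩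

/-- At the top line, point 0 is the upper endpoint and point 1 is the additional strand, which
stands for the lower endpoint. -/
theorem hasThroughStrand_iff {D : List OrientedSlice} (h : IsOrientedPath [a] D [a]) :
    HasThroughStrand (D.map OrientedSlice.flat) ↔
      linkFrom startLink (D.map OrientedSlice.flat) 0 = some 1 := by
  have hm := isMatching_linkFrom h (isMatching_startLink a)
  obtain ⟨hj, he⟩ := joins_and_ends (D₂ := []) h
  rw [List.append_nil] at hj he
  set m := linkFrom startLink (D.map OrientedSlice.flat)
  unfold HasThroughStrand
  rw [List.length_map]
  have hnext : next (D.map OrientedSlice.flat) ⟨D.length, 0, true⟩ = none := by simp [next]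
  constructor
  · intro h1
    refine hm.symm _ _ ?_
    cases hm1 : m 1 with
    -- The strand of the lower endpoint would stop at an interior dead end. Travel is deterministic,
    -- so this dead end would have to be the upper endpoint.
    | none =>
      exfalso
      obtain ⟨z, h2, h3, h4⟩ := he 1 le_rfl hm1
      have key : ∀ {y z : Node}, next (D.map OrientedSlice.flat) y = none →
          ReflTransGen (Step (D.map OrientedSlice.flat)) y z → y = z := by
        intro y z hy hyz
        rcases hyz.cases_head with h | ⟨w, h5, -⟩
        · exact h
        · rw [Step, hy] at h5; cases h5
      have huniq : Relator.RightUnique (Step (D.map OrientedSlice.flat)) :=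
        fun _ _ _ h h' => h.unique h'
      have : z = ⟨D.length, 0, true⟩ := by
        rcases ReflTransGen.total_of_right_unique huniq h1 h2 with h5 | h5
        · exact (key hnext h5).symm
        · exact key h3 h5
      subst this
      simp at h4
    | some j =>
      have h2 := hm.lt' hm1
      have h3 := hm.ne _ _ hm1
      obtain rfl : j = 0 := by
        change j < 2 at h2
        omega
      rfl
  · intro h1
    exact ReflTransGen.mono (fun _ _ h => h.1) _ _ (hj _ _ (hm.symm _ _ h1))

end Oriented

/-! ### Two colours: recognising the states counted by Δ -/

section SignWeights

variable {K : Type*} [CommRing K]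

/-- The weight of a strand of a given colour that runs from left to right at a minimum or maximum. -/
def signWeight (x : Bool) : K := if x then -1 else 1

/-- The weight of a strand that ends in the interior. -/
def endWeight (x : Bool) : K := if x then 0 else 1

-- A loop contributes 1 - 1 = 0, whichever way it runs, and a completed strand with two interior
-- ends contributes 1.
open Classical in
theorem closedFactor_signWeight (m : ℕ → Option ℕ) (D : List OrientedSlice) :
    closedFactor (K := K) signWeight signWeight endWeight m D = if ClosesLoop m D then 0 else 1 := by
  induction D generalizing m with
  | nil =>
    rw [closedFactor, if_neg]
    rintro ⟨D₁, x, D₂, h, -⟩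
    simp at h
  | cons x D ih =>
    rw [closedFactor, ih, closesLoop_cons]
    obtain ⟨l, p, o, r⟩ := x
    cases p <;> simp [stepFactor, signWeight, endWeight]
    split_ifs <;> simp_all

open Classical in
/-- The value of a diagram with two endpoints tells whether it has no closed loop and a strand that
joins the endpoints. -/
theorem orientedOp_signWeight {a : Bool} {D : List OrientedSlice} (h : IsOrientedPath [a] D [a])
    (c : ℕ → Bool) (h0 : c 0 = true) (h1 : c 1 = true) :
    orientedOp (K := K) signWeight signWeight endWeight D
        (fun c => arcWeight signWeight a (c 0) (c 1)) c =
      if ¬ HasLoop (D.map OrientedSlice.flat) ∧ HasThroughStrand (D.map OrientedSlice.flat)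
      then signWeight a else 0 := by
  have hm := isMatching_startLink a
  have hm' := isMatching_linkFrom h hm
  have hstart : (fun c => arcWeight signWeight a (c 0) (c 1)) =
      matchingValue (K := K) signWeight endWeight ([a].length + 1) (orientAt a [a]) startLink := by
    funext c
    simp [matchingValue, Finset.prod_range_succ, pointWeight, startLink, orientAt]
  rw [hstart, orientedOp_matchingValue (by intro x; cases x <;> simp [signWeight])
    (by intro x; cases x <;> simp [signWeight, endWeight]) h hm, closedFactor_signWeight,
    ← hasLoop_iff h, hasThroughStrand_iff h, Pi.smul_apply, smul_eq_mul, matchingValue]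
  set m := linkFrom startLink (D.map OrientedSlice.flat)
  by_cases hl : HasLoop (D.map OrientedSlice.flat)
  · simp [hl]
  · rw [if_neg hl, one_mul, List.length_singleton, Finset.prod_range_succ, Finset.prod_range_one]
    cases hm0 : m 0 with
    -- The boundary colour `true` has weight 0 at an interior end.
    | none => simp [pointWeight_none hm0, h0, endWeight]
    | some j =>
      have h2 := hm'.lt' hm0
      have h3 := hm'.ne _ _ hm0
      obtain rfl : j = 1 := by
        rw [List.length_singleton] at h2
        omega
      -- At the colour `true` the through arc has weight -1 if `a` and 1 otherwise, which is
      -- `signWeight a` with the orientation read as a colour.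
      rw [pointWeight_mul hm' hm0]
      simp [arcWeight, h0, h1, orientAt, signWeight, hl]

end SignWeights

/-! ### The turning number -/

/-- The exponent of `-q` in the weight of a slice. -/
def Slice.balance (x : Slice) : ℤ :=
  match x.piece with
  | .cup o => if o then 1 else 0
  | .cap o => if o then 0 else -1
  | .cross _ _ _ => 0

/-- The exponent of `-q` in the weight of a diagram. -/
def balance (w : List Slice) : ℤ := (w.map Slice.balance).sum

theorem balance_append (w w' : List Slice) : balance (w ++ w') = balance w + balance w' := by
  simp [balance]

/-- In a horizontal smoothing the maximum and the minimum have opposite left legs, so their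
exponents are 0 and 0, or -1 and 1. -/
theorem balance_smooth (w : List Slice) : balance (smooth w) = balance w := by
  induction w with
  | nil => rfl
  | cons x w ih =>
    rw [smooth, List.flatMap_cons, balance_append]
    change _ + balance (smooth w) = _
    rw [ih, show x :: w = [x] ++ w from rfl, balance_append]
    congr 1
    obtain ⟨l, P, r⟩ := x
    cases P with
    | cup o => rfl
    | cap o => rfl
    | cross a b f =>
      cases a <;> cases b <;> simp [Slice.smooth, smoothCrossing, balance, Slice.balance]

/-- A slice without crossing. -/
def Slice.IsFlat (x : Slice) : Prop := ∀ a b f, x.piece ≠ .cross a b f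

theorem isFlat_of_mem_smooth {w : List Slice} {x : Slice} (h : x ∈ smooth w) : x.IsFlat := by
  obtain ⟨y, -, hy⟩ := List.mem_flatMap.1 h
  obtain ⟨l, P, r⟩ := y
  intro a b f
  cases P with
  | cup o => obtain rfl := List.mem_singleton.1 hy; simp
  | cap o => obtain rfl := List.mem_singleton.1 hy; simp
  | cross a b f =>
    simp only [Slice.smooth, smoothCrossing] at hy
    split_ifs at hy
    · simp at hy
    · rcases List.mem_pair.1 hy with rfl | rfl <;> simp

theorem IsPath.smooth {s t : List Bool} {w : List Slice} (h : IsPath s w t) :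
    IsPath s (smooth w) t := by
  induction w generalizing s with
  | nil => exact h
  | cons x w ih =>
    obtain ⟨rfl, h⟩ := h
    refine IsPath.append ?_ (ih h)
    obtain ⟨l, P, r⟩ := x
    cases P with
    | cup o => exact ⟨rfl, rfl⟩
    | cap o => exact ⟨rfl, rfl⟩
    | cross a b f =>
      cases a <;> cases b <;>
        simp [Slice.smooth, smoothCrossing, IsPath, Slice.src, Slice.tgt, Piece.src, Piece.tgt]

/-- A slice without crossing as an oriented slice. -/
def Slice.oriented (x : Slice) : OrientedSlice :=
  match x.piece with
  | .cup o => ⟨x.left, .cup, o, x.right⟩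
  | .cap o => ⟨x.left, .cap, o, x.right⟩
  | .cross a _ _ => ⟨x.left, .cup, a, x.right⟩

theorem IsPath.oriented {s t : List Bool} {w : List Slice} (h : IsPath s w t)
    (hw : ∀ x ∈ w, x.IsFlat) : IsOrientedPath s (w.map Slice.oriented) t := by
  induction w generalizing s with
  | nil => exact h
  | cons x w ih =>
    obtain ⟨rfl, h⟩ := h
    have ih := ih h fun y hy => hw y (List.mem_cons_of_mem _ hy)
    have hx := hw x List.mem_cons_self
    obtain ⟨l, P, r⟩ := x
    cases P with
    | cup o => exact ⟨rfl, ih⟩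
    | cap o => exact ⟨rfl, ih⟩
    | cross a b f => exact absurd rfl (hx a b f)

theorem flatMap_flat {w : List Slice} (hw : ∀ x ∈ w, x.IsFlat) :
    w.flatMap Slice.flat = (w.map Slice.oriented).map OrientedSlice.flat := by
  induction w with
  | nil => rfl
  | cons x w ih =>
    have ih := ih fun y hy => hw y (List.mem_cons_of_mem _ hy)
    have hx := hw x List.mem_cons_self
    rw [List.flatMap_cons, ih]
    obtain ⟨l, P, r⟩ := x
    cases P with
    | cup o => rfl
    | cap o => rfl
    | cross a b f => exact absurd rfl (hx a b f)

/-- All of the points `0, …, N - 1` are matched. -/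
def IsComplete (N : ℕ) (m : ℕ → Option ℕ) : Prop := ∀ i < N, ∃ j, m i = some j

theorem IsComplete.step {x : Slice} (hx : x.IsFlat) {m : ℕ → Option ℕ}
    (h : IsComplete (x.src.length + 1) m) :
    IsComplete (x.tgt.length + 1) (linkStep x.left.length x.oriented.piece m) := by
  intro i hi
  obtain ⟨l, P, r⟩ := x
  cases P with
  | cup o =>
    change ∃ j, linkStep l.length .cup m i = some j
    rcases shift_cases l.length 2 i with ⟨i, rfl⟩ | h3
    · obtain ⟨j, hj⟩ := h i (by
        refine (shift_lt_add (l := l.length) (k := 2) ?_).1 ?_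
        · simp [Slice.src, Piece.src]; omega
        · convert hi using 1
          simp [Slice.src, Piece.src, Slice.tgt, Piece.tgt]; omega)
      exact ⟨_, by rw [linkStep_cup_shift, hj]; rfl⟩
    · obtain rfl | rfl : i = l.length ∨ i = l.length + 1 := by omega
      · exact ⟨_, linkStep_cup_left _ _⟩
      · exact ⟨_, linkStep_cup_right _ _⟩
  | cap o =>
    change ∃ j, linkStep l.length .cap m i = some j
    have hlen : (Slice.mk l (.cap o) r).src.length + 1 = l.length + r.length + 1 + 2 := by
      simp [Slice.src, Piece.src]; omega
    have hlen' : (Slice.mk l (.cap o) r).tgt.length + 1 = l.length + r.length + 1 := by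
      simp [Slice.tgt, Piece.tgt]
    rw [hlen] at h
    rw [hlen'] at hi
    obtain ⟨j, hj⟩ := h (shift l.length 2 i) ((shift_lt_add (by omega)).2 hi)
    obtain ⟨j₀, h0⟩ := h l.length (by omega)
    obtain ⟨j₁, h1⟩ := h (l.length + 1) (by omega)
    simp only [linkStep, hj, Option.bind_some, h0, h1, Option.map_some]
    split_ifs <;> exact ⟨_, rfl⟩
  | cross a b f => exact absurd rfl (hx a b f)

open LaurentPolynomial

/-- The weights of a single colour that measure how much a strand turns. -/
noncomputable def turnWeight (k : ℤ) (_ : Unit) : ℤ[T;T⁻¹] := T k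

/-- With one colour there is a single colouring, so every slice acts as a scalar, a power of q. -/
theorem orientedOp_turnWeight {w : List Slice} (hw : ∀ x ∈ w, x.IsFlat)
    (v : (ℕ → Unit) → ℤ[T;T⁻¹]) (c : ℕ → Unit) :
    orientedOp (turnWeight 1) (turnWeight (-1)) 0 (w.map Slice.oriented) v c =
      T (balance w) * v c := by
  induction w generalizing v c with
  | nil => simp [orientedOp, balance]
  | cons x w ih =>
    have ih := ih fun y hy => hw y (List.mem_cons_of_mem _ hy)
    have hx := hw x List.mem_cons_self
    rw [List.map_cons, orientedOp, Module.End.mul_apply, ih, show x :: w = [x] ++ w from rfl,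
      balance_append, add_comm, T_add, mul_assoc]
    congr 1
    have hv : ∀ d, v d = v c := fun d => congrArg v (Subsingleton.elim _ _)
    obtain ⟨l, P, r⟩ := x
    cases P with
    | cup o =>
      change liftN l.length (cupOp _) v c = _
      rw [liftN_apply]
      have hcup : ∀ (g : Unit → ℤ[T;T⁻¹]) v (c : ℕ → Unit),
          cupOp g v c = g (c 0) * v (stail (stail c)) :=
        fun g v c => by simp [cupOp]
      rw [hcup, hv]
      cases o <;> simp [balance, Slice.balance, Slice.oriented, turnWeight]
    | cap o =>
      change liftN l.length (capOp _) v c = _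
      rw [liftN_apply, capOp_apply]
      simp only [hv, Finset.univ_unique, Finset.sum_singleton]
      cases o <;> simp [balance, Slice.balance, Slice.oriented, turnWeight]
    | cross a b f => exact absurd rfl (hx a b f)

/-- The contribution of slice number `k` to the turning number. -/
noncomputable def loopSignNat (w : List Slice) (k : ℕ) : ℤ :=
  if h : k < w.length then loopSign w ⟨k, h⟩ else 0

/-- A maximum that completes a loop contributes q for a clockwise and q⁻¹ for a counterclockwise
loop. Completeness excludes strands with two interior ends, whose factor would be 0. -/
theorem stepFactor_turnWeight {a : Bool} {t : List Bool} {w₁ w₂ : List Slice} {x : Slice}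
    (h : IsPath [a] (w₁ ++ x :: w₂) t) (hw : ∀ y ∈ w₁ ++ x :: w₂, y.IsFlat)
    (hc : IsComplete (x.src.length + 1)
      (linkFrom startLink ((w₁.map Slice.oriented).map OrientedSlice.flat))) :
    stepFactor (turnWeight 1) (turnWeight (-1)) 0
        (linkFrom startLink ((w₁.map Slice.oriented).map OrientedSlice.flat)) x.left.length
        x.oriented.o x.oriented.piece = T (-loopSignNat (w₁ ++ x :: w₂) w₁.length) := by
  have h' := h.oriented hw
  have hx := hw x (by simp)
  have hget : (w₁ ++ x :: w₂)[w₁.length]'(by simp) = x := by simp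
  rw [loopSignNat, dif_pos (by simp)]
  unfold loopSign
  simp only [Fin.getElem_fin, hget]
  rw [flatMap_flat hw]
  rw [List.map_append, List.map_cons] at h' ⊢
  have key := isTopOfLoop_iff h'
  rw [List.length_map] at key
  obtain ⟨l, P, r⟩ := x
  cases P with
  | cup o => simp [stepFactor, Slice.oriented]
  | cap o =>
    obtain ⟨j, hj⟩ := hc l.length (by simp [Slice.src])
    have key := key rfl
    change IsTopOfLoop _ w₁.length l.length ↔
      linkFrom startLink ((w₁.map Slice.oriented).map OrientedSlice.flat) l.length =
        some (l.length + 1) at key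
    generalize linkFrom startLink ((w₁.map Slice.oriented).map OrientedSlice.flat) = m at *
    simp only [Slice.oriented, stepFactor]
    have hne : ¬ (m l.length = none ∧ m (l.length + 1) = none) := by simp [hj]
    rw [if_neg hne]
    split_ifs <;> simp_all [turnWeight, Slice.oriented]
  | cross a b f => exact absurd rfl (hx a b f)

theorem closedFactor_turnWeight {a : Bool} {s t : List Bool} {w₁ w₂ : List Slice}
    (h₁ : IsPath [a] w₁ s) (h : IsPath s w₂ t) (hw : ∀ y ∈ w₁ ++ w₂, y.IsFlat)
    (hc : IsComplete (s.length + 1)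
      (linkFrom startLink ((w₁.map Slice.oriented).map OrientedSlice.flat))) :
    closedFactor (turnWeight 1) (turnWeight (-1)) 0
        (linkFrom startLink ((w₁.map Slice.oriented).map OrientedSlice.flat))
        (w₂.map Slice.oriented) =
      T (-∑ k ∈ Finset.range w₂.length, loopSignNat (w₁ ++ w₂) (w₁.length + k)) ∧
    IsComplete (t.length + 1)
      (linkFrom startLink (((w₁ ++ w₂).map Slice.oriented).map OrientedSlice.flat)) := by
  induction w₂ generalizing w₁ s with
  | nil =>
    obtain rfl : s = t := h
    simpa [closedFactor] using hc
  | cons x w₂ ih =>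
    obtain ⟨rfl, h⟩ := h
    have hx : x.IsFlat := hw x (by simp)
    have hleft : x.oriented.left = x.left := by
      obtain ⟨l, P, r⟩ := x
      cases P <;> rfl
    have hlink : linkFrom startLink (((w₁ ++ [x]).map Slice.oriented).map OrientedSlice.flat) =
        linkStep x.left.length x.oriented.piece
          (linkFrom startLink ((w₁.map Slice.oriented).map OrientedSlice.flat)) := by
      rw [List.map_append, List.map_append, List.map_singleton, List.map_singleton, linkFrom_concat,
        OrientedSlice.flat, hleft]
    have happ : w₁ ++ x :: w₂ = w₁ ++ [x] ++ w₂ := by simp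
    have hfull : IsPath [a] (w₁ ++ x :: w₂) t := h₁.append ⟨rfl, h⟩
    have := ih (w₁ := w₁ ++ [x]) (h₁.append ⟨rfl, rfl⟩) h (by rwa [← happ])
      (by rw [hlink]; exact hc.step hx)
    rw [← happ, hlink] at this
    refine ⟨?_, this.2⟩
    rw [List.map_cons, closedFactor, hleft, this.1, stepFactor_turnWeight hfull hw hc, ← T_add,
      List.length_cons, Finset.sum_range_succ']
    congr 1
    simp only [List.length_append, List.length_singleton, add_zero, neg_add, add_assoc,
      add_comm 1]

/-- The smoothed diagram with one colour is evaluated twice: slice by slice it gives q to the power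
`balance`, and by components it gives q to the power -τ. The arc through the additional strand has
the same weight at the bottom and at the top and cancels. -/
theorem Tangle.turningNumber_eq {a : Bool} (T : Tangle [a] [a]) :
    T.turningNumber = -balance T.word := by
  have hw : ∀ x ∈ smooth T.word, x.IsFlat := fun x hx => isFlat_of_mem_smooth hx
  have hp := T.isPath.smooth
  have hm := isMatching_startLink a
  have hop := hp.oriented hw
  have hm' := isMatching_linkFrom hop hm
  have hc : IsComplete ([a].length + 1) startLink := by
    intro i hi
    change i < 2 at hi
    unfold startLink
    split_ifs
    · exact ⟨_, rfl⟩
    · exact ⟨_, rfl⟩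
    · omega
  obtain ⟨h1, h2⟩ := closedFactor_turnWeight (w₁ := []) (w₂ := smooth T.word) rfl hp hw hc
  have h3 := orientedOp_matchingValue (u := turnWeight 1) (u' := turnWeight (-1)) (ω := 0)
    (fun _ => T_one_mul_T_neg_one) (by simp) hop hm
  have h4 := congrFun h3 fun _ => ()
  rw [orientedOp_turnWeight hw, balance_smooth, Pi.smul_apply, smul_eq_mul] at h4
  have hval : ∀ m, IsMatching ([a].length + 1) (orientAt a [a]) m → IsComplete ([a].length + 1) m →
      matchingValue (turnWeight 1) 0 ([a].length + 1) (orientAt a [a]) m (fun _ => ()) =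
        LaurentPolynomial.T (if a then 1 else 0) := by
    intro m h5 h6
    obtain ⟨j, hj⟩ := h6 0 (by simp)
    have h7 := h5.lt' hj
    have h8 := h5.ne _ _ hj
    obtain rfl : j = 1 := by
      rw [List.length_singleton] at h7
      omega
    rw [matchingValue, List.length_singleton, Finset.prod_range_succ, Finset.prod_range_one,
      pointWeight_mul h5 hj]
    cases a <;> simp [arcWeight, orientAt, turnWeight]
  rw [hval _ hm hc, hval _ hm' h2] at h4
  change closedFactor _ _ _ startLink _ = _ at h1
  rw [h1, ← T_add, ← T_add] at h4
  have h5 := T_injective h4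
  have h6 : T.turningNumber = ∑ k ∈ Finset.range (smooth T.word).length,
      loopSignNat (smooth T.word) k := by
    rw [Finset.sum_range]
    exact Finset.sum_congr rfl fun k _ => by rw [loopSignNat, dif_pos k.2]
  simp only [List.nil_append, List.length_nil, zero_add, ← h6] at h5
  omega

/-! ### The expansion of a diagram with orientations -/

/-- A picture that replaces a crossing with orientations `a`, `b`, as an oriented diagram. -/
def Picture.orientedWord (l r : List Bool) (a b : Bool) : Picture → List OrientedSlice
  | .vertical => []
  | .horizontal => [⟨l, .cap, a, r⟩, ⟨l, .cup, b, r⟩]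
  | .slash => [⟨l ++ [a], .death, b, r⟩, ⟨l, .birth, b, a :: r⟩]
  | .backslash => [⟨l, .death, a, b :: r⟩, ⟨l ++ [b], .birth, a, r⟩]
  | .leftEdge => [⟨l ++ [a], .death, b, r⟩, ⟨l ++ [a], .birth, a, r⟩]
  | .rightEdge => [⟨l, .death, a, b :: r⟩, ⟨l, .birth, b, b :: r⟩]
  | .bottomEdge => [⟨l, .cap, a, r⟩, ⟨l, .birth, a, r⟩, ⟨l, .birth, b, a :: r⟩]
  | .topEdge => [⟨l, .death, a, b :: r⟩, ⟨l, .death, b, r⟩, ⟨l, .cup, b, r⟩]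
  | .ticks => [⟨l, .death, a, b :: r⟩, ⟨l, .death, b, r⟩, ⟨l, .birth, a, r⟩, ⟨l, .birth, b, a :: r⟩]

/-- The terms that replace a slice, with orientations. -/
noncomputable def Slice.orientedTerms (x : Slice) : List (ℤ[T;T⁻¹] × List OrientedSlice) :=
  match x.piece with
  | .cup o => [(1, [⟨x.left, .cup, o, x.right⟩])]
  | .cap o => [(1, [⟨x.left, .cap, o, x.right⟩])]
  | .cross a b f =>
      (crossingTerms a b f).map fun t => (t.1, t.2.orientedWord x.left x.right a b)

/-- The expansion of a diagram, with orientations. -/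
noncomputable def orientedExpand : List Slice → List (ℤ[T;T⁻¹] × List OrientedSlice)
  | [] => [(1, [])]
  | x :: w => x.orientedTerms.flatMap fun t =>
      (orientedExpand w).map fun t' => (t.1 * t'.1, t.2 ++ t'.2)

/-- Forget the orientations of a term. -/
def flatTerm {K : Type*} (t : K × List OrientedSlice) : K × List FlatSlice :=
  (t.1, t.2.map OrientedSlice.flat)

theorem Picture.map_flat_orientedWord (l r : List Bool) (a b : Bool) (P : Picture) :
    (P.orientedWord l r a b).map OrientedSlice.flat = P.word l.length r.length := by
  cases P <;> simp [orientedWord, word, OrientedSlice.flat]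

theorem Slice.terms_eq (x : Slice) : x.terms = x.orientedTerms.map flatTerm := by
  obtain ⟨l, P, r⟩ := x
  cases P with
  | cup o => rfl
  | cap o => rfl
  | cross a b f =>
    simp only [terms, orientedTerms, List.map_map]
    refine List.map_congr_left fun t _ => ?_
    simp [flatTerm, Picture.map_flat_orientedWord]

theorem expand_eq (w : List Slice) : expand w = (orientedExpand w).map flatTerm := by
  induction w with
  | nil => rfl
  | cons x w ih =>
    rw [expand, orientedExpand, ih, x.terms_eq, List.map_flatMap, List.flatMap_map]
    refine List.flatMap_congr fun t _ => ?_
    simp [flatTerm, Function.comp_def]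

/-- The pictures that occur in the expansion of a crossing with orientations `a`, `b`. -/
def Picture.Fits (a b : Bool) : Picture → Prop
  | .vertical => a = b
  | .leftEdge => a = b
  | .rightEdge => a = b
  | .horizontal => b = !a
  | .bottomEdge => b = !a
  | .topEdge => b = !a
  | _ => True

theorem fits_of_mem_crossingTerms {a b f : Bool} {t : ℤ[T;T⁻¹] × Picture}
    (h : t ∈ crossingTerms a b f) : t.2.Fits a b := by
  simp only [crossingTerms, List.mem_cons, List.not_mem_nil, or_false] at h
  rcases h with rfl | rfl | rfl | rfl | rfl | rfl | rfl <;> cases a <;> cases b <;>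
    simp [smoothing, rightToLeft, rightSide, leftToRight, leftSide, Picture.Fits]

theorem Picture.isOrientedPath_orientedWord {l r : List Bool} {a b : Bool} {P : Picture}
    (h : P.Fits a b) :
    IsOrientedPath (l ++ [a, b] ++ r) (P.orientedWord l r a b) (l ++ [b, a] ++ r) := by
  cases P <;> simp only [Fits] at h <;> first | subst h | skip
  all_goals simp [orientedWord, IsOrientedPath, OrientedSlice.src, OrientedSlice.tgt,
    OrientedSlice.pieceSrc, OrientedSlice.pieceTgt]

theorem Slice.isOrientedPath_of_mem {x : Slice} {t : ℤ[T;T⁻¹] × List OrientedSlice}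
    (h : t ∈ x.orientedTerms) : IsOrientedPath x.src t.2 x.tgt := by
  obtain ⟨l, P, r⟩ := x
  cases P with
  | cup o => obtain rfl := List.mem_singleton.1 h; exact ⟨rfl, rfl⟩
  | cap o => obtain rfl := List.mem_singleton.1 h; exact ⟨rfl, rfl⟩
  | cross a b f =>
    obtain ⟨t, ht, rfl⟩ := List.mem_map.1 h
    exact Picture.isOrientedPath_orientedWord (fits_of_mem_crossingTerms ht)

theorem isOrientedPath_of_mem_orientedExpand {s u : List Bool} {w : List Slice}
    (hw : IsPath s w u) {t : ℤ[T;T⁻¹] × List OrientedSlice} (h : t ∈ orientedExpand w) :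
    IsOrientedPath s t.2 u := by
  induction w generalizing s t with
  | nil => obtain rfl := List.mem_singleton.1 h; exact hw
  | cons x w ih =>
    obtain ⟨rfl, hw⟩ := hw
    obtain ⟨t₁, h1, h⟩ := List.mem_flatMap.1 h
    obtain ⟨t₂, h2, rfl⟩ := List.mem_map.1 h
    exact isOrientedPath_append.2 ⟨_, Slice.isOrientedPath_of_mem h1, ih hw h2⟩

/-! ### The operators of the terms -/

section Operators

variable {K : Type*} [CommRing K]

/-- The operator of a crossingless diagram. -/
def signOp (D : List OrientedSlice) : Module.End K ((ℕ → Bool) → K) :=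
  orientedOp signWeight signWeight endWeight D

/-- `Picture.weight` is the operator of the picture with the signs of its extrema but without their
powers of -q. The orientations must fit for arcs between corners to be coherent. -/
theorem signOp_orientedWord {l r : List Bool} {a b : Bool} {P : Picture} (h : P.Fits a b) :
    signOp (K := K) (P.orientedWord l r a b) = liftN l.length (crossOp (P.weight a b)) := by
  have key : ∀ (r : List Bool), signOp (K := K) (P.orientedWord [] r a b) =
      crossOp (P.weight a b) := by
    intro r
    ext v c
    obtain ⟨x, c, rfl⟩ := exists_scons c
    obtain ⟨y, c, rfl⟩ := exists_scons c
    cases P <;> simp only [Picture.Fits] at h <;> first | subst h | skip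
    all_goals
      simp only [Picture.orientedWord, signOp, orientedOp, orientedSliceOp, List.length_nil,
        List.nil_append, List.length_singleton, liftN_zero, liftN_succ, Module.End.mul_apply,
        Module.End.one_apply, one_mul, birthOp_apply, cupOp_apply, capOp_apply, deathOp_apply,
        lift_apply, crossOp_apply, Fintype.sum_bool, Picture.weight, colourSign, signWeight,
        endWeight]
    all_goals cases x <;> cases y <;> try cases a
    all_goals simp [add_comm]
  have hl : signOp (K := K) (P.orientedWord l r a b) =
      liftN l.length (signOp (P.orientedWord [] r a b)) := by
    cases P <;> simp [Picture.orientedWord, signOp, orientedOp, orientedSliceOp, liftN_mul,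
      liftN_add, liftN_one]
  rw [hl, key]

end Operators

theorem crossOp_crossWeight (a b f : Bool) :
    crossOp (crossWeight (K := ℤ[T;T⁻¹]) (T 1) (T (-1)) a b f) =
      ((crossingTerms a b f).map fun t => t.1 • crossOp (t.2.weight a b)).sum := by
  ext1 v
  funext c
  obtain ⟨x, c, rfl⟩ := exists_scons c
  obtain ⟨y, c, rfl⟩ := exists_scons c
  simp only [crossingTerms, List.map_cons, List.map_nil, List.sum_cons, List.sum_nil, add_zero,
    LinearMap.add_apply, LinearMap.smul_apply, Pi.add_apply, Pi.smul_apply, smul_eq_mul,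
    crossOp_apply, Finset.mul_sum, ← Finset.sum_add_distrib]
  refine Finset.sum_congr rfl fun x' _ => Finset.sum_congr rfl fun y' _ => ?_
  rw [crossWeight]
  ring

/-- The power of -q splits off from the sign of the colour and depends only on the oriented piece,
so it is common to all terms of the expansion. -/
theorem sliceOp_eq (x : Slice) : sliceOp (K := ℤ[T;T⁻¹]) (T 1) (T (-1)) x =
    ((negQ ^ x.balance : (ℤ[T;T⁻¹])ˣ) : ℤ[T;T⁻¹]) •
      (x.orientedTerms.map fun t => t.1 • signOp t.2).sum := by
  obtain ⟨l, P, r⟩ := x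
  cases P with
  | cup o =>
    have h : cupOp (cupWeight (K := ℤ[T;T⁻¹]) (T 1) o) =
        ((negQ ^ (if o then 1 else 0 : ℤ) : (ℤ[T;T⁻¹])ˣ) : ℤ[T;T⁻¹]) •
          cupOp fun c => if o then signWeight c else 1 := by
      ext1 v
      funext c
      obtain ⟨x, c, rfl⟩ := exists_scons c
      obtain ⟨y, c, rfl⟩ := exists_scons c
      cases o <;> cases x <;> cases y <;>
        simp [cupOp_apply, cupWeight, colourSign, signWeight, negQ]
    simp [sliceOp, pieceOp, Slice.orientedTerms, Slice.balance, h, liftN_smul, signOp, orientedOp,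
      orientedSliceOp]
  | cap o =>
    have h : capOp (capWeight (K := ℤ[T;T⁻¹]) (T (-1)) o) =
        ((negQ ^ (if o then 0 else -1 : ℤ) : (ℤ[T;T⁻¹])ˣ) : ℤ[T;T⁻¹]) •
          capOp fun c => if o then 1 else signWeight c := by
      ext1 v
      funext c
      cases o <;> simp [capOp_apply, capWeight, colourSign, signWeight, negQ, mul_add]
    simp [sliceOp, pieceOp, Slice.orientedTerms, Slice.balance, h, liftN_smul, signOp, orientedOp,
      orientedSliceOp]
  | cross a b f =>
    simp only [sliceOp, pieceOp, Slice.orientedTerms, Slice.balance, zpow_zero, Units.val_one,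
      one_smul, crossOp_crossWeight, liftN_listSum, List.map_map]
    congr 1
    refine List.map_congr_left fun t ht => ?_
    simp [liftN_smul, signOp_orientedWord (fits_of_mem_crossingTerms ht)]

theorem sum_mul_sum {R : Type*} [Ring R] (l l' : List R) :
    l'.sum * l.sum = (l.flatMap fun x => l'.map fun y => y * x).sum := by
  induction l with
  | nil => simp
  | cons x l ih => simp [mul_add, ih, List.sum_map_mul_right]

/-- The operator of a diagram through its expansion. -/
theorem wordOp_eq (w : List Slice) : wordOp (K := ℤ[T;T⁻¹]) (T 1) (T (-1)) w =
    ((negQ ^ balance w : (ℤ[T;T⁻¹])ˣ) : ℤ[T;T⁻¹]) •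
      ((orientedExpand w).map fun t => t.1 • signOp t.2).sum := by
  induction w with
  | nil => simp [wordOp, balance, orientedExpand, signOp, orientedOp]
  | cons x w ih =>
    rw [wordOp, ih, sliceOp_eq, smul_mul_smul_comm, sum_mul_sum, ← Units.val_mul, ← zpow_add,
      show x :: w = [x] ++ w from rfl, balance_append, add_comm (balance w)]
    congr 2
    · simp [balance]
    · simp [orientedExpand, List.flatMap_map, List.map_flatMap, Function.comp_def, signOp,
        orientedOp_append, smul_smul, mul_comm]

/-- The state sum is, up to a power of `-q`, the value of the operator of the diagram. -/
theorem Tangle.wordOp_apply {a : Bool} (T : Tangle [a] [a]) (c : ℕ → Bool) (h0 : c 0 = true)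
    (h1 : c 1 = true) :
    wordOp (K := ℤ[T;T⁻¹]) (LaurentPolynomial.T 1) (LaurentPolynomial.T (-1)) T.word
        (fun c => arcWeight signWeight a (c 0) (c 1)) c =
      ((negQ ^ balance T.word : (ℤ[T;T⁻¹])ˣ) : ℤ[T;T⁻¹]) * (signWeight a * T.Delta) := by
  have hsum : ∀ (l : List (ℤ[T;T⁻¹] × List OrientedSlice)),
      (∀ t ∈ l, IsOrientedPath [a] t.2 [a]) →
      (l.map fun t => t.1 • signOp t.2).sum (fun c => arcWeight signWeight a (c 0) (c 1)) c =
        signWeight a * ((l.map flatTerm).map fun t => open Classical in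
          if ¬ HasLoop t.2 ∧ HasThroughStrand t.2 then t.1 else 0).sum := by
    intro l hl
    induction l with
    | nil => simp
    | cons t l ih =>
      rw [List.map_cons, List.sum_cons, LinearMap.add_apply, Pi.add_apply,
        ih fun t ht => hl t (List.mem_cons_of_mem _ ht), LinearMap.smul_apply, Pi.smul_apply, signOp,
        orientedOp_signWeight (hl t List.mem_cons_self) c h0 h1, List.map_cons, List.map_cons,
        List.sum_cons, mul_add, smul_eq_mul]
      congr 1
      by_cases h : ¬ HasLoop (t.2.map OrientedSlice.flat) ∧
          HasThroughStrand (t.2.map OrientedSlice.flat)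
      · rw [if_pos h, mul_comm]
        exact congrArg _ (if_pos h).symm
      · rw [if_neg h, mul_zero]
        exact (mul_eq_zero_of_right _ (if_neg h)).symm
  rw [wordOp_eq, LinearMap.smul_apply, Pi.smul_apply, smul_eq_mul,
    hsum _ fun t ht => isOrientedPath_of_mem_orientedExpand T.isPath ht, Tangle.Delta, expand_eq]

/-- The closing maximum is the last one, so cutting there leaves the tangle with the additional
strand on its right. The initial minimum supplies the starting arc, and the expansion of the
operator yields Δ times the power of -q. -/
theorem Tangle.stateInvariant_closure {a : Bool} (T : Tangle [a] [a]) :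
    stateInvariant (K := ℤ[T;T⁻¹]) (LaurentPolynomial.T 1) (LaurentPolynomial.T (-1)) T.closure.word =
      ((negQ ^ (-T.turningNumber) : (ℤ[T;T⁻¹])ˣ) : ℤ[T;T⁻¹]) * T.Delta := by
  have hv : sliceOp (K := ℤ[T;T⁻¹]) (LaurentPolynomial.T 1) (LaurentPolynomial.T (-1)) ⟨[], .cup a, []⟩ 1 =
      (if a then -LaurentPolynomial.T 1 else 1 : ℤ[T;T⁻¹]) •
        fun c : ℕ → Bool => arcWeight signWeight a (c 0) (c 1) := by
    funext c
    obtain ⟨x, c, rfl⟩ := exists_scons c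
    obtain ⟨y, c, rfl⟩ := exists_scons c
    change cupOp _ _ _ = _
    cases a <;> cases x <;> cases y <;>
      simp [cupOp_apply, cupWeight, colourSign, signWeight, arcWeight]
  change stateInvariant _ _ (⟨[], .cup a, []⟩ :: whisker [] T.word [!a] ++ [⟨[], .cap a, []⟩]) = _
  rw [stateInvariant_concat, wordValue, wordOp, wordOp_whisker,
    Module.End.mul_apply, hv, map_smul, Pi.smul_apply, smul_eq_mul, List.length_nil, liftN_zero,
    T.wordOp_apply _ rfl rfl, T.turningNumber_eq, neg_neg]
  -- For an upward tangle the factors p of the cut, -q of the minimum and -1 of the through arc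
  -- multiply to 1; for a downward one all three are 1.
  cases a
  · simp [signWeight]
  · have := T_one_mul_T_neg_one
    simp only [if_true, signWeight]
    linear_combination
      (((negQ ^ balance T.word : (ℤ[T;T⁻¹])ˣ) : ℤ[T;T⁻¹]) * T.Delta) * this

end TangleDiagram
open TangleDiagram in
/-- There is exactly one isotopy invariant of oriented links that is `1` on the unknot and satisfies
the Alexander–Conway skein relation, the Alexander polynomial `A`, and `(-q) ^ (-τ(T)) Δ(T)` is its
value at the closure of `T`, for every oriented tangle diagram `T` with two endpoints. -/
theorem mainTheorem1 :
    (∃! A : LinkDiagram → LaurentPolynomial ℤ, IsAlexanderPolynomial A) ∧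
    ∀ A : LinkDiagram → LaurentPolynomial ℤ, IsAlexanderPolynomial A →
      ∀ (a : Bool) (T : Tangle [a] [a]),
        ((negQ ^ (-T.turningNumber) : (LaurentPolynomial ℤ)ˣ) : LaurentPolynomial ℤ) * T.Delta =
          A T.closure := by
  refine ⟨⟨_, isAlexanderPolynomial_stateInvariant,
    fun A h => h.unique isAlexanderPolynomial_stateInvariant⟩, fun A h a T => ?_⟩
  rw [h.unique isAlexanderPolynomial_stateInvariant]
  exact T.stateInvariant_closure.symm
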